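/- Let $m\ge n$, $r\ge 2$, $r\le n$, $d-r\ge 2$, $\tau\ge 0$, and let $A\in\mathbb C^{m\times n}$ have singular values $\sigma_1\ge\dots\ge\sigma_n\ge 0$ with $\sigma_r>0$ (that is, $\operatorname{rank}A\ge r$); put $\sigma_{n+1}=0$. Let $A=U\Sigma V^H$ be any SVD, with $U\in\mathbb C^{m\times n}$, $V\in\mathbb C^{n\times n}$ having orthonormal columns, $\Sigma=\operatorname{diag}(\sigma_1,\dots,\sigma_n)$, $V=(V_r\;V_0)$ and $\Sigma_0=\operatorname{diag}(\sigma_{r+1},\dots,\sigma_n)$, where $V_r$ consists of the first $r$ columns of $V$. Put $\alpha=\sigma_{r+1}/\sigma_r$, and for a test matrix $\Omega\in\mathbb R^{n\times d}$ let $\Lambda_1=V_r^H\Omega$, $\Lambda_2=V_0^H\Omega$; $M^\dagger$ denotes the Moore–Penrose inverse. *Algorithm (EOD-ABE with subspace iteration), in exact arithmetic.* Input: $A$, $\Omega=(\Omega_1,\dots,\Omega_s)$ with blocks of $k$ columns ($1\le k\le n$, $d=sk$), a precision $\varepsilon>0$, and $\tau$. 1. Basis extraction: for $j=1,\dots,s$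 compute a QR decomposition $\bigl(I-\sum_{i<j}Q_iQ_i^H\bigr)A\Omega_j=Q_jR_j$; if some $|R_j(l,l)|<\varepsilon$, take the smallest such $l$, stop and return $Q^{(0)}=[Q_1,\dots,Q_{j-1},Q_j(:,1{:}l-1)]$. If this never happens, return $Q^{(0)}=[Q_1,\dots,Q_s]$. 2. For $j=1,\dots,\tau$ compute QR decompositions $A^HQ^{(j-1)}=\tilde Q_j\tilde R_j$ and $A\tilde Q_j=Q^{(j)}R^{(j)}$. 3. Compute QR decompositions $(Q^{(\tau)H}A)^H=QR$ and $R^H=\hat Q\hat R$, and return $\tilde A=(Q^{(\tau)}\hat Q)\,\hat R\,Q^H$. A run is called *exact* if the diagonal entry that stops step 1 (if there is one) equals $0$, that is, if the precision is so fine that no nonzero diagonal entry is discarded. The QR decompositions may be chosen arbitrarily. Then: (i) For every $\Omega\in\mathbb R^{n\times d}$ with $\operatorname{rank}\Lambda_1=r$, every run of the algorithm in which the number of columns of $Q^{(0)}$ is $\operatorname{rank}(A\Omega)$ satisfies $$\|A-\tilde A\|_F^2\le \alpha^{2\tau}\|\Sigma_0\Lambda_2\Lambda_1^\dagger\|_F^2+\|\Sigma_0\|_F^2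 .\qquad(*)$$ (ii) If $\Omega$ is a standard Gaussian matrix (independent real $N(0,1)$ entries), then almost surely $\operatorname{rank}\Lambda_1=r$ and $(*)$ holds for every exact run of the algorithm. (iii) If $\Omega$ is a standard Gaussian matrix and $\tilde A$ is the output of runs of the algorithm on $\Omega$ that are almost surely exact (where the precision may depend on $\Omega$), then $\|A-\tilde A\|_F$ is integrable and $$\mathbb E\|A-\tilde A\|_F\le\Bigl(1+\frac{r\,\alpha^{2\tau}}{d-r-1}\Bigr)^{1/2}\Bigl(\sum_{j>r}\sigma_j^2\Bigr)^{1/2}.$$ -/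

import Mathlib

open MeasureTheory ProbabilityTheory
open scoped Matrix

/- The norm `‖·‖` of a matrix is the Frobenius norm throughout. -/
attribute [local instance] Matrix.frobeniusNormedAddCommGroup

namespace EOD

/-! ### The Moore–Penrose inverse -/

/-- The four Penrose equations: `X` is the Moore–Penrose inverse of `M`. -/
structure IsMoorePenrose {p q : ℕ} (M : Matrix (Fin p) (Fin q) ℂ)
    (X : Matrix (Fin q) (Fin p) ℂ) : Prop where
  mul_mul_left : M * X * M = M
  mul_mul_right : X * M * X = X
  herm_left : (M * X).IsHermitian
  herm_right : (X * M).IsHermitian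

open scoped ComplexOrder in
/-- Every complex matrix has a Moore–Penrose inverse. -/
theorem exists_isMoorePenrose {p q : ℕ} (M : Matrix (Fin p) (Fin q) ℂ) :
    ∃ X, IsMoorePenrose M X := by
  have hH : (Mᴴ * M).IsHermitian := Matrix.isHermitian_conjTranspose_mul_self M
  set H := Mᴴ * M with hHdef
  let E : Matrix (Fin q) (Fin q) ℂ := hH.eigenvectorUnitary
  let L : Fin q → ℂ := fun i => (hH.eigenvalues i : ℂ)
  have hE : Eᴴ * E = 1 := Unitary.coe_star_mul_self hH.eigenvectorUnitary
  have hspec : H = E * Matrix.diagonal L * Eᴴ := by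
    have h := hH.spectral_theorem
    rw [Unitary.conjStarAlgAut_apply] at h
    exact h
  let D : Matrix (Fin q) (Fin q) ℂ := E * Matrix.diagonal (fun i => (L i)⁻¹) * Eᴴ
  have key : ∀ a b : Fin q → ℂ, (E * Matrix.diagonal a * Eᴴ) * (E * Matrix.diagonal b * Eᴴ)
      = E * Matrix.diagonal (fun i => a i * b i) * Eᴴ := by
    intro a b
    calc (E * Matrix.diagonal a * Eᴴ) * (E * Matrix.diagonal b * Eᴴ)
        = E * Matrix.diagonal a * (Eᴴ * E) * Matrix.diagonal b * Eᴴ := by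
          simp only [Matrix.mul_assoc]
      _ = _ := by
          rw [hE, Matrix.mul_one, Matrix.mul_assoc E, Matrix.diagonal_mul_diagonal]
  have hDherm : Dᴴ = D := by
    have hs : star (fun i => (L i)⁻¹) = fun i => (L i)⁻¹ := by
      funext i
      simp [L]
    simp only [D, Matrix.conjTranspose_mul, Matrix.diagonal_conjTranspose,
      Matrix.conjTranspose_conjTranspose, Matrix.mul_assoc, hs]
  have hcomm : D * H = H * D := by
    rw [hspec, key, key]
    simp only [mul_comm]
  have hHDH : H * D * H = H := by
    rw [hspec, key, key]
    congr 2
    congr 1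
    funext i
    by_cases h : L i = 0 <;> simp [h]
  have hDHD : D * H * D = D := by
    rw [hspec, key, key]
    show _ = E * Matrix.diagonal (fun i => (L i)⁻¹) * Eᴴ
    congr 2
    congr 1
    funext i
    by_cases h : L i = 0 <;> simp [h]
  refine ⟨D * Mᴴ, ?_, ?_, ?_, ?_⟩
  · have h0 : Mᴴ * M * (D * H - 1) = 0 := by
      rw [Matrix.mul_sub, Matrix.mul_one, ← Matrix.mul_assoc, ← hHdef, hHDH, sub_self]
    rw [Matrix.conjTranspose_mul_self_mul_eq_zero, Matrix.mul_sub, Matrix.mul_one,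
      sub_eq_zero] at h0
    calc M * (D * Mᴴ) * M = M * (D * H) := by simp only [hHdef, Matrix.mul_assoc]
      _ = M := h0
  · calc D * Mᴴ * M * (D * Mᴴ) = D * H * D * Mᴴ := by simp only [hHdef, Matrix.mul_assoc]
      _ = D * Mᴴ := by rw [hDHD]
  · show (M * (D * Mᴴ))ᴴ = _
    simp only [Matrix.conjTranspose_mul, Matrix.conjTranspose_conjTranspose, hDherm,
      Matrix.mul_assoc]
  · show (D * Mᴴ * M)ᴴ = D * Mᴴ * M
    rw [Matrix.mul_assoc, ← hHdef, Matrix.conjTranspose_mul, hDherm, hH.eq, hcomm]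

/-- The Moore–Penrose inverse `M†`. -/
noncomputable def pinv {p q : ℕ} (M : Matrix (Fin p) (Fin q) ℂ) : Matrix (Fin q) (Fin p) ℂ :=
  Classical.choose (exists_isMoorePenrose M)

theorem pinv_spec {p q : ℕ} (M : Matrix (Fin p) (Fin q) ℂ) : IsMoorePenrose M (pinv M) :=
  Classical.choose_spec (exists_isMoorePenrose M)

/-! ### QR decompositions -/

/-- `B = Q R` is a (thin) QR decomposition: `Q` has orthonormal columns and `R` is upper
triangular. -/
structure IsQR {p q : ℕ} (B Q : Matrix (Fin p) (Fin q) ℂ) (R : Matrix (Fin q) (Fin q) ℂ) :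
    Prop where
  orthonormal : Qᴴ * Q = 1
  upper : R.BlockTriangular id
  eq : B = Q * R

/-! ### The algorithm -/

/-- A real matrix regarded as a complex one. -/
noncomputable def toC {p q : ℕ} (W : Matrix (Fin p) (Fin q) ℝ) : Matrix (Fin p) (Fin q) ℂ :=
  W.map (fun x : ℝ => (x : ℂ))

section Algorithm

variable {m n d k s : ℕ}

/-- With `d = s * k` columns grouped into `s` consecutive blocks of size `k`, the position of
column `l` of block `j` is `j * k + l`. -/
def colIdx (hd : d = s * k) : Fin s × Fin k ≃ Fin d :=
  finProdFinEquiv.trans (finCongr hd.symm)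

theorem colIdx_val (hd : d = s * k) (x : Fin s × Fin k) :
    (colIdx hd x : ℕ) = (x.1 : ℕ) * k + x.2 := by
  simp [colIdx, finProdFinEquiv, mul_comm, add_comm]

/-- The `j`-th block of `k` consecutive columns of `W`. -/
def colBlock (hd : d = s * k) (W : Matrix (Fin n) (Fin d) ℝ) (j : Fin s) :
    Matrix (Fin n) (Fin k) ℝ :=
  W.submatrix id (fun l => colIdx hd (j, l))

/-- A run of the blockwise randomized basis extraction on `A`, with test matrix `W` split into
blocks `W_0, …, W_{s-1}` of `k` columns and precision `ε`.  In round `j` one computes a QR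
decomposition `(I - ∑_{i<j} Q_i Q_iᴴ) A W_j = Q_j R_j`; at the first diagonal entry of `R_j` of
modulus `< ε` the loop is left, and the columns `Q` found before that entry are returned.
If there is no such entry, all `d` columns are returned. -/
structure BasisExt (A : Matrix (Fin m) (Fin n) ℂ) (hd : d = s * k)
    (W : Matrix (Fin n) (Fin d) ℝ) (ε : ℝ) where
  /-- The orthonormal blocks `Q_j` (blocks after the round in which the loop is left are unused). -/
  Q : Fin s → Matrix (Fin m) (Fin k) ℂ
  /-- The triangular factors `R_j`. -/
  R : Fin s → Matrix (Fin k) (Fin k) ℂ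
  /-- The number of columns that are returned. -/
  size : ℕ
  size_le : size ≤ d
  /-- The QR decompositions, for every round `j` that is reached. -/
  qr : ∀ j : Fin s, (j : ℕ) * k ≤ size →
    IsQR ((1 - ∑ i ∈ Finset.univ.filter (fun i => i < j), Q i * (Q i)ᴴ)
      * A * toC (colBlock hd W j)) (Q j) (R j)
  /-- The test does not fire on the diagonal entries belonging to the returned columns. -/
  keep : ∀ x : Fin s × Fin k, (colIdx hd x : ℕ) < size → ε ≤ ‖R x.1 x.2 x.2‖
  /-- The test fires on the next diagonal entry, if there is one. -/
  fires : ∀ x : Fin s × Fin k, (colIdx hd x : ℕ) = size → ‖R x.1 x.2 x.2‖ < ε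

/-- The returned basis: the first `size` columns of `[Q_0, Q_1, …]`. -/
def BasisExt.basis {A : Matrix (Fin m) (Fin n) ℂ} {hd : d = s * k}
    {W : Matrix (Fin n) (Fin d) ℝ} {ε : ℝ} (b : BasisExt A hd W ε) :
    Matrix (Fin m) (Fin b.size) ℂ :=
  fun i c => b.Q ((colIdx hd).symm (c.castLE b.size_le)).1 i
    ((colIdx hd).symm (c.castLE b.size_le)).2

/-- The precision is fine enough for this run: the diagonal entry that made the test fire (if it
fired) is exactly zero, so no nonzero entry has been discarded. -/
def BasisExt.Exact {A : Matrix (Fin m) (Fin n) ℂ} {hd : d = s * k}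
    {W : Matrix (Fin n) (Fin d) ℝ} {ε : ℝ} (b : BasisExt A hd W ε) : Prop :=
  ∀ x : Fin s × Fin k, (colIdx hd x : ℕ) = b.size → b.R x.1 x.2 x.2 = 0

/-- A run of the efficient orthogonal decomposition with automatic basis extraction via subspace
iteration, with `τ` power iterations. -/
structure Run (A : Matrix (Fin m) (Fin n) ℂ) (hd : d = s * k)
    (W : Matrix (Fin n) (Fin d) ℝ) (ε : ℝ) (τ : ℕ) where
  /-- The basis extraction. -/
  ext : BasisExt A hd W ε
  /-- The bases `Q_0, …, Q_τ` of the subspace iteration. -/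
  Qs : ℕ → Matrix (Fin m) (Fin ext.size) ℂ
  Qs_zero : Qs 0 = ext.basis
  /-- One power iteration: `Aᴴ Q_j = Q' R'` and `A Q' = Q_{j+1} R_{j+1}` (QR decompositions). -/
  Qs_succ : ∀ j < τ, ∃ (Q' : Matrix (Fin n) (Fin ext.size) ℂ)
    (R' R'' : Matrix (Fin ext.size) (Fin ext.size) ℂ),
    IsQR (Aᴴ * Qs j) Q' R' ∧ IsQR (A * Q') (Qs (j + 1)) R''
  /-- QR decomposition `Cᴴ = Q R` of `C = Q_τᴴ A`. -/
  Q : Matrix (Fin n) (Fin ext.size) ℂ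
  R : Matrix (Fin ext.size) (Fin ext.size) ℂ
  qr : IsQR ((Qs τ)ᴴ * A)ᴴ Q R
  /-- QR decomposition `Rᴴ = Q̂ R̂`. -/
  Qhat : Matrix (Fin ext.size) (Fin ext.size) ℂ
  Rhat : Matrix (Fin ext.size) (Fin ext.size) ℂ
  qr_hat : IsQR Rᴴ Qhat Rhat

/-- The computed approximation `Ã = U D Vᴴ` with `U = Q_τ Q̂`, `D = R̂`, `V = Q`. -/
noncomputable def Run.approx {A : Matrix (Fin m) (Fin n) ℂ} {hd : d = s * k}
    {W : Matrix (Fin n) (Fin d) ℝ} {ε : ℝ} {τ : ℕ} (ρ : Run A hd W ε τ) :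
    Matrix (Fin m) (Fin n) ℂ :=
  (ρ.Qs τ * ρ.Qhat) * ρ.Rhat * ρ.Qᴴ

end Algorithm

/-! ### Singular value decompositions -/

/-- `A = U Σ Vᴴ` is a singular value decomposition of the `m × n` matrix `A`, with `U` of size
`m × n`, `Σ` and `V` of size `n × n`.  The singular values are `σ 0 ≥ σ 1 ≥ … ≥ σ (n-1)`, and
`σ j = 0` for `j ≥ n`. -/
structure IsSVD {m n : ℕ} (A U : Matrix (Fin m) (Fin n) ℂ) (σ : ℕ → ℝ)
    (V : Matrix (Fin n) (Fin n) ℂ) : Prop where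
  antitone : Antitone σ
  eq_zero : ∀ j, n ≤ j → σ j = 0
  left : Uᴴ * U = 1
  right : Vᴴ * V = 1
  eq : A = U * Matrix.diagonal (fun j : Fin n => (σ j : ℂ)) * Vᴴ

/-- `V_r`: the first `r` columns of `V`. -/
def leading {n r : ℕ} (hr : r ≤ n) (V : Matrix (Fin n) (Fin n) ℂ) : Matrix (Fin n) (Fin r) ℂ :=
  V.submatrix id (Fin.castLE hr)

/-- `V_0`: the last `n - r` columns of `V`. -/
def trailing {n : ℕ} (r : ℕ) (V : Matrix (Fin n) (Fin n) ℂ) :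
    Matrix (Fin n) (Fin (n - r)) ℂ :=
  V.submatrix id (fun j => ⟨r + j, by omega⟩)

/-- `Σ_0`: the trailing `(n - r) × (n - r)` block of `Σ`. -/
noncomputable def trailingSigma (n r : ℕ) (σ : ℕ → ℝ) :
    Matrix (Fin (n - r)) (Fin (n - r)) ℂ :=
  Matrix.diagonal (fun j => (σ (r + j) : ℂ))

/-- The right-hand side `α^{2τ} ‖Σ_0 Λ_2 Λ_1†‖_F² + ‖Σ_0‖_F²` of the structural bound, where
`α = σ_{r+1} / σ_r`, `Λ_1 = V_rᴴ W` and `Λ_2 = V_0ᴴ W`. -/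
noncomputable def structuralBound {n r d : ℕ} (hr : r ≤ n) (σ : ℕ → ℝ)
    (V : Matrix (Fin n) (Fin n) ℂ) (τ : ℕ) (W : Matrix (Fin n) (Fin d) ℝ) : ℝ :=
  (σ r / σ (r - 1)) ^ (2 * τ)
      * ‖trailingSigma n r σ * ((trailing r V)ᴴ * toC W) * pinv ((leading hr V)ᴴ * toC W)‖ ^ 2
    + ‖trailingSigma n r σ‖ ^ 2

/-! ### Gaussian matrices -/

/-- `G` is a standard Gaussian matrix: its entries are independent real `N(0,1)` variables. -/
structure IsStdGaussian {Ω : Type*} [MeasurableSpace Ω] (P : Measure Ω) {n d : ℕ}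
    (G : Ω → Matrix (Fin n) (Fin d) ℝ) : Prop where
  law : ∀ i j, HasLaw (fun ω => G ω i j) (gaussianReal 0 1) P
  indep : iIndepFun (fun (ij : Fin n × Fin d) ω => G ω ij.1 ij.2) P

end EOD

/-!
Write `Y = (A Aᴴ)^τ A W` for a test matrix `W`. A run that extracts `rank (A W)` columns returns
`P A`, where `P` is the orthogonal projection onto the range of `Y` (`Run.exists_projection`), so
its error is the least value of `‖A - Y X‖` (`norm_sq_residual_le`). The choice
`X = Λ₁† Σ₁^{-2τ} V_rᴴ` gives the structural bound (`exists_norm_sub_powered_mul_le`). The columns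
of a Gaussian `W` are almost surely in general position (`ae_linearIndependent_mulVec`), which
gives `rank Λ₁ = r` and forces every exact run to extract `rank (A W)` columns
(`BasisExt.size_eq_rank_of_exact`).

The bound in expectation does not follow by averaging the structural bound: `W` is real and `V`
complex, so that `Λ₁` and `Λ₂` need not be independent. It suffices to bound the mean squared
error. With `B = (A Aᴴ)^τ A` and `s_j = σ_j^{2τ+1}`, the main step (`lintegral_residual_le`) is
`E ‖(1 - P) B‖² ≤ (d - 1) / (d - r - 1) · ∑_{j ≥ r} s_j²`, indices starting at `0`. It is proved in
five moves.

* `‖(1 - P) B‖²` is the mean of `|(1 - P) B x|²` over one more real Gaussian vector `x`, and this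
  is at most the reciprocal of a diagonal entry of `M⁻¹`, where `M` is the regularized Gram matrix
  of the `D = d + 1` vectors `B x` (`lintegral_residual_le_inv_realQuad`).
* By rotation invariance the coordinate vector may be replaced by a real Gaussian vector `u`, at
  the cost of the factor `E |u|⁻² = 1 / (D - 2)` (`lintegral_inv_realQuad_gramShift`).
* For fixed `M` and an orthogonal projection `Π` of rank `q > 2`,
  `E_u 1 / ⟨u, M⁻¹ u⟩ ≤ tr (Π M) / (q (q - 2))` (`lintegral_gaussVec_inv_realQuad_le`): the
  expectation is `∫ ∏ (1 + 2 t a_k)^{-1/2} dt` for the eigenvalues `a_k` of `Re M⁻¹`, and the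
  product is compared with a single power by Jensen's inequality (`log_le_sum_log_diag_inv`).
* For the projection `Π` onto the kernel of `V_rᴴ [x W]`, the trace is, up to the regularization,
  a sum of `s_j²`, `j ≥ r`, times ratios of Gram determinants (`trace_kerProj_mul_gramShift`).
* Each ratio has expectation at most `D - r` (`lintegral_gram_ratio_le`). The reciprocal of the
  denominator is a Gaussian integral over an auxiliary `ζ`; for fixed `ζ` one compares the expected
  Gram determinants of weighted samples, for which an explicit formula holds
  (`integral_det_mul_prod`), using that the weight `exp (-|mᵀ x|²)` has second moments at most its
  mean (`exists_weightedMoment_formWeight`).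

The passage from `B` back to `A` compares the residuals of the left singular vectors with weights
`σ_j^{4τ}` (`norm_sq_residual_le_powered`) and produces the factor `1 + r α^{2τ} / (d - r - 1)`.
Almost surely the error of an exact run is a function of `W` alone, and it is measurable since it
is an infimum of continuous functions (`measurable_norm_sq_residual`).
-/

namespace EOD

open scoped ENNReal

/-! ### Standard Gaussian vectors and matrices -/

/-- The law of a vector of independent standard Gaussian entries. -/
noncomputable def gaussVec (ι : Type*) [Fintype ι] : Measure (ι → ℝ) :=
  Measure.pi fun _ => gaussianReal 0 1

/-- The law of a matrix whose rows are independent standard Gaussian vectors. The test matrices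
of the algorithm have such *columns*, so that they are the transposes of the samples. -/
noncomputable def gaussMat (κ ι : Type*) [Fintype κ] [Fintype ι] : Measure (κ → ι → ℝ) :=
  Measure.pi fun _ => gaussVec ι

instance (ι : Type*) [Fintype ι] : IsProbabilityMeasure (gaussVec ι) := by
  unfold gaussVec; infer_instance

instance (κ ι : Type*) [Fintype κ] [Fintype ι] : IsProbabilityMeasure (gaussMat κ ι) := by
  unfold gaussMat; infer_instance

/-- The standard Gaussian law is invariant under orthogonal maps: it is the law of the coordinates
of a standard Gaussian in any orthonormal basis. -/
theorem gaussVec_map_mulVec {ι : Type*} [Fintype ι] [DecidableEq ι] (O : Matrix ι ι ℝ)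
    (hO : Oᵀ * O = 1) : (gaussVec ι).map (fun x => O *ᵥ x) = gaussVec ι := by
  rcases isEmpty_or_nonempty ι with _ | _
  · rw [Subsingleton.elim (fun x : ι → ℝ => O *ᵥ x) id, Measure.map_id]
  have hon : Orthonormal ℝ (fun i : ι => WithLp.toLp 2 (fun j => O j i)) := by
    rw [orthonormal_iff_ite]
    intro i j
    have := congrFun (congrFun hO i) j
    rw [Matrix.mul_apply, Matrix.one_apply] at this
    rw [← this]
    simp [PiLp.inner_apply, Matrix.transpose_apply, mul_comm]
  have hcard : Fintype.card ι = Module.finrank ℝ (EuclideanSpace ℝ ι) := by simp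
  let b0 := basisOfOrthonormalOfCardEqFinrank hon hcard
  have hb0 : ⇑b0 = fun i : ι => WithLp.toLp 2 (fun j => O j i) :=
    coe_basisOfOrthonormalOfCardEqFinrank hon hcard
  let b : OrthonormalBasis ι ℝ (EuclideanSpace ℝ ι) :=
    b0.toOrthonormalBasis (by rw [hb0]; exact hon)
  have h1 := stdGaussian_eq_map_pi_orthonormalBasis b
  rw [← map_pi_eq_stdGaussian] at h1
  have h2 := congrArg (Measure.map (WithLp.ofLp (p := 2) (V := ι → ℝ))) h1
  rw [Measure.map_map (by fun_prop) (by fun_prop),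
    Measure.map_map (by fun_prop) (by fun_prop)] at h2
  have e1 : (WithLp.ofLp (p := 2) (V := ι → ℝ)) ∘ (WithLp.toLp 2) = id := rfl
  have e2 : (WithLp.ofLp (p := 2) (V := ι → ℝ)) ∘ (fun x : ι → ℝ => ∑ i, x i • b i)
      = fun x => O *ᵥ x := by
    funext x
    funext j
    have hb : ∀ i, b i = WithLp.toLp 2 (fun j => O j i) := by
      intro i
      simp [b, hb0]
    simp [hb, Matrix.mulVec, dotProduct, mul_comm]
  rw [e1, e2, Measure.map_id] at h2
  exact h2.symm

theorem gaussVec_prod_map_curry (κ ι : Type*) [Fintype κ] [Fintype ι] :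
    (gaussVec (κ × ι)).map (fun x k i => x (k, i)) = gaussMat κ ι := by
  have h := Measure.infinitePi_map_curry (fun (_ : κ) (_ : ι) => gaussianReal 0 1)
  simp only [Measure.infinitePi_eq_pi] at h
  exact h

/-- A Gaussian matrix is invariant under orthogonal combinations of its rows. -/
theorem gaussMat_map_orthogonal {κ ι : Type*} [Fintype κ] [Fintype ι] [DecidableEq κ]
    [DecidableEq ι] (O : Matrix κ κ ℝ) (hO : Oᵀ * O = 1) :
    (gaussMat κ ι).map (fun X k i => ∑ l, O k l * X l i) = gaussMat κ ι := by
  have hK : (Matrix.kronecker O (1 : Matrix ι ι ℝ))ᵀ * Matrix.kronecker O (1 : Matrix ι ι ℝ)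
      = 1 := by
    rw [Matrix.kronecker, ← Matrix.kroneckerMap_transpose, ← Matrix.mul_kronecker_mul, hO]
    simp
  have h := gaussVec_map_mulVec (Matrix.kronecker O (1 : Matrix ι ι ℝ)) hK
  have h2 := congrArg (Measure.map (fun (x : κ × ι → ℝ) k i => x (k, i))) h
  have hm : Measurable (fun (x : κ × ι → ℝ) (k : κ) (i : ι) => x (k, i)) := by fun_prop
  have hm2 : Measurable (fun x : κ × ι → ℝ => Matrix.kronecker O (1 : Matrix ι ι ℝ) *ᵥ x) := by
    unfold Matrix.mulVec dotProduct; fun_prop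
  rw [Measure.map_map hm hm2, gaussVec_prod_map_curry] at h2
  conv_lhs => rw [← gaussVec_prod_map_curry]
  rw [Measure.map_map (by fun_prop) hm]
  rw [← h2]
  congr 1
  funext x
  funext k i
  simp [Matrix.mulVec, dotProduct, Matrix.kronecker, Fintype.sum_prod_type, Matrix.one_apply]

theorem integral_gauss_exp_neg_mul_sq {a : ℝ} (ha : 0 ≤ a) :
    ∫ x, Real.exp (-a * x ^ 2) ∂(gaussianReal 0 1) = (1 + 2 * a) ^ (-(1 / 2) : ℝ) := by
  rw [integral_gaussianReal_eq_integral_smul (by norm_num)]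
  have h2 : ∀ x : ℝ, gaussianPDFReal 0 1 x • Real.exp (-a * x ^ 2)
      = (Real.sqrt (2 * Real.pi))⁻¹ * Real.exp (-(a + 1 / 2) * x ^ 2) := by
    intro x
    simp only [gaussianPDFReal, NNReal.coe_one, mul_one, sub_zero, smul_eq_mul]
    rw [mul_assoc, ← Real.exp_add]
    ring_nf
  simp_rw [h2]
  rw [integral_const_mul, integral_gaussian]
  rw [Real.rpow_neg (by positivity), ← Real.sqrt_eq_rpow, ← Real.sqrt_inv, ← Real.sqrt_inv,
    ← Real.sqrt_mul (by positivity)]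
  congr 1
  field_simp
  ring

theorem integrable_gauss_pow_mul {f : ℝ → ℝ} (hf : Measurable f) (hb : ∀ x, |f x| ≤ 1) (p : ℕ) :
    Integrable (fun x => x ^ p * f x) (gaussianReal 0 1) := by
  have h : Integrable (fun x : ℝ => x ^ p) (gaussianReal 0 1) := by
    have := (memLp_id_gaussianReal (μ := 0) (v := 1) (p : NNReal)).integrable_norm_pow'
    rw [← integrable_norm_iff (by fun_prop)]
    simpa using this
  refine h.mul_bdd (c := 1) hf.aestronglyMeasurable (.of_forall fun x => ?_)
  simpa using hb x

theorem integral_gauss_sq : ∫ x, x ^ 2 ∂(gaussianReal 0 1) = 1 := by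
  have := variance_id_gaussianReal (μ := 0) (v := 1)
  rw [variance_eq_integral (by fun_prop)] at this
  simpa using this

/-- A weight that decreases in `|x|` decreases the second moment. -/
theorem integral_gauss_sq_mul_exp_le {a : ℝ} (ha : 0 ≤ a) :
    ∫ x, x ^ 2 * Real.exp (-a * x ^ 2) ∂(gaussianReal 0 1)
      ≤ ∫ x, Real.exp (-a * x ^ 2) ∂(gaussianReal 0 1) := by
  have hb : ∀ x : ℝ, |Real.exp (-a * x ^ 2)| ≤ 1 := by
    intro x
    rw [abs_of_pos (Real.exp_pos _), Real.exp_le_one_iff]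
    nlinarith [sq_nonneg x]
  have hm : Measurable (fun x : ℝ => Real.exp (-a * x ^ 2)) := by fun_prop
  have i2 := integrable_gauss_pow_mul hm hb 2
  have i0 := integrable_gauss_pow_mul hm hb 0
  simp only [pow_zero, one_mul] at i0
  have j2 := integrable_gauss_pow_mul (f := fun _ => 1) measurable_const (by simp) 2
  simp only [mul_one] at j2
  -- Chebyshev's argument: `(x² - 1) (exp (-a x²) - exp (-a)) ≤ 0`, and `x² - 1` has mean zero.
  have key : ∫ x, (x ^ 2 * Real.exp (-a * x ^ 2) - Real.exp (-a * x ^ 2)) ∂(gaussianReal 0 1)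
      ≤ ∫ x, Real.exp (-a) * (x ^ 2 - 1) ∂(gaussianReal 0 1) := by
    refine integral_mono (i2.sub i0) ((j2.sub (integrable_const 1)).const_mul _) ?_
    intro x
    show x ^ 2 * Real.exp (-a * x ^ 2) - Real.exp (-a * x ^ 2) ≤ Real.exp (-a) * (x ^ 2 - 1)
    rcases le_total (x ^ 2) 1 with h | h
    · have : Real.exp (-a) ≤ Real.exp (-a * x ^ 2) := Real.exp_le_exp.2 (by nlinarith)
      nlinarith
    · have : Real.exp (-a * x ^ 2) ≤ Real.exp (-a) := Real.exp_le_exp.2 (by nlinarith)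
      nlinarith
  rw [integral_sub i2 i0, integral_const_mul, integral_sub j2 (integrable_const 1),
    integral_gauss_sq] at key
  simpa using key

theorem integral_gauss_mul_exp_eq_zero (a : ℝ) :
    ∫ x, x * Real.exp (-a * x ^ 2) ∂(gaussianReal 0 1) = 0 := by
  have hmap : (gaussianReal 0 1).map (fun x : ℝ => -x) = gaussianReal 0 1 := by
    rw [gaussianReal_map_neg]; simp
  have h : ∫ x, x * Real.exp (-a * x ^ 2) ∂(gaussianReal 0 1)
      = ∫ x, -(x * Real.exp (-a * x ^ 2)) ∂(gaussianReal 0 1) := by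
    conv_lhs => rw [← hmap]
    rw [integral_map (by fun_prop) (by fun_prop)]
    simp
  rw [integral_neg] at h
  linarith

/-- `1 / (∑ aₖ xₖ²) = ∫₀^∞ exp (-t ∑ aₖ xₖ²) dt`, integrated against the Gaussian law. -/
theorem lintegral_gaussVec_inv_quadratic {ι : Type*} [Fintype ι] (a : ι → ℝ)
    (ha : ∀ i, 0 ≤ a i) :
    ∫⁻ t in Set.Ioi (0 : ℝ), ENNReal.ofReal (∏ i, (1 + 2 * (t * a i)) ^ (-(1 / 2) : ℝ))
      = ∫⁻ x, ∫⁻ t in Set.Ioi (0 : ℝ), ENNReal.ofReal (Real.exp (-t * ∑ i, a i * x i ^ 2))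
          ∂volume ∂(gaussVec ι) := by
  rw [lintegral_lintegral_swap (by fun_prop)]
  refine setLIntegral_congr_fun measurableSet_Ioi ?_
  intro t ht
  have ht0 : (0 : ℝ) < t := ht
  simp only
  have he : ∀ x : ι → ℝ, Real.exp (-t * ∑ i, a i * x i ^ 2)
      = ∏ i, Real.exp (-(t * a i) * x i ^ 2) := by
    intro x
    rw [← Real.exp_sum, Finset.mul_sum]
    congr 1
    exact Finset.sum_congr rfl fun i _ => by ring
  have hint : Integrable (fun x : ι → ℝ => ∏ i, Real.exp (-(t * a i) * x i ^ 2)) (gaussVec ι) := by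
    unfold gaussVec
    refine Integrable.fintype_prod (f := fun i (y : ℝ) => Real.exp (-(t * a i) * y ^ 2)) fun i => ?_
    have := integrable_gauss_pow_mul (f := fun y => Real.exp (-(t * a i) * y ^ 2)) (by fun_prop)
      (fun x => by
        rw [abs_of_pos (Real.exp_pos _), Real.exp_le_one_iff]
        nlinarith [sq_nonneg x, mul_nonneg ht0.le (ha i)]) 0
    simpa using this
  simp_rw [he]
  rw [← ofReal_integral_eq_lintegral_ofReal hint (.of_forall fun x => by positivity)]
  congr 1
  unfold gaussVec
  rw [integral_fintype_prod_eq_prod (f := fun i (y : ℝ) => Real.exp (-(t * a i) * y ^ 2))]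
  exact (Finset.prod_congr rfl fun i _ => integral_gauss_exp_neg_mul_sq
    (mul_nonneg ht0.le (ha i))).symm

theorem lintegral_exp_neg_mul_Ioi {b : ℝ} (hb : 0 < b) :
    ∫⁻ t in Set.Ioi (0 : ℝ), ENNReal.ofReal (Real.exp (-t * b)) = ENNReal.ofReal (1 / b) := by
  have h := integral_exp_mul_Ioi (a := -b) (by linarith) 0
  have hi := integrableOn_exp_mul_Ioi (a := -b) (by linarith) 0
  rw [← ofReal_integral_eq_lintegral_ofReal]
  · congr 1
    rw [show (fun t : ℝ => Real.exp (-t * b)) = fun t => Real.exp (-b * t) by funext t; ring_nf, h]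
    simp
  · rw [show (fun t : ℝ => Real.exp (-t * b)) = fun t => Real.exp (-b * t) by funext t; ring_nf]
    exact hi
  · exact .of_forall fun t => (Real.exp_pos _).le

/-- The antiderivative is `-(1 + 2 t b)^{1 - p/2} / (b (p - 2))`. -/
theorem lintegral_rpow_Ioi {b p : ℝ} (hb : 0 < b) (hp : 2 < p) :
    ∫⁻ t in Set.Ioi (0 : ℝ), ENNReal.ofReal ((1 + 2 * (t * b)) ^ (-(p / 2)))
      = ENNReal.ofReal (1 / (b * (p - 2))) := by
  have hp' : -(p / 2) < -1 := by linarith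
  have hd : ∀ t ∈ Set.Ioi (0:ℝ), HasDerivAt
      (fun t => -(1 / (b * (p - 2))) * (1 + 2 * (t * b)) ^ (1 - p / 2))
      ((1 + 2 * (t * b)) ^ (-(p / 2))) t := by
    intro t ht
    have ht0 : (0 : ℝ) < t := ht
    have h1 : HasDerivAt (fun t : ℝ => 1 + 2 * (t * b)) (2 * b) t := by
      have := (((hasDerivAt_id t).mul_const b).const_mul 2).const_add 1
      simpa using this
    have h2 := (h1.rpow_const (p := 1 - p / 2) (Or.inl (by positivity))).const_mul
      (-(1 / (b * (p - 2))))
    refine h2.congr_deriv ?_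
    have : p - 2 ≠ 0 := by linarith
    rw [show 1 - p / 2 - 1 = -(p / 2) by ring]
    field_simp
    ring
  have hc : ContinuousWithinAt (fun t => -(1 / (b * (p - 2))) * (1 + 2 * (t * b)) ^ (1 - p / 2))
      (Set.Ici 0) 0 := by
    refine ContinuousAt.continuousWithinAt ?_
    refine continuousAt_const.mul (ContinuousAt.rpow_const (by fun_prop) (Or.inl (by simp)))
  have hlim : Filter.Tendsto (fun t => -(1 / (b * (p - 2))) * (1 + 2 * (t * b)) ^ (1 - p / 2))
      Filter.atTop (nhds 0) := by
    have h1 : Filter.Tendsto (fun t : ℝ => 1 + 2 * (t * b)) Filter.atTop Filter.atTop := by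
      refine Filter.tendsto_atTop_add_const_left _ _ ?_
      exact Filter.Tendsto.const_mul_atTop (by norm_num)
        (Filter.Tendsto.atTop_mul_const hb Filter.tendsto_id)
    have h2 := (tendsto_rpow_neg_atTop (y := p / 2 - 1) (by linarith)).comp h1
    have h3 := h2.const_mul (-(1 / (b * (p - 2))))
    simp only [mul_zero] at h3
    refine h3.congr fun t => ?_
    simp [Function.comp, neg_sub]
  have hpos : ∀ t ∈ Set.Ioi (0:ℝ), 0 ≤ (1 + 2 * (t * b)) ^ (-(p / 2)) := by
    intro t ht
    have ht0 : (0 : ℝ) < t := ht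
    positivity
  have hI := integral_Ioi_of_hasDerivAt_of_nonneg hc hd hpos hlim
  have hInt := integrableOn_Ioi_deriv_of_nonneg hc hd hpos hlim
  rw [← ofReal_integral_eq_lintegral_ofReal hInt
    ((ae_restrict_iff' measurableSet_Ioi).2 (.of_forall hpos)), hI]
  congr 1
  simp

/-! ### Inverse quadratic forms at a real Gaussian vector -/

section
open scoped ComplexOrder

variable {ι : Type*} [Fintype ι] [DecidableEq ι]

theorem exists_unitary_diagonal {M : Matrix ι ι ℂ} (hM : M.PosDef) :
    ∃ (E : Matrix ι ι ℂ) (μ : ι → ℝ), Eᴴ * E = 1 ∧ E * Eᴴ = 1 ∧ (∀ l, 0 < μ l) ∧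
      M = E * Matrix.diagonal (fun l => (μ l : ℂ)) * Eᴴ := by
  refine ⟨hM.1.eigenvectorUnitary, hM.1.eigenvalues, Unitary.coe_star_mul_self _,
    Unitary.coe_mul_star_self _, hM.eigenvalues_pos, ?_⟩
  have h := hM.1.spectral_theorem
  rw [Unitary.conjStarAlgAut_apply] at h
  exact h

theorem exists_orthogonal_diagonal {R : Matrix ι ι ℝ} (hR : R.IsHermitian) :
    ∃ (O : Matrix ι ι ℝ) (a : ι → ℝ), Oᵀ * O = 1 ∧ R = O * Matrix.diagonal a * Oᵀ := by
  refine ⟨hR.eigenvectorUnitary, hR.eigenvalues, ?_, ?_⟩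
  · have := Unitary.coe_star_mul_self hR.eigenvectorUnitary
    rwa [Matrix.star_eq_conjTranspose, Matrix.conjTranspose_eq_transpose_of_trivial] at this
  · have h := hR.spectral_theorem
    rw [Unitary.conjStarAlgAut_apply, Matrix.star_eq_conjTranspose,
      Matrix.conjTranspose_eq_transpose_of_trivial] at h
    exact h

end

/-- The value of the complex Hermitian form `N` at a real vector. -/
noncomputable def realQuad {ι : Type*} [Fintype ι] (N : Matrix ι ι ℂ) (u : ι → ℝ) : ℝ :=
  ((fun i => (u i : ℂ)) ⬝ᵥ N *ᵥ (fun i => (u i : ℂ))).re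

theorem realQuad_eq_dotProduct {ι : Type*} [Fintype ι] (N : Matrix ι ι ℂ) (u : ι → ℝ) :
    realQuad N u = u ⬝ᵥ N.map Complex.re *ᵥ u := by
  simp [realQuad, dotProduct, Matrix.mulVec, Complex.re_sum, Finset.mul_sum]

open scoped ComplexOrder in
theorem realQuad_pos {ι : Type*} [Fintype ι] {N : Matrix ι ι ℂ} (hN : N.PosDef)
    {u : ι → ℝ} (hu : u ≠ 0) : 0 < realQuad N u := by
  have h := hN.re_dotProduct_pos (x := fun i => (u i : ℂ)) (by
    intro h
    apply hu
    funext i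
    have := congrFun h i
    simpa using this)
  have hs : star (fun i => (u i : ℂ)) = fun i => (u i : ℂ) := by
    funext i
    simp
  rw [hs] at h
  exact h

/-- The tangent at `y0` to the convex function `y ↦ log (1 + 2 t / y)` lies below its graph. -/
theorem log_one_add_div_tangent {t y y0 : ℝ} (ht : 0 ≤ t) (hy : 0 < y) (hy0 : 0 < y0) :
    Real.log (1 + 2 * (t * (1 / y0))) + 2 * t / (y0 * (y0 + 2 * t)) * (y0 - y)
      ≤ Real.log (1 + 2 * (t * (1 / y))) := by
  have h1 : Real.log (1 + 2 * (t * (1 / y0))) - Real.log (1 + 2 * (t * (1 / y)))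
      = Real.log ((y * (y0 + 2 * t)) / (y0 * (y + 2 * t))) := by
    rw [← Real.log_div (by positivity) (by positivity)]
    congr 1
    field_simp
  have h2 := Real.log_le_sub_one_of_pos
    (show 0 < (y * (y0 + 2 * t)) / (y0 * (y + 2 * t)) by positivity)
  have h3 : (y * (y0 + 2 * t)) / (y0 * (y + 2 * t)) - 1
      ≤ - (2 * t / (y0 * (y0 + 2 * t)) * (y0 - y)) := by
    have : - (2 * t / (y0 * (y0 + 2 * t)) * (y0 - y)) -
      ((y * (y0 + 2 * t)) / (y0 * (y + 2 * t)) - 1)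
        = 2 * t * (y0 - y) ^ 2 / (y0 * (y + 2 * t) * (y0 + 2 * t)) := by
      field_simp
      ring
    have h4 : 0 ≤ 2 * t * (y0 - y) ^ 2 / (y0 * (y + 2 * t) * (y0 + 2 * t)) := by positivity
    linarith
  linarith

section

open scoped ComplexOrder

variable {ι : Type*} [Fintype ι] [DecidableEq ι]

theorem diag_conj_diagonal (E : Matrix ι ι ℂ) (μ : ι → ℝ) (k : ι) :
    (Eᴴ * Matrix.diagonal (fun l => (μ l : ℂ)) * E) k k = ∑ l, ((‖E l k‖ ^ 2 * μ l : ℝ) : ℂ) := by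
  rw [Matrix.mul_apply]
  refine Finset.sum_congr rfl fun l _ => ?_
  rw [Matrix.mul_diagonal, Matrix.conjTranspose_apply]
  have := Complex.conj_mul' (E l k)
  push_cast
  rw [← this]
  simp only [RCLike.star_def]
  ring

theorem sum_norm_sq_col {E : Matrix ι ι ℂ} (h : Eᴴ * E = 1) (k : ι) : ∑ l, ‖E l k‖ ^ 2 = 1 := by
  have := diag_conj_diagonal E 1 k
  simp only [Pi.one_apply, Complex.ofReal_one, Matrix.diagonal_one, mul_one] at this
  rw [h, Matrix.one_apply_eq] at this
  exact_mod_cast this.symm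

theorem sum_norm_sq_row {E : Matrix ι ι ℂ} (h : Eᴴ * E = 1) (l : ι) : ∑ k, ‖E l k‖ ^ 2 = 1 := by
  have h' : Eᴴᴴ * Eᴴ = 1 := by
    rw [Matrix.conjTranspose_conjTranspose]; exact mul_eq_one_comm.1 h
  have := sum_norm_sq_col h' l
  simpa using this

/-- A lower bound for the diagonal of `M⁻¹` in any orthonormal basis `oₖ` in terms of the trace of
`M` compressed by a projection `P` of rank `q`. If `M` has eigenvectors `eₗ` and eigenvalues `μₗ`,
Jensen's inequality is used twice: for the concave function `log`, with the doubly stochastic matrix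
`|⟨eₗ, oₖ⟩|²`, and for the convex function `y ↦ log (1 + 2 t / y)`, with the weights
`⟨eₗ, P eₗ⟩ ≤ 1`. -/
theorem log_le_sum_log_diag_inv {M P O : Matrix ι ι ℂ} (hM : M.PosDef) (hP : Pᴴ = P)
    (hPP : P * P = P) (hO : Oᴴ * O = 1) {q : ℝ} (hq : 0 < q) (htr : P.trace = q) {t : ℝ}
    (ht : 0 ≤ t) :
    0 < (P * M).trace.re ∧
    q * Real.log (1 + 2 * (t * (q / (P * M).trace.re)))
      ≤ ∑ k, Real.log (1 + 2 * (t * ((Oᴴ * M⁻¹ * O) k k).re)) := by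
  obtain ⟨E, μ, hE, hE', hμ, hMe⟩ := exists_unitary_diagonal hM
  have hinv : M⁻¹ = E * Matrix.diagonal (fun l => ((1 / μ l : ℝ) : ℂ)) * Eᴴ := by
    apply Matrix.inv_eq_right_inv
    rw [hMe]
    calc E * Matrix.diagonal (fun l => (μ l : ℂ)) * Eᴴ
          * (E * Matrix.diagonal (fun l => ((1 / μ l : ℝ) : ℂ)) * Eᴴ)
        = E * (Matrix.diagonal (fun l => (μ l : ℂ)) * (Eᴴ * E)
          * Matrix.diagonal (fun l => ((1 / μ l : ℝ) : ℂ))) * Eᴴ := by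
          simp only [Matrix.mul_assoc]
      _ = 1 := by
          rw [hE, Matrix.mul_one, Matrix.diagonal_mul_diagonal]
          have : (fun i => (μ i : ℂ) * ((1 / μ i : ℝ) : ℂ)) = fun _ => 1 := by
            funext i
            have : (μ i : ℂ) ≠ 0 := by exact_mod_cast (hμ i).ne'
            push_cast
            field_simp
          rw [this, Matrix.diagonal_one, Matrix.mul_one, hE']
  -- the doubly stochastic matrix `|⟨eₗ, oₖ⟩|²`
  set F := Eᴴ * O with hF
  have hFF : Fᴴ * F = 1 := by
    rw [hF, Matrix.conjTranspose_mul, Matrix.conjTranspose_conjTranspose,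
      Matrix.mul_assoc, ← Matrix.mul_assoc E, hE', Matrix.one_mul, hO]
  have hdiag : ∀ k, ((Oᴴ * M⁻¹ * O) k k).re = ∑ l, ‖F l k‖ ^ 2 * (1 / μ l) := by
    intro k
    have h := diag_conj_diagonal F (fun l => 1 / μ l) k
    have h' : Fᴴ * Matrix.diagonal (fun l => ((1 / μ l : ℝ) : ℂ)) * F = Oᴴ * M⁻¹ * O := by
      rw [hinv, hF, Matrix.conjTranspose_mul, Matrix.conjTranspose_conjTranspose]
      simp only [Matrix.mul_assoc]
    rw [h'] at h
    rw [h, ← Complex.ofReal_sum, Complex.ofReal_re]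
  have hstep1 : ∑ l, Real.log (1 + 2 * (t * (1 / μ l)))
      ≤ ∑ k, Real.log (1 + 2 * (t * ((Oᴴ * M⁻¹ * O) k k).re)) := by
    have hk : ∀ k, ∑ l, ‖F l k‖ ^ 2 * Real.log (1 + 2 * (t * (1 / μ l)))
        ≤ Real.log (1 + 2 * (t * ((Oᴴ * M⁻¹ * O) k k).re)) := by
      intro k
      have := strictConcaveOn_log_Ioi.concaveOn.le_map_sum (t := Finset.univ)
        (w := fun l => ‖F l k‖ ^ 2) (p := fun l => 1 + 2 * (t * (1 / μ l)))
        (fun l _ => by positivity) (sum_norm_sq_col hFF k)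
        (fun l _ => by
          have := hμ l
          simp only [Set.mem_Ioi]
          positivity)
      simp only [smul_eq_mul] at this
      refine this.trans_eq ?_
      congr 1
      rw [hdiag]
      simp only [mul_add, mul_one, Finset.sum_add_distrib, sum_norm_sq_col hFF k, Finset.mul_sum]
      congr 1
      exact Finset.sum_congr rfl fun l _ => by ring
    calc ∑ l, Real.log (1 + 2 * (t * (1 / μ l)))
        = ∑ l, (∑ k, ‖F l k‖ ^ 2) * Real.log (1 + 2 * (t * (1 / μ l))) := by
          simp only [sum_norm_sq_row hFF, one_mul]
      _ = ∑ k, ∑ l, ‖F l k‖ ^ 2 * Real.log (1 + 2 * (t * (1 / μ l))) := by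
          simp only [Finset.sum_mul]
          exact Finset.sum_comm
      _ ≤ _ := Finset.sum_le_sum fun k _ => hk k
  -- the weights `πₗ = ⟨eₗ, P eₗ⟩`
  set π : ι → ℝ := fun l => ∑ j, ‖(P * E) j l‖ ^ 2 with hπ
  have hπdiag : ∀ l, (Eᴴ * P * E) l l = π l := by
    intro l
    have h := diag_conj_diagonal (P * E) 1 l
    have h' : (P * E)ᴴ * Matrix.diagonal (fun l => (((1 : ι → ℝ) l : ℝ) : ℂ)) * (P * E)
        = Eᴴ * P * E := by
      simp only [Pi.one_apply, Complex.ofReal_one, Matrix.diagonal_one, Matrix.mul_one]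
      rw [Matrix.conjTranspose_mul, hP, Matrix.mul_assoc, ← Matrix.mul_assoc P, hPP,
        Matrix.mul_assoc]
    rw [h'] at h
    rw [h]
    simp [hπ]
  have hπ0 : ∀ l, 0 ≤ π l := fun l => by positivity
  have hπ1 : ∀ l, π l ≤ 1 := by
    intro l
    -- `1 - P` is a projection too
    have h := diag_conj_diagonal ((1 - P) * E) 1 l
    have h' : ((1 - P) * E)ᴴ * Matrix.diagonal (fun l => (((1 : ι → ℝ) l : ℝ) : ℂ)) * ((1 - P) * E)
        = 1 - Eᴴ * P * E := by
      simp only [Pi.one_apply, Complex.ofReal_one, Matrix.diagonal_one, Matrix.mul_one]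
      rw [Matrix.conjTranspose_mul, Matrix.conjTranspose_sub, Matrix.conjTranspose_one, hP,
        Matrix.mul_assoc, ← Matrix.mul_assoc (1 - P)]
      have : (1 - P) * (1 - P) = 1 - P := by
        rw [Matrix.mul_sub, Matrix.sub_mul, Matrix.sub_mul, hPP]
        simp
      rw [this, Matrix.sub_mul, Matrix.mul_sub, Matrix.one_mul, hE, Matrix.mul_assoc]
    rw [h', Matrix.sub_apply, hπdiag, Matrix.one_apply_eq] at h
    have h2 : (1 : ℝ) - π l = ∑ j, ‖((1 - P) * E) j l‖ ^ 2 := by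
      have : ((1 - π l : ℝ) : ℂ) = ((∑ j, ‖((1 - P) * E) j l‖ ^ 2 : ℝ) : ℂ) := by
        push_cast
        rw [h]
        simp
      exact_mod_cast this
    have h3 : 0 ≤ ∑ j, ‖((1 - P) * E) j l‖ ^ 2 := by positivity
    linarith
  have hπsum : ∑ l, π l = q := by
    have h : (Eᴴ * P * E).trace = q := by
      rw [Matrix.trace_mul_comm, ← Matrix.mul_assoc, hE', Matrix.one_mul, htr]
    have h2 : ((∑ l, π l : ℝ) : ℂ) = q := by
      rw [← h, Matrix.trace]
      push_cast
      exact Finset.sum_congr rfl fun l _ => (hπdiag l).symm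
    exact_mod_cast h2
  have hπμ : ∑ l, π l * μ l = (P * M).trace.re := by
    have h : (P * M).trace = (Eᴴ * P * E * Matrix.diagonal (fun l => (μ l : ℂ))).trace := by
      rw [hMe, ← Matrix.mul_assoc, ← Matrix.mul_assoc, Matrix.trace_mul_comm]
      simp only [Matrix.mul_assoc]
    rw [h, Matrix.trace, Complex.re_sum]
    refine Finset.sum_congr rfl fun l _ => ?_
    rw [Matrix.diag_apply, Matrix.mul_diagonal, hπdiag, ← Complex.ofReal_mul, Complex.ofReal_re]
  have hpos : 0 < (P * M).trace.re := by
    rw [← hπμ]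
    by_contra hcon
    have hz : ∑ l, π l * μ l = 0 := le_antisymm (not_lt.1 hcon)
      (Finset.sum_nonneg fun l _ => mul_nonneg (hπ0 l) (hμ l).le)
    rw [Finset.sum_eq_zero_iff_of_nonneg fun l _ => mul_nonneg (hπ0 l) (hμ l).le] at hz
    have : ∑ l, π l = 0 := Finset.sum_eq_zero fun l hl =>
      (mul_eq_zero.1 (hz l hl)).resolve_right (hμ l).ne'
    rw [hπsum] at this
    exact hq.ne' this
  refine ⟨hpos, le_trans ?_ hstep1⟩
  set y0 := (P * M).trace.re / q with hy0
  have hy0pos : 0 < y0 := by positivity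
  have hq' : q / (P * M).trace.re = 1 / y0 := by rw [hy0]; field_simp
  rw [hq']
  calc q * Real.log (1 + 2 * (t * (1 / y0)))
      = ∑ l, π l * (Real.log (1 + 2 * (t * (1 / y0)))
          + 2 * t / (y0 * (y0 + 2 * t)) * (y0 - μ l)) := by
        have : ∀ l, π l * (Real.log (1 + 2 * (t * (1 / y0)))
          + 2 * t / (y0 * (y0 + 2 * t)) * (y0 - μ l))
          = π l * (Real.log (1 + 2 * (t * (1 / y0))) + 2 * t / (y0 * (y0 + 2 * t)) * y0)
            - 2 * t / (y0 * (y0 + 2 * t)) * (π l * μ l) := fun l => by ring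
        simp only [this, Finset.sum_sub_distrib, ← Finset.sum_mul, ← Finset.mul_sum]
        rw [hπsum, hπμ, show (P * M).trace.re = q * y0 by rw [hy0]; field_simp]
        ring
    _ ≤ ∑ l, π l * Real.log (1 + 2 * (t * (1 / μ l))) :=
        Finset.sum_le_sum fun l _ =>
          mul_le_mul_of_nonneg_left (log_one_add_div_tangent ht (hμ l) hy0pos) (hπ0 l)
    _ ≤ ∑ l, Real.log (1 + 2 * (t * (1 / μ l))) := by
        refine Finset.sum_le_sum fun l _ => ?_
        have h0 : 0 ≤ Real.log (1 + 2 * (t * (1 / μ l))) := by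
          refine Real.log_nonneg ?_
          have := hμ l
          have : 0 ≤ 2 * (t * (1 / μ l)) := by positivity
          linarith
        exact mul_le_of_le_one_left h0 (hπ1 l)

/-- If `M` is a positive definite complex matrix and `P` an orthogonal projection of rank `q > 2`,
the expectation of `1 / ⟨u, M⁻¹ u⟩` over a *real* Gaussian vector `u` is at most
`tr (P M) / (q (q - 2))`. -/
theorem lintegral_gaussVec_inv_realQuad_le {M P : Matrix ι ι ℂ} (hM : M.PosDef) (hP : Pᴴ = P)
    (hPP : P * P = P) {q : ℝ} (hq : 2 < q) (htr : P.trace = q) :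
    ∫⁻ u, ENNReal.ofReal (1 / realQuad M⁻¹ u) ∂(gaussVec ι)
      ≤ ENNReal.ofReal ((P * M).trace.re / (q * (q - 2))) := by
  have hN : (M⁻¹).PosDef := hM.inv
  set R : Matrix ι ι ℝ := (M⁻¹).map Complex.re with hR
  have hRs : R.IsHermitian := by
    ext i j
    have := congrFun (congrFun hN.1 i) j
    simp only [Matrix.conjTranspose_apply] at this
    simp only [hR, Matrix.conjTranspose_apply, Matrix.map_apply, star_trivial]
    rw [← this]
    simp
  obtain ⟨O, a, hO, hRO⟩ := exists_orthogonal_diagonal hRs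
  -- the eigenvalues of the real part are values of the complex form
  set Oc : Matrix ι ι ℂ := O.map (fun x => (x : ℂ)) with hOc
  have hOcH : Ocᴴ * Oc = 1 := by
    ext i j
    have := congrFun (congrFun hO i) j
    simp only [Matrix.mul_apply, Matrix.transpose_apply] at this
    simp only [hOc, Matrix.mul_apply, Matrix.conjTranspose_apply, Matrix.map_apply,
      RCLike.star_def, Complex.conj_ofReal]
    rw [Matrix.one_apply] at this ⊢
    have h2 := congrArg (fun x : ℝ => (x : ℂ)) this
    simp only [Complex.ofReal_sum, Complex.ofReal_mul] at h2
    rw [h2]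
    split_ifs <;> simp
  have hquad : ∀ x : ι → ℝ, realQuad M⁻¹ (O *ᵥ x) = ∑ i, a i * x i ^ 2 := by
    intro x
    rw [realQuad_eq_dotProduct, ← hR, hRO, ← Matrix.mulVec_mulVec, ← Matrix.mulVec_mulVec,
      Matrix.mulVec_mulVec _ Oᵀ, hO, Matrix.one_mulVec, Matrix.dotProduct_mulVec,
      Matrix.vecMul_mulVec, Matrix.vecMul_eq_sum]
    have h : Oᵀ * O = 1 := hO
    simp only [h]
    simp [dotProduct, Matrix.mulVec_diagonal, Matrix.one_apply, Finset.sum_apply]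
    exact Finset.sum_congr rfl fun i _ => by ring
  have haeq : ∀ k, ((Ocᴴ * M⁻¹ * Oc) k k).re = a k := by
    intro k
    have h := hquad (Pi.single k 1)
    have h2 : ∑ i, a i * (Pi.single k (1 : ℝ) : ι → ℝ) i ^ 2 = a k := by
      simp [Pi.single_apply]
    rw [h2] at h
    rw [← h, realQuad, Matrix.mulVec_single_one]
    simp only [Matrix.mul_apply, dotProduct, Matrix.mulVec, hOc, Matrix.conjTranspose_apply,
      Matrix.map_apply, Matrix.col_apply, RCLike.star_def, Complex.conj_ofReal, Finset.sum_mul,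
      Finset.mul_sum]
    rw [Finset.sum_comm]
    congr 1
    exact Finset.sum_congr rfl fun i _ => Finset.sum_congr rfl fun j _ => by ring
  have ha : ∀ k, 0 < a k := by
    intro k
    have h := hquad (Pi.single k 1)
    have h2 : ∑ i, a i * (Pi.single k (1 : ℝ) : ι → ℝ) i ^ 2 = a k := by
      simp [Pi.single_apply]
    rw [h2] at h
    rw [← h]
    refine realQuad_pos hN ?_
    intro h0
    have h3 : (Pi.single k (1 : ℝ) : ι → ℝ) = 0 := by
      rw [← Matrix.one_mulVec (Pi.single k (1 : ℝ) : ι → ℝ), ← hO, ← Matrix.mulVec_mulVec, h0,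
        Matrix.mulVec_zero]
    have := congrFun h3 k
    simp at this
  obtain ⟨hpos, -⟩ := log_le_sum_log_diag_inv hM hP hPP hOcH (by linarith) htr le_rfl
  have hmeasQ : Measurable (fun u => ENNReal.ofReal (1 / realQuad M⁻¹ u)) := by
    unfold realQuad dotProduct Matrix.mulVec dotProduct
    fun_prop
  have hmeasO : Measurable (fun x : ι → ℝ => O *ᵥ x) := by
    unfold Matrix.mulVec dotProduct; fun_prop
  calc ∫⁻ u, ENNReal.ofReal (1 / realQuad M⁻¹ u) ∂(gaussVec ι)
      = ∫⁻ x, ENNReal.ofReal (1 / ∑ i, a i * x i ^ 2) ∂(gaussVec ι) := by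
        conv_lhs => rw [← gaussVec_map_mulVec O hO]
        rw [lintegral_map hmeasQ hmeasO]
        simp only [hquad]
    _ ≤ ∫⁻ x, ∫⁻ t in Set.Ioi (0 : ℝ), ENNReal.ofReal (Real.exp (-t * ∑ i, a i * x i ^ 2))
          ∂volume ∂(gaussVec ι) := by
        -- only `≤`, because of the junk value `1 / 0 = 0`
        refine lintegral_mono fun x => ?_
        have h0 : 0 ≤ ∑ i, a i * x i ^ 2 :=
          Finset.sum_nonneg fun i _ => mul_nonneg (ha i).le (sq_nonneg _)
        rcases h0.eq_or_lt with h | h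
        · simp [← h]
        · rw [lintegral_exp_neg_mul_Ioi h]
    _ = ∫⁻ t in Set.Ioi (0 : ℝ), ENNReal.ofReal (∏ i, (1 + 2 * (t * a i)) ^ (-(1 / 2) : ℝ)) :=
        (lintegral_gaussVec_inv_quadratic a fun i => (ha i).le).symm
    _ ≤ ∫⁻ t in Set.Ioi (0 : ℝ),
          ENNReal.ofReal ((1 + 2 * (t * (q / (P * M).trace.re))) ^ (-(q / 2))) := by
        refine setLIntegral_mono (by fun_prop) fun t ht => ?_
        have ht0 : (0 : ℝ) < t := ht
        refine ENNReal.ofReal_le_ofReal ?_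
        have hj := (log_le_sum_log_diag_inv hM hP hPP hOcH (by linarith) htr ht0.le).2
        simp only [haeq] at hj
        have hb : 0 < q / (P * M).trace.re := div_pos (by linarith) hpos
        rw [← Real.log_le_log_iff (Finset.prod_pos fun i _ => by
            have := ha i
            positivity) (by positivity),
          Real.log_prod (fun i _ => by
            have := ha i
            positivity), Real.log_rpow (by positivity)]
        have : ∀ i, Real.log ((1 + 2 * (t * a i)) ^ (-(1 / 2) : ℝ))
            = -(1 / 2) * Real.log (1 + 2 * (t * a i)) := fun i => by
          have := ha i
          rw [Real.log_rpow (by positivity)]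
        simp only [this, ← Finset.mul_sum]
        linarith
    _ = ENNReal.ofReal ((P * M).trace.re / (q * (q - 2))) := by
        rw [lintegral_rpow_Ioi (div_pos (by linarith) hpos) hq]
        congr 1
        have : q - 2 ≠ 0 := by linarith
        have : q ≠ 0 := by linarith
        field_simp

end

/-! ### The expected Gram determinant of a weighted Gaussian matrix -/

section

variable {κ ι α : Type*} [Fintype κ] [Fintype ι] [Fintype α]

/-- The complex matrix whose columns are the rows of `X`. -/
noncomputable def sampleMat (X : κ → ι → ℝ) : Matrix ι κ ℂ := fun i k => (X k i : ℂ)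

/-- The matrix of second moments `E[w(x) x xᵀ]` of a Gaussian vector `x` under a weight `w`. -/
noncomputable def weightedMoment (w : (ι → ℝ) → ℝ) : Matrix ι ι ℂ :=
  fun i j => ((∫ x, x i * x j * w x ∂gaussVec ι : ℝ) : ℂ)

theorem integrable_gaussVec_mul_mul {w : (ι → ℝ) → ℝ} (hw : Measurable w) (hb : ∀ x, |w x| ≤ 1)
    (i j : ι) : Integrable (fun x => x i * x j * w x) (gaussVec ι) := by
  have hL : ∀ i : ι, MemLp (fun x : ι → ℝ => x i) 2 (gaussVec ι) := fun i =>
    (memLp_id_gaussianReal (μ := 0) (v := 1) 2).comp_measurePreserving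
      (measurePreserving_eval (fun _ : ι => gaussianReal 0 1) i)
  have h : Integrable (fun x : ι → ℝ => x i * x j) (gaussVec ι) := (hL i).integrable_mul (hL j)
  exact h.mul_bdd (c := 1) hw.aestronglyMeasurable (.of_forall fun x => by simpa using hb x)

theorem integrable_gaussVec_of_bdd {w : (ι → ℝ) → ℝ} (hw : Measurable w) (hb : ∀ x, |w x| ≤ 1) :
    Integrable w (gaussVec ι) :=
  Integrable.of_bound hw.aestronglyMeasurable 1 (.of_forall fun x => by simpa using hb x)

theorem integrable_weighted_forms {w : (ι → ℝ) → ℝ} (hw : Measurable w) (hb : ∀ x, |w x| ≤ 1)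
    (p q : ι → ℂ) : Integrable (fun x : ι → ℝ => (∑ i, p i * (x i : ℂ)) *
      star (∑ i, q i * (x i : ℂ)) * (w x : ℂ)) (gaussVec ι) := by
  have h : ∀ x : ι → ℝ, (∑ i, p i * (x i : ℂ)) * star (∑ i, q i * (x i : ℂ)) * (w x : ℂ)
      = ∑ i, ∑ j, p i * star (q j) * ((x i * x j * w x : ℝ) : ℂ) := by
    intro x
    rw [star_sum, Finset.sum_mul_sum]
    simp only [star_mul', Finset.sum_mul]
    refine Finset.sum_congr rfl fun i _ => Finset.sum_congr rfl fun j _ => ?_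
    simp
    ring
  simp_rw [h]
  exact integrable_finsetSum _ fun i _ => integrable_finsetSum _ fun j _ =>
    ((integrable_gaussVec_mul_mul hw hb i j).ofReal).const_mul _

theorem integral_weighted_forms {w : (ι → ℝ) → ℝ} (hw : Measurable w) (hb : ∀ x, |w x| ≤ 1)
    (p q : ι → ℂ) : ∫ x : ι → ℝ, (∑ i, p i * (x i : ℂ)) *
      star (∑ i, q i * (x i : ℂ)) * (w x : ℂ) ∂gaussVec ι
      = ∑ i, ∑ j, p i * weightedMoment w i j * star (q j) := by
  have h : ∀ x : ι → ℝ, (∑ i, p i * (x i : ℂ)) * star (∑ i, q i * (x i : ℂ)) * (w x : ℂ)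
      = ∑ i, ∑ j, p i * star (q j) * ((x i * x j * w x : ℝ) : ℂ) := by
    intro x
    rw [star_sum, Finset.sum_mul_sum]
    simp only [star_mul', Finset.sum_mul]
    refine Finset.sum_congr rfl fun i _ => Finset.sum_congr rfl fun j _ => ?_
    simp
    ring
  simp_rw [h]
  rw [integral_finsetSum _ fun i _ => integrable_finsetSum _ fun j _ =>
    ((integrable_gaussVec_mul_mul hw hb i j).ofReal).const_mul _]
  refine Finset.sum_congr rfl fun i _ => ?_
  rw [integral_finsetSum _ fun j _ =>
    ((integrable_gaussVec_mul_mul hw hb i j).ofReal).const_mul _]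
  refine Finset.sum_congr rfl fun j _ => ?_
  rw [integral_const_mul, integral_complex_ofReal, mul_right_comm]
  rfl

/-- Only injective choices of columns survive in the expansion of a Gram determinant, since the
other choices produce two equal columns. -/
theorem det_mul_conjTranspose_eq_sum [DecidableEq α] [DecidableEq κ] (Z : Matrix α κ ℂ) :
    (Z * Zᴴ).det = ∑ f : α ↪ κ, ∑ π : Equiv.Perm α,
      Equiv.Perm.sign π • ∏ a, (Z (π a) (f a) * star (Z a (f a))) := by
  have h1 : (Z * Zᴴ).det = ∑ f : α → κ, ∑ π : Equiv.Perm α,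
      Equiv.Perm.sign π • ∏ a, (Z (π a) (f a) * star (Z a (f a))) := by
    rw [Matrix.det_apply, Finset.sum_comm]
    refine Finset.sum_congr rfl fun π _ => ?_
    rw [← Finset.smul_sum]
    congr 1
    simp only [Matrix.mul_apply, Matrix.conjTranspose_apply]
    rw [Finset.prod_univ_sum]
    simp
  rw [h1]
  have h2 : ∀ f : α → κ, ¬ Function.Injective f → ∑ π : Equiv.Perm α,
      Equiv.Perm.sign π • ∏ a, (Z (π a) (f a) * star (Z a (f a))) = 0 := by
    intro f hf
    simp only [Function.Injective, not_forall] at hf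
    obtain ⟨a, b, hab, hne⟩ := hf
    have h3 : (Matrix.of fun c a => Z c (f a)).det = 0 :=
      Matrix.det_zero_of_column_eq hne (fun k => by simp [hab])
    have h4 := congrArg (· * ∏ a, star (Z a (f a))) h3
    simp only [Matrix.det_apply, zero_mul, Finset.sum_mul] at h4
    rw [← h4]
    refine Finset.sum_congr rfl fun π _ => ?_
    rw [Finset.prod_mul_distrib, smul_mul_assoc]
    rfl
  rw [← Finset.sum_subset (Finset.subset_univ (Finset.univ.filter Function.Injective))
    (fun f _ hf => h2 f (by simpa using hf))]
  rw [Finset.sum_subtype (p := Function.Injective) _ (by simp)]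
  exact Fintype.sum_equiv (Equiv.subtypeInjectiveEquivEmbedding α κ) _ _ (fun f => rfl)

theorem prod_embedding_mul_prod [DecidableEq κ] (f : α ↪ κ) (h : α → ℂ) (c : ℂ) (P : κ → ℂ)
    (h1 : ∀ a, P (f a) = h a) (h2 : ∀ k, k ∉ Set.range f → P k = c) :
    ∏ k, P k = (∏ a, h a) * c ^ (Fintype.card κ - Fintype.card α) := by
  rw [← Finset.prod_mul_prod_compl (Finset.univ.map f), Finset.prod_map]
  congr 1
  · exact Finset.prod_congr rfl fun a _ => h1 a
  · rw [Finset.prod_congr (g := fun _ => c) rfl, Finset.prod_const, Finset.card_compl,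
      Finset.card_map, Finset.card_univ]
    intro k hk
    exact h2 k (by simpa using hk)

theorem integral_prod_forms [DecidableEq α] [DecidableEq κ] {w : (ι → ℝ) → ℝ} (hw : Measurable w)
    (hb : ∀ x, |w x| ≤ 1) (f : α ↪ κ) (p q : α → ι → ℂ) :
    Integrable (fun X : κ → ι → ℝ => (∏ a, ((∑ i, p a i * (X (f a) i : ℂ)) *
      star (∑ i, q a i * (X (f a) i : ℂ)))) * ∏ k, (w (X k) : ℂ)) (gaussMat κ ι) ∧
    ∫ X : κ → ι → ℝ, (∏ a, ((∑ i, p a i * (X (f a) i : ℂ)) *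
      star (∑ i, q a i * (X (f a) i : ℂ)))) * ∏ k, (w (X k) : ℂ) ∂gaussMat κ ι
      = (∏ a, ∑ i, ∑ j, p a i * weightedMoment w i j * star (q a j)) *
        ((∫ x, w x ∂gaussVec ι : ℝ) : ℂ) ^ (Fintype.card κ - Fintype.card α) := by
  -- Each integrand factors over the independent rows: row `f a` carries the forms `p a` and `q a`,
  -- the other rows only the weight.
  let F : α → (ι → ℝ) → ℂ := fun a x => (∑ i, p a i * (x i : ℂ)) * star (∑ i, q a i * (x i : ℂ))
  let g : κ → (ι → ℝ) → ℂ := fun k x => (∏ a with f a = k, F a x) * (w x : ℂ)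
  have hg : ∀ X : κ → ι → ℝ, (∏ a, ((∑ i, p a i * (X (f a) i : ℂ)) *
      star (∑ i, q a i * (X (f a) i : ℂ)))) * ∏ k, (w (X k) : ℂ) = ∏ k, g k (X k) := by
    intro X
    rw [← Finset.prod_fiberwise Finset.univ f, ← Finset.prod_mul_distrib]
    refine Finset.prod_congr rfl fun k _ => ?_
    simp only [g]
    congr 1
    refine Finset.prod_congr rfl fun a ha => ?_
    rw [(Finset.mem_filter.1 ha).2]
  have hg1 : ∀ a, g (f a) = fun x => F a x * (w x : ℂ) := by
    intro a
    funext x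
    have : Finset.univ.filter (fun b => f b = f a) = {a} := by
      ext b
      simp
    simp only [g, this, Finset.prod_singleton]
  have hg2 : ∀ k, k ∉ Set.range f → g k = fun x => (w x : ℂ) := by
    intro k hk
    funext x
    have : Finset.univ.filter (fun a => f a = k) = ∅ := by
      ext a
      simpa using fun h => hk ⟨a, h⟩
    simp [g, this]
  have hgi : ∀ k, Integrable (g k) (gaussVec ι) := by
    intro k
    by_cases hk : k ∈ Set.range f
    · obtain ⟨a, rfl⟩ := hk
      rw [hg1]
      exact integrable_weighted_forms hw hb _ _
    · rw [hg2 k hk]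
      exact (integrable_gaussVec_of_bdd hw hb).ofReal
  simp_rw [hg]
  refine ⟨Integrable.fintype_prod hgi, ?_⟩
  unfold gaussMat
  rw [integral_fintype_prod_eq_prod]
  refine prod_embedding_mul_prod f _ _ _ ?_ ?_
  · intro a
    rw [hg1]
    exact integral_weighted_forms hw hb _ _
  · intro k hk
    rw [hg2 k hk]
    exact integral_complex_ofReal

/-- The expected Gram determinant of `T` applied to a Gaussian sample, weighted by a product
weight `∏ w`. With `D` rows and `T` of height `p`, each of the `D (D - 1) ⋯ (D - p + 1)` injective
choices of `p` rows contributes the determinant of the moment matrix compressed by `T`, and the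
remaining rows contribute powers of the mean of `w`. -/
theorem integral_det_mul_prod [DecidableEq α] [DecidableEq κ] {w : (ι → ℝ) → ℝ}
    (hw : Measurable w) (hb : ∀ x, |w x| ≤ 1) (T : Matrix α ι ℂ) :
    Integrable (fun X : κ → ι → ℝ => ((T * sampleMat X) * (T * sampleMat X)ᴴ).det *
      ∏ k, (w (X k) : ℂ)) (gaussMat κ ι) ∧
    ∫ X : κ → ι → ℝ, ((T * sampleMat X) * (T * sampleMat X)ᴴ).det *
      ∏ k, (w (X k) : ℂ) ∂gaussMat κ ι
      = ((Fintype.card κ).descFactorial (Fintype.card α) : ℂ) *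
        (((∫ x, w x ∂gaussVec ι : ℝ) : ℂ) ^ (Fintype.card κ - Fintype.card α) *
        (T * weightedMoment w * Tᴴ).det) := by
  have hX : ∀ X : κ → ι → ℝ, ((T * sampleMat X) * (T * sampleMat X)ᴴ).det * ∏ k, (w (X k) : ℂ)
      = ∑ f : α ↪ κ, ∑ π : Equiv.Perm α, (((Equiv.Perm.sign π : ℤ) : ℂ) *
        ((∏ a, ((∑ i, T (π a) i * (X (f a) i : ℂ)) * star (∑ i, T a i * (X (f a) i : ℂ))))
          * ∏ k, (w (X k) : ℂ))) := by
    intro X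
    rw [det_mul_conjTranspose_eq_sum, Finset.sum_mul]
    refine Finset.sum_congr rfl fun f _ => ?_
    rw [Finset.sum_mul]
    refine Finset.sum_congr rfl fun π _ => ?_
    rw [Units.smul_def, zsmul_eq_mul, mul_assoc]
    rfl
  simp_rw [hX]
  have hi := fun (f : α ↪ κ) (π : Equiv.Perm α) =>
    (integral_prod_forms (κ := κ) hw hb f (fun a => T (π a)) T)
  refine ⟨integrable_finsetSum _ fun f _ => integrable_finsetSum _ fun π _ =>
    (hi f π).1.const_mul _, ?_⟩
  rw [integral_finsetSum _ fun f _ => integrable_finsetSum _ fun π _ => (hi f π).1.const_mul _]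
  have hf : ∀ f : α ↪ κ, ∫ X : κ → ι → ℝ, ∑ π : Equiv.Perm α, (((Equiv.Perm.sign π : ℤ) : ℂ) *
        ((∏ a, ((∑ i, T (π a) i * (X (f a) i : ℂ)) * star (∑ i, T a i * (X (f a) i : ℂ))))
          * ∏ k, (w (X k) : ℂ))) ∂gaussMat κ ι
      = (((∫ x, w x ∂gaussVec ι : ℝ) : ℂ) ^ (Fintype.card κ - Fintype.card α) *
        (T * weightedMoment w * Tᴴ).det) := by
    intro f
    rw [integral_finsetSum _ fun π _ => (hi f π).1.const_mul _, Matrix.det_apply, Finset.mul_sum]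
    refine Finset.sum_congr rfl fun π _ => ?_
    rw [integral_const_mul, (hi f π).2, Units.smul_def, zsmul_eq_mul, mul_comm (∏ a, _), ← mul_assoc,
      ← mul_assoc, mul_comm (_ ^ _)]
    congr 1
    refine Finset.prod_congr rfl fun a _ => ?_
    simp only [Matrix.mul_apply, Matrix.conjTranspose_apply, Finset.sum_mul]
    exact Finset.sum_comm
  rw [Finset.sum_congr rfl fun f _ => hf f, Finset.sum_const, nsmul_eq_mul, Finset.card_univ,
    Fintype.card_embedding_eq]

end

/-! ### Moments under the weight `exp (-|mᵀ x|²)` -/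

section

variable {κ ι α : Type*} [Fintype κ] [Fintype ι] [Fintype α]

/-- The weight `exp (-|mᵀ x|²)`, where `m` is complex and `x` real. -/
noncomputable def formWeight (m : ι → ℂ) (x : ι → ℝ) : ℝ :=
  Real.exp (-‖∑ i, m i * (x i : ℂ)‖ ^ 2)

theorem measurable_formWeight (m : ι → ℂ) : Measurable (formWeight m) := by
  unfold formWeight; fun_prop

theorem formWeight_pos (m : ι → ℂ) (x : ι → ℝ) : 0 < formWeight m x := Real.exp_pos _

theorem abs_formWeight_le (m : ι → ℂ) (x : ι → ℝ) : |formWeight m x| ≤ 1 := by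
  rw [abs_of_pos (formWeight_pos m x), formWeight, Real.exp_le_one_iff]
  nlinarith [sq_nonneg ‖∑ i, m i * (x i : ℂ)‖]

theorem integral_gauss_exp_pos {a : ℝ} (ha : 0 ≤ a) :
    0 < ∫ x, Real.exp (-a * x ^ 2) ∂(gaussianReal 0 1) := by
  rw [integral_gauss_exp_neg_mul_sq ha]
  positivity

theorem integral_gauss_sq_mul_exp_pos {a : ℝ} (ha : 0 ≤ a) :
    0 < ∫ x, x ^ 2 * Real.exp (-a * x ^ 2) ∂(gaussianReal 0 1) := by
  have hi := integrable_gauss_pow_mul (f := fun x => Real.exp (-a * x ^ 2)) (by fun_prop)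
    (fun x => by
      rw [abs_of_pos (Real.exp_pos _), Real.exp_le_one_iff]
      nlinarith [sq_nonneg x]) 2
  rw [integral_pos_iff_support_of_nonneg (fun x => by positivity) hi]
  have hs : Function.support (fun x : ℝ => x ^ 2 * Real.exp (-a * x ^ 2)) = {0}ᶜ := by
    ext x
    simp [Real.exp_ne_zero]
  rw [hs, measure_compl (measurableSet_singleton _) (measure_ne_top _ _)]
  have := nullSingletonClass_gaussianReal (μ := 0) (v := 1) (by norm_num)
  rw [measure_singleton]
  simp

theorem integral_gaussVec_mul_mul_exp [DecidableEq ι] (a : ι → ℝ) (i j : ι) :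
    ∫ x, x i * x j * Real.exp (-∑ l, a l * x l ^ 2) ∂gaussVec ι
      = if i = j then (∫ y, y ^ 2 * Real.exp (-a i * y ^ 2) ∂gaussianReal 0 1) *
        ∏ l ∈ Finset.univ.erase i, ∫ y, Real.exp (-a l * y ^ 2) ∂gaussianReal 0 1 else 0 := by
  let g : ι → ℝ → ℝ := fun l y =>
    (if i = l then y else 1) * (if j = l then y else 1) * Real.exp (-a l * y ^ 2)
  have hg : ∀ x : ι → ℝ, x i * x j * Real.exp (-∑ l, a l * x l ^ 2) = ∏ l, g l (x l) := by
    intro x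
    simp only [g, Finset.prod_mul_distrib, Finset.prod_ite_eq, Finset.mem_univ, if_true]
    rw [← Real.exp_sum, ← Finset.sum_neg_distrib]
    simp only [neg_mul]
  simp_rw [hg]
  unfold gaussVec
  rw [integral_fintype_prod_eq_prod]
  split_ifs with h
  · subst h
    rw [← Finset.mul_prod_erase _ _ (Finset.mem_univ i)]
    congr 1
    · simp [g, sq]
    · refine Finset.prod_congr rfl fun l hl => ?_
      simp [g, (Finset.ne_of_mem_erase hl).symm]
  · refine Finset.prod_eq_zero (Finset.mem_univ i) ?_
    have h' : ¬ j = i := fun h' => h h'.symm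
    simp only [g, if_true, h', if_false, mul_one]
    exact integral_gauss_mul_exp_eq_zero _

/-- The moment matrix of the weight `exp (-|mᵀ x|²)` has positive eigenvalues, none of which
exceeds the mean of the weight. The real quadratic form `|mᵀ x|²` can be diagonalized by an
orthogonal matrix, which reduces the claim to one dimension (`integral_gauss_sq_mul_exp_le`). -/
theorem exists_weightedMoment_formWeight [DecidableEq ι] (m : ι → ℂ) :
    ∃ (O : Matrix ι ι ℂ) (s : ι → ℝ), Oᴴ * O = 1 ∧ (∀ i, 0 < s i) ∧
      (∀ i, s i ≤ ∫ x, formWeight m x ∂gaussVec ι) ∧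
      weightedMoment (formWeight m) = O * Matrix.diagonal (fun i => (s i : ℂ)) * Oᴴ := by
  let R : Matrix ι ι ℝ := fun i j => (m i * star (m j)).re
  have hR : R.IsHermitian := by
    ext i j
    rw [Matrix.conjTranspose_apply]
    simp [R]
    ring
  have hquad : ∀ x : ι → ℝ, ‖∑ i, m i * (x i : ℂ)‖ ^ 2 = x ⬝ᵥ R *ᵥ x := by
    intro x
    have h1 : ((‖∑ i, m i * (x i : ℂ)‖ ^ 2 : ℝ) : ℂ)
        = ∑ i, ∑ j, (m i * star (m j)) * ((x i * x j : ℝ) : ℂ) := by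
      push_cast
      rw [← Complex.mul_conj', map_sum, Finset.sum_mul_sum]
      refine Finset.sum_congr rfl fun i _ => ?_
      refine Finset.sum_congr rfl fun j _ => ?_
      simp
      ring
    have h2 := congrArg Complex.re h1
    rw [Complex.ofReal_re] at h2
    rw [h2]
    simp only [Complex.re_sum, Complex.re_mul_ofReal, dotProduct, Matrix.mulVec, Finset.mul_sum, R]
    refine Finset.sum_congr rfl fun i _ => ?_
    refine Finset.sum_congr rfl fun j _ => ?_
    ring
  obtain ⟨O, a, hO, hRO⟩ := exists_orthogonal_diagonal hR
  have hO' : O * Oᵀ = 1 := mul_eq_one_comm.1 hO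
  have hdiag : ∀ x : ι → ℝ, (O *ᵥ x) ⬝ᵥ R *ᵥ (O *ᵥ x) = ∑ i, a i * x i ^ 2 := by
    intro x
    rw [hRO, Matrix.mulVec_mulVec, Matrix.mul_assoc, hO, Matrix.mul_one, ← Matrix.mulVec_mulVec,
      Matrix.dotProduct_mulVec, ← Matrix.mulVec_transpose, Matrix.mulVec_mulVec, hO,
      Matrix.one_mulVec]
    simp only [dotProduct, Matrix.mulVec_diagonal]
    exact Finset.sum_congr rfl fun i _ => by ring
  have ha : ∀ i, 0 ≤ a i := by
    intro i
    have h := hdiag (Pi.single i 1)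
    rw [← hquad] at h
    have h3 : ∑ l, a l * (Pi.single i (1:ℝ) : ι → ℝ) l ^ 2 = a i := by
      rw [Finset.sum_eq_single i] <;> simp +contextual
    rw [h3] at h
    rw [← h]
    positivity
  have hw : ∀ x : ι → ℝ, formWeight m (O *ᵥ x) = Real.exp (-∑ i, a i * x i ^ 2) := by
    intro x
    rw [formWeight, hquad, hdiag]
  have hmO : Measurable (fun x : ι → ℝ => O *ᵥ x) := by
    unfold Matrix.mulVec dotProduct; fun_prop
  let c : ι → ℝ := fun i => ∫ y, Real.exp (-a i * y ^ 2) ∂gaussianReal 0 1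
  have hcpos : ∀ i, 0 < c i := fun i => integral_gauss_exp_pos (ha i)
  have hmean : ∫ x, formWeight m x ∂gaussVec ι = ∏ i, c i := by
    conv_lhs => rw [← gaussVec_map_mulVec O hO]
    rw [integral_map hmO.aemeasurable (measurable_formWeight m).aestronglyMeasurable]
    simp_rw [hw]
    have : ∀ x : ι → ℝ, Real.exp (-∑ i, a i * x i ^ 2) = ∏ i, Real.exp (-a i * x i ^ 2) := by
      intro x
      rw [← Real.exp_sum, ← Finset.sum_neg_distrib]
      simp only [neg_mul]
    simp_rw [this]
    unfold gaussVec
    rw [integral_fintype_prod_eq_prod (f := fun i (y : ℝ) => Real.exp (-a i * y ^ 2))]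
  let s : ι → ℝ := fun i => (∫ y, y ^ 2 * Real.exp (-a i * y ^ 2) ∂gaussianReal 0 1) *
        ∏ l ∈ Finset.univ.erase i, c l
  refine ⟨O.map (fun x => (x : ℂ)), s, ?_, ?_, ?_, ?_⟩
  · have h := congrArg (fun N : Matrix ι ι ℝ => N.map (Complex.ofRealHom)) hO
    simp only [Matrix.map_mul] at h
    rw [Matrix.map_one _ (by simp) (by simp)] at h
    rw [← h]
    congr 1
    ext i j
    simp
  · intro i
    exact mul_pos (integral_gauss_sq_mul_exp_pos (ha i)) (Finset.prod_pos fun l _ => hcpos l)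
  · intro i
    rw [hmean, ← Finset.mul_prod_erase _ _ (Finset.mem_univ i)]
    exact mul_le_mul_of_nonneg_right (integral_gauss_sq_mul_exp_le (ha i))
      (Finset.prod_nonneg fun l _ => (hcpos l).le)
  · have hreal : (Matrix.of fun i j => ∫ x, x i * x j * formWeight m x ∂gaussVec ι)
        = O * Matrix.diagonal s * Oᵀ := by
      ext i j
      rw [Matrix.of_apply]
      conv_lhs => rw [← gaussVec_map_mulVec O hO]
      rw [integral_map hmO.aemeasurable (by
        have := measurable_formWeight m
        exact (by fun_prop : Measurable _).aestronglyMeasurable)]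
      simp_rw [hw]
      have h1 : ∀ x : ι → ℝ, (O *ᵥ x) i * (O *ᵥ x) j * Real.exp (-∑ i, a i * x i ^ 2)
          = ∑ p, ∑ q, O i p * O j q * (x p * x q * Real.exp (-∑ i, a i * x i ^ 2)) := by
        intro x
        simp only [Matrix.mulVec, dotProduct]
        rw [Finset.sum_mul_sum, Finset.sum_mul]
        refine Finset.sum_congr rfl fun p _ => ?_
        rw [Finset.sum_mul]
        refine Finset.sum_congr rfl fun q _ => ?_
        ring
      simp_rw [h1]
      have hi : ∀ p q, Integrable (fun x : ι → ℝ => x p * x q * Real.exp (-∑ i, a i * x i ^ 2))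
          (gaussVec ι) := fun p q => integrable_gaussVec_mul_mul (by fun_prop) (fun x => by
            rw [← hw]
            exact abs_formWeight_le m _) p q
      rw [integral_finsetSum _ fun p _ => integrable_finsetSum _ fun q _ => (hi p q).const_mul _]
      rw [Matrix.mul_apply]
      refine Finset.sum_congr rfl fun p _ => ?_
      rw [integral_finsetSum _ fun q _ => (hi p q).const_mul _]
      simp_rw [integral_const_mul, integral_gaussVec_mul_mul_exp a]
      simp [Matrix.mul_diagonal, s, c]
      ring
    have h := congrArg (fun N : Matrix ι ι ℝ => N.map (Complex.ofRealHom)) hreal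
    simp only [Matrix.map_mul] at h
    have e1 : weightedMoment (formWeight m)
        = (Matrix.of fun i j => ∫ x, x i * x j * formWeight m x ∂gaussVec ι).map
          Complex.ofRealHom := rfl
    rw [e1, h]
    congr 1
    · congr 1
      ext i j
      by_cases hij : i = j <;> simp [Matrix.diagonal, hij]
    · ext i j
      simp

end

/-! ### A ratio of Gram determinants -/

section
open scoped ComplexOrder

variable {κ ι α : Type*} [Fintype κ] [Fintype ι] [Fintype α]

theorem sum_norm_sq_mulVec (T : Matrix κ α ℂ) (ζ : α → ℂ) :
    ((∑ k, ‖(T *ᵥ ζ) k‖ ^ 2 : ℝ) : ℂ) = star ζ ⬝ᵥ (Tᴴ * T) *ᵥ ζ := by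
  rw [← Matrix.mulVec_mulVec, Matrix.dotProduct_mulVec, ← Matrix.star_mulVec, dotProduct]
  push_cast
  exact Finset.sum_congr rfl fun k _ => (Complex.conj_mul' _).symm

/-- The integral of `exp (-‖ζ‖²)` over the complex space. -/
noncomputable def complexGaussInt (α : Type*) [Fintype α] : ℝ≥0∞ :=
  ∫⁻ ζ : α → ℂ, ENNReal.ofReal (Real.exp (-∑ a, ‖ζ a‖ ^ 2))

theorem complexGaussInt_ne_zero : complexGaussInt α ≠ 0 := by
  unfold complexGaussInt
  rw [ne_eq, lintegral_eq_zero_iff (by fun_prop)]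
  intro h
  have h2 : ∀ᵐ ζ : α → ℂ, False := by
    filter_upwards [h] with ζ hζ
    have : ENNReal.ofReal (Real.exp (-∑ a, ‖ζ a‖ ^ 2)) = 0 := hζ
    rw [ENNReal.ofReal_eq_zero] at this
    exact absurd (Real.exp_pos _) (not_lt.2 this)
  have h3 := Filter.eventually_false_iff_eq_bot.1 h2
  rw [ae_eq_bot] at h3
  exact NeZero.ne (volume : Measure (α → ℂ)) h3

theorem complexGaussInt_ne_top : complexGaussInt α ≠ ∞ := by
  unfold complexGaussInt
  have h1 : Integrable (fun z : ℂ => Real.exp (-‖z‖ ^ 2)) := by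
    have := (GaussianFourier.integrable_cexp_neg_mul_sq_norm_add (V := ℂ) (b := 1) (by simp) 0 0).norm
    refine this.congr (.of_forall fun z => ?_)
    simp only [Complex.norm_exp]
    congr 1
    simp [← Complex.ofReal_pow]
  have h2 : Integrable (fun ζ : α → ℂ => ∏ a, Real.exp (-‖ζ a‖ ^ 2)) := by
    exact Integrable.fintype_prod (f := fun (_ : α) (z : ℂ) => Real.exp (-‖z‖ ^ 2)) fun _ => h1
  have h3 : ∀ ζ : α → ℂ, Real.exp (-∑ a, ‖ζ a‖ ^ 2) = ∏ a, Real.exp (-‖ζ a‖ ^ 2) := by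
    intro ζ
    rw [← Real.exp_sum, Finset.sum_neg_distrib]
  simp_rw [h3]
  have h4 := h2.2
  rw [hasFiniteIntegral_iff_ofReal (.of_forall fun ζ => by positivity)] at h4
  exact h4.ne

/-- The reciprocal of the determinant of a Gram matrix is a Gaussian integral over the complex
space. -/
theorem lintegral_exp_neg_gram_mul_det [DecidableEq α] (Z : Matrix α κ ℂ)
    (hZ : (Z * Zᴴ).det ≠ 0) :
    (∫⁻ ζ : α → ℂ, ENNReal.ofReal (Real.exp (-∑ k, ‖(Zᴴ *ᵥ ζ) k‖ ^ 2))) *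
      ENNReal.ofReal ((Z * Zᴴ).det.re) = complexGaussInt α := by
  have hpsd : (Z * Zᴴ).PosSemidef := Matrix.posSemidef_self_mul_conjTranspose Z
  have hpd : (Z * Zᴴ).PosDef := hpsd.posDef_iff_isUnit.2
    ((Matrix.isUnit_iff_isUnit_det _).2 (isUnit_iff_ne_zero.2 hZ))
  obtain ⟨E, μ, hE, hE', hμ, hH⟩ := exists_unitary_diagonal hpd
  -- With `Z Zᴴ = Lᴴ L`, the substitution `ζ ↦ L ζ` has real Jacobian `|det L|² = det (Z Zᴴ)`.
  set L : Matrix α α ℂ := Matrix.diagonal (fun l => (Real.sqrt (μ l) : ℂ)) * Eᴴ with hL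
  have hLL : Lᴴ * L = Z * Zᴴ := by
    rw [hH, hL, Matrix.conjTranspose_mul, Matrix.conjTranspose_conjTranspose,
      Matrix.diagonal_conjTranspose, Matrix.mul_assoc, ← Matrix.mul_assoc (Matrix.diagonal _),
      Matrix.diagonal_mul_diagonal, Matrix.mul_assoc]
    congr 3
    funext l
    have h1 : Real.sqrt (μ l) * Real.sqrt (μ l) = μ l := Real.mul_self_sqrt (hμ l).le
    have h2 : ((Real.sqrt (μ l) : ℝ) : ℂ) * ((Real.sqrt (μ l) : ℝ) : ℂ) = (μ l : ℂ) := by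
      exact_mod_cast h1
    simpa using h2
  have hq : ∀ ζ : α → ℂ, ∑ k, ‖(Zᴴ *ᵥ ζ) k‖ ^ 2 = ∑ a, ‖(L *ᵥ ζ) a‖ ^ 2 := by
    intro ζ
    have h1 := sum_norm_sq_mulVec Zᴴ ζ
    have h2 := sum_norm_sq_mulVec L ζ
    rw [Matrix.conjTranspose_conjTranspose, ← hLL, ← h2] at h1
    exact_mod_cast h1
  have hdet : (Z * Zᴴ).det = ((Complex.normSq L.det : ℝ) : ℂ) := by
    rw [← hLL, Matrix.det_mul, Matrix.det_conjTranspose, mul_comm, RCLike.star_def,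
      Complex.mul_conj]
  have hLdet : Complex.normSq L.det ≠ 0 := by
    intro h
    rw [hdet, h] at hZ
    exact hZ (by simp)
  have hdetf : LinearMap.det ((Matrix.toLin' L).restrictScalars ℝ) = Complex.normSq L.det := by
    rw [LinearMap.det_restrictScalars, LinearMap.det_toLin', Algebra.norm_complex_eq]
    rfl
  have hmap := Measure.map_linearMap_addHaar_eq_smul_addHaar (volume : Measure (α → ℂ))
    (f := (Matrix.toLin' L).restrictScalars ℝ) (by rw [hdetf]; exact hLdet)
  simp_rw [hq]
  have hm : Measurable ((Matrix.toLin' L).restrictScalars ℝ) :=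
    (LinearMap.continuous_of_finiteDimensional _).measurable
  have h5 : ∫⁻ ζ : α → ℂ, ENNReal.ofReal (Real.exp (-∑ a, ‖(L *ᵥ ζ) a‖ ^ 2))
      = ∫⁻ ζ, ENNReal.ofReal (Real.exp (-∑ a, ‖ζ a‖ ^ 2))
          ∂(Measure.map ((Matrix.toLin' L).restrictScalars ℝ) volume) := by
    rw [lintegral_map (by fun_prop) hm]
    rfl
  rw [h5, hmap, lintegral_smul_measure, hdetf, hdet, Complex.ofReal_re, smul_eq_mul, mul_comm,
    ← mul_assoc, ← ENNReal.ofReal_mul (Complex.normSq_nonneg _),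
    abs_of_nonneg (inv_nonneg.2 (Complex.normSq_nonneg _)), mul_inv_cancel₀ hLdet]
  simp [complexGaussInt]

/-- Fischer's inequality with a block of size one, read off from the Schur complement. -/
theorem re_det_fromBlocks_le [DecidableEq α] {A : Matrix α α ℂ} (hA : A.PosDef)
    (B : Matrix α Unit ℂ) (x : Matrix Unit Unit ℂ) :
    (Matrix.fromBlocks A B Bᴴ x).det.re ≤ A.det.re * (x () ()).re := by
  have hAd := hA.det_pos
  have : Invertible A := A.invertibleOfIsUnitDet (isUnit_iff_ne_zero.2 hAd.ne')
  rw [Matrix.det_fromBlocks₁₁]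
  have h1 : (Bᴴ * ⅟A * B).PosSemidef := by
    rw [Matrix.invOf_eq_nonsing_inv]
    exact hA.inv.posSemidef.conjTranspose_mul_mul_same B
  have h2 : 0 ≤ ((Bᴴ * ⅟A * B) () ()).re := by
    have := h1.diag_nonneg (i := ())
    exact (Complex.le_def.1 this).1
  have him : A.det.im = 0 := (Complex.lt_def.1 hAd).2.symm
  have hre : 0 < A.det.re := (Complex.lt_def.1 hAd).1
  rw [Complex.mul_re, him, zero_mul, sub_zero, Matrix.det_unique (x - Bᴴ * ⅟A * B),
    Matrix.sub_apply, Complex.sub_re]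
  exact mul_le_mul_of_nonneg_left (by linarith [h2]) hre.le

/-- If `0 < S ≤ c`, adding one orthonormal row to `T` multiplies `det (T S Tᴴ)` by at
most `c`. -/
theorem re_det_compression_le [DecidableEq α] [DecidableEq ι] {S O : Matrix ι ι ℂ} {s : ι → ℝ}
    {c : ℝ} (hO : Oᴴ * O = 1) (hs : ∀ i, 0 < s i) (hc : ∀ i, s i ≤ c)
    (hS : S = O * Matrix.diagonal (fun i => (s i : ℂ)) * Oᴴ) (T : Matrix (α ⊕ Unit) ι ℂ)
    (hT : T * Tᴴ = 1) :
    0 ≤ (T.toRows₁ * S * T.toRows₁ᴴ).det.re ∧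
    (T * S * Tᴴ).det.re ≤ (T.toRows₁ * S * T.toRows₁ᴴ).det.re * c := by
  have hO' : O * Oᴴ = 1 := mul_eq_one_comm.1 hO
  have hSpd : S.PosDef := by
    rw [hS]
    refine Matrix.PosDef.mul_mul_conjTranspose_same (Matrix.PosDef.diagonal fun i => by
      exact_mod_cast hs i) ?_
    intro x y hxy
    have := congrArg (fun v => v ᵥ* Oᴴ) hxy
    simpa [Matrix.vecMul_vecMul, hO'] using this
  have hcS : ((c : ℂ) • (1 : Matrix ι ι ℂ) - S).PosSemidef := by
    have h1 : (c : ℂ) • (1 : Matrix ι ι ℂ) - S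
        = O * Matrix.diagonal (fun i => ((c - s i : ℝ) : ℂ)) * Oᴴ := by
      have : Matrix.diagonal (fun i => ((c - s i : ℝ) : ℂ))
          = (c : ℂ) • (1 : Matrix ι ι ℂ) - Matrix.diagonal (fun i => (s i : ℂ)) := by
        ext i j
        by_cases hij : i = j <;> simp [Matrix.diagonal, hij]
      rw [this, Matrix.mul_sub, Matrix.sub_mul, ← hS, Matrix.mul_smul, Matrix.smul_mul,
        Matrix.mul_one, hO']
    rw [h1]
    exact (Matrix.PosSemidef.diagonal fun i => by
      have := sub_nonneg.2 (hc i)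
      show (0 : ℂ) ≤ ((c - s i : ℝ) : ℂ)
      exact_mod_cast this).mul_mul_conjTranspose_same O
  set T1 := T.toRows₁ with hT1
  set t := T.toRows₂ with ht
  have hTT : T = Matrix.fromRows T1 t := (Matrix.fromRows_toRows T).symm
  have hb : T * Tᴴ = Matrix.fromBlocks (T1 * T1ᴴ) (T1 * tᴴ) (t * T1ᴴ) (t * tᴴ) := by
    rw [hTT, Matrix.conjTranspose_fromRows_eq_fromCols_conjTranspose, Matrix.fromRows_mul_fromCols]
  rw [hT, ← Matrix.fromBlocks_one, Matrix.fromBlocks_inj] at hb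
  obtain ⟨h11, -, -, h22⟩ := hb
  have hApd : (T1 * S * T1ᴴ).PosDef := by
    refine hSpd.mul_mul_conjTranspose_same ?_
    intro x y hxy
    have := congrArg (fun v => v ᵥ* T1ᴴ) hxy
    simpa [Matrix.vecMul_vecMul, ← h11] using this
  have hbl : T * S * Tᴴ = Matrix.fromBlocks (T1 * S * T1ᴴ) (T1 * S * tᴴ) (T1 * S * tᴴ)ᴴ
      (t * S * tᴴ) := by
    rw [hTT, Matrix.conjTranspose_fromRows_eq_fromCols_conjTranspose, Matrix.fromRows_mul,
      Matrix.fromRows_mul_fromCols]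
    congr 1
    simp [Matrix.conjTranspose_mul, hSpd.1.eq, Matrix.mul_assoc]
  have hdet := (Complex.lt_def.1 hApd.det_pos).1
  refine ⟨hdet.le, ?_⟩
  rw [hbl]
  refine (re_det_fromBlocks_le hApd _ _).trans (mul_le_mul_of_nonneg_left ?_ hdet.le)
  have h3 := (hcS.mul_mul_conjTranspose_same t).diag_nonneg (i := ())
  have h4 : t * ((c : ℂ) • (1 : Matrix ι ι ℂ) - S) * tᴴ = (c : ℂ) • 1 - t * S * tᴴ := by
    rw [Matrix.mul_sub, Matrix.sub_mul, Matrix.mul_smul, Matrix.smul_mul, Matrix.mul_one, ← h22]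
  rw [h4] at h3
  have h5 := (Complex.le_def.1 h3).1
  simpa using h5

/-- As a function of the sample, the Gaussian kernel in `ζ` is a product of weights, one for each
row. -/
theorem prod_formWeight (T : Matrix α ι ℂ) (ζ : α → ℂ) (X : κ → ι → ℝ) :
    ∏ k, formWeight (fun i => ∑ a, star (T a i) * ζ a) (X k)
      = Real.exp (-∑ k, ‖((T * sampleMat X)ᴴ *ᵥ ζ) k‖ ^ 2) := by
  simp only [formWeight]
  rw [← Real.exp_sum, Finset.sum_neg_distrib]
  congr 2
  refine Finset.sum_congr rfl fun k _ => ?_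
  congr 2
  simp only [Matrix.mulVec, dotProduct, Matrix.conjTranspose_apply, Matrix.mul_apply, sampleMat,
    Finset.sum_mul, star_sum, star_mul']
  rw [Finset.sum_comm]
  refine Finset.sum_congr rfl fun a _ => ?_
  refine Finset.sum_congr rfl fun i _ => ?_
  simp
  ring

theorem continuous_gram_det [DecidableEq α] (T : Matrix α ι ℂ) :
    Continuous fun X : κ → ι → ℝ => ((T * sampleMat X) * (T * sampleMat X)ᴴ).det := by
  have h : Continuous fun X : κ → ι → ℝ => T * sampleMat X := by
    refine continuous_const.matrix_mul ?_
    refine continuous_matrix fun i k => ?_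
    unfold sampleMat
    fun_prop
  exact (h.matrix_mul h.matrix_conjTranspose).matrix_det

theorem gram_det_nonneg [DecidableEq α] (Z : Matrix α κ ℂ) : 0 ≤ (Z * Zᴴ).det.re :=
  (Complex.le_def.1 (Matrix.posSemidef_self_mul_conjTranspose Z).det_nonneg).1

theorem lintegral_gram_det_mul_exp [DecidableEq α] [DecidableEq κ] (T : Matrix α ι ℂ) (m : ι → ℂ) :
    ∫⁻ X : κ → ι → ℝ, ENNReal.ofReal (((T * sampleMat X) * (T * sampleMat X)ᴴ).det.re *
      ∏ k, formWeight m (X k)) ∂gaussMat κ ι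
      = ENNReal.ofReal ((Fintype.card κ).descFactorial (Fintype.card α) *
        ((∫ x, formWeight m x ∂gaussVec ι) ^ (Fintype.card κ - Fintype.card α) *
        (T * weightedMoment (formWeight m) * Tᴴ).det.re)) := by
  obtain ⟨h1, h2⟩ := integral_det_mul_prod (κ := κ) (measurable_formWeight m)
    (abs_formWeight_le m) T
  have h3 := congrArg Complex.re h2
  have hre : ∀ X : κ → ι → ℝ, (((T * sampleMat X) * (T * sampleMat X)ᴴ).det *
      ∏ k, (formWeight m (X k) : ℂ)).re = ((T * sampleMat X) * (T * sampleMat X)ᴴ).det.re *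
      ∏ k, formWeight m (X k) := by
    intro X
    rw [← Complex.ofReal_prod, Complex.re_mul_ofReal]
  rw [← RCLike.re_eq_complex_re, ← integral_re h1] at h3
  have h4 := h1.re
  simp only [RCLike.re_eq_complex_re, hre] at h3 h4
  rw [← ofReal_integral_eq_lintegral_ofReal h4 (.of_forall fun X => mul_nonneg (gram_det_nonneg _)
    (Finset.prod_nonneg fun k _ => (formWeight_pos m _).le)), h3]
  congr 1
  rw [← Complex.ofReal_pow, ← Complex.ofReal_natCast, Complex.re_ofReal_mul, Complex.re_ofReal_mul]

/-- To integrate a ratio `g / f`, write `1 / f` as an integral of a kernel `e` and compare the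
weighted integrals of `g` and `f` for each value of the auxiliary variable. -/
theorem lintegral_div_le_of_kernel {S Y : Type*} [MeasurableSpace S] [MeasurableSpace Y]
    {μ : Measure S} {ν : Measure Y} [IsProbabilityMeasure μ] [SFinite ν] {f g : S → ℝ}
    {e : S → Y → ℝ} (hf : Measurable f) (hg : Measurable g) (he : Measurable (Function.uncurry e))
    (hf0 : ∀ x, 0 ≤ f x) (hg0 : ∀ x, 0 ≤ g x) {c q : ℝ≥0∞} (hc0 : c ≠ 0) (hc : c ≠ ∞) (hq : q ≠ ∞)
    (hk : ∀ x, f x ≠ 0 → (∫⁻ y, ENNReal.ofReal (e x y) ∂ν) * ENNReal.ofReal (f x) = c)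
    (hfix : ∀ y, ∫⁻ x, ENNReal.ofReal (g x * e x y) ∂μ
      ≤ q * ∫⁻ x, ENNReal.ofReal (f x * e x y) ∂μ) :
    ∫⁻ x, ENNReal.ofReal (g x / f x) ∂μ ≤ q := by
  have he' : ∀ x, Measurable (e x) := fun x => he.comp (by fun_prop : Measurable (Prod.mk x))
  have hup : ∀ x, c * ENNReal.ofReal (g x / f x) ≤ ∫⁻ y, ENNReal.ofReal (g x * e x y) ∂ν := by
    intro x
    by_cases h0 : f x = 0
    · simp [h0]
    simp_rw [ENNReal.ofReal_mul (hg0 x)]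
    rw [lintegral_const_mul _ (he' x).ennreal_ofReal, ← hk x h0, mul_assoc,
      ← ENNReal.ofReal_mul (hf0 x), mul_div_cancel₀ _ h0, mul_comm]
  have hlow : ∀ x, ∫⁻ y, ENNReal.ofReal (f x * e x y) ∂ν ≤ c := by
    intro x
    by_cases h0 : f x = 0
    · simp [h0]
    simp_rw [ENNReal.ofReal_mul (hf0 x)]
    rw [lintegral_const_mul _ (he' x).ennreal_ofReal, ← hk x h0, mul_comm]
  refine (ENNReal.mul_le_mul_iff_right hc0 hc).1 ?_
  calc c * ∫⁻ x, ENNReal.ofReal (g x / f x) ∂μ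
      = ∫⁻ x, c * ENNReal.ofReal (g x / f x) ∂μ :=
        (lintegral_const_mul _ (hg.div hf).ennreal_ofReal).symm
    _ ≤ ∫⁻ x, ∫⁻ y, ENNReal.ofReal (g x * e x y) ∂ν ∂μ := lintegral_mono hup
    _ = ∫⁻ y, ∫⁻ x, ENNReal.ofReal (g x * e x y) ∂μ ∂ν :=
        lintegral_lintegral_swap ((hg.comp measurable_fst).mul he).ennreal_ofReal.aemeasurable
    _ ≤ ∫⁻ y, q * ∫⁻ x, ENNReal.ofReal (f x * e x y) ∂μ ∂ν := lintegral_mono hfix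
    _ = q * ∫⁻ y, ∫⁻ x, ENNReal.ofReal (f x * e x y) ∂μ ∂ν := lintegral_const_mul' _ _ hq
    _ = q * ∫⁻ x, ∫⁻ y, ENNReal.ofReal (f x * e x y) ∂ν ∂μ := by
        congr 1
        exact (lintegral_lintegral_swap (f := fun x y => ENNReal.ofReal (f x * e x y))
          ((hf.comp measurable_fst).mul he).ennreal_ofReal.aemeasurable).symm
    _ ≤ q * ∫⁻ _x, c ∂μ := by
        gcongr with x
        exact hlow x
    _ = c * q := by simp [mul_comm]

/-- One more row of `T` replaces one factor `c` (the mean of the weight) by at most `c` in the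
expected Gram determinant, and multiplies the number of choices of rows by the codimension. -/
theorem lintegral_gram_det_mul_exp_le [DecidableEq α] [DecidableEq κ] [DecidableEq ι]
    (T : Matrix (α ⊕ Unit) ι ℂ) (hT : T * Tᴴ = 1) (hcard : Fintype.card α < Fintype.card κ)
    (m : ι → ℂ) :
    ∫⁻ X : κ → ι → ℝ, ENNReal.ofReal (((T * sampleMat X) * (T * sampleMat X)ᴴ).det.re *
      ∏ k, formWeight m (X k)) ∂gaussMat κ ι
      ≤ ENNReal.ofReal ((Fintype.card κ : ℝ) - Fintype.card α) *
        ∫⁻ X : κ → ι → ℝ, ENNReal.ofReal (((T.toRows₁ * sampleMat X) *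
          (T.toRows₁ * sampleMat X)ᴴ).det.re * ∏ k, formWeight m (X k)) ∂gaussMat κ ι := by
  rw [lintegral_gram_det_mul_exp T m, lintegral_gram_det_mul_exp T.toRows₁ m,
    ← ENNReal.ofReal_mul (by
      rw [sub_nonneg]
      exact_mod_cast hcard.le)]
  refine ENNReal.ofReal_le_ofReal ?_
  obtain ⟨O, s, hO, hs, hc, hS⟩ := exists_weightedMoment_formWeight m
  obtain ⟨hnn, hle⟩ := re_det_compression_le hO hs hc hS T hT
  have hcnn : 0 ≤ ∫ x, formWeight m x ∂gaussVec ι :=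
    integral_nonneg fun x => (formWeight_pos _ _).le
  have hcs : Fintype.card (α ⊕ Unit) = Fintype.card α + 1 := by simp
  obtain ⟨q, hq⟩ := Nat.exists_eq_add_of_lt hcard
  rw [hcs, Nat.descFactorial_succ, hq]
  have e1 : Fintype.card α + q + 1 - (Fintype.card α + 1) = q := by omega
  have e2 : Fintype.card α + q + 1 - Fintype.card α = q + 1 := by omega
  rw [e1, e2]
  push_cast
  generalize (∫ x, formWeight m x ∂gaussVec ι) = c at *
  calc _ ≤ ((q : ℝ) + 1) * ((Fintype.card α + q + 1).descFactorial (Fintype.card α) : ℝ) *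
        (c ^ q * ((T.toRows₁ * weightedMoment (formWeight m) * T.toRows₁ᴴ).det.re * c)) := by
          gcongr
    _ = _ := by ring

/-- If the rows of `T` are orthonormal, the squared distance of the last row of a sample of `T`
from the span of the other rows, a ratio of Gram determinants, has expectation at most the
codimension. The reciprocal of the denominator is replaced by a Gaussian integral in an auxiliary
variable `ζ`; for fixed `ζ` the samples remain independent, with a weight `exp (-|mᵀ x|²)`. -/
theorem lintegral_gram_ratio_le [DecidableEq α] [DecidableEq κ] [DecidableEq ι]
    (T : Matrix (α ⊕ Unit) ι ℂ) (hT : T * Tᴴ = 1) (hcard : Fintype.card α < Fintype.card κ) :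
    ∫⁻ X : κ → ι → ℝ, ENNReal.ofReal (((T * sampleMat X) * (T * sampleMat X)ᴴ).det.re /
        ((T.toRows₁ * sampleMat X) * (T.toRows₁ * sampleMat X)ᴴ).det.re) ∂gaussMat κ ι
      ≤ ENNReal.ofReal ((Fintype.card κ : ℝ) - Fintype.card α) := by
  have hce : Continuous (Function.uncurry fun (X : κ → ι → ℝ) (ζ : α → ℂ) =>
      Real.exp (-∑ k, ‖((T.toRows₁ * sampleMat X)ᴴ *ᵥ ζ) k‖ ^ 2)) := by
    have h : Continuous fun p : (κ → ι → ℝ) × (α → ℂ) =>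
        (T.toRows₁ * sampleMat p.1)ᴴ *ᵥ p.2 := by
      refine Continuous.matrix_mulVec ?_ continuous_snd
      refine Continuous.matrix_conjTranspose ?_
      refine continuous_const.matrix_mul ?_
      refine continuous_matrix fun i k => ?_
      unfold sampleMat
      fun_prop
    exact Real.continuous_exp.comp
      (continuous_finsetSum _ fun k _ => (((continuous_apply k).comp h).norm.pow 2)).neg
  refine lintegral_div_le_of_kernel (ν := (volume : Measure (α → ℂ)))
    (Complex.continuous_re.comp (continuous_gram_det T.toRows₁)).measurable
    (Complex.continuous_re.comp (continuous_gram_det T)).measurable hce.measurable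
    (fun _ => gram_det_nonneg _) (fun _ => gram_det_nonneg _) (complexGaussInt_ne_zero (α := α))
    complexGaussInt_ne_top ENNReal.ofReal_ne_top (fun X hX => ?_) (fun ζ => ?_)
  · refine lintegral_exp_neg_gram_mul_det (T.toRows₁ * sampleMat X) fun h => hX ?_
    simp only [h, Complex.zero_re, Function.comp]
  · simp_rw [← prod_formWeight T.toRows₁ ζ]
    exact lintegral_gram_det_mul_exp_le T hT hcard _

end

/-! ### Gaussian vectors are in general position -/

section

variable {ι α : Type*} [Fintype ι] [Fintype α]

/-- A reflection that maps a given vector to the positive half of a coordinate axis. -/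
theorem exists_reflection [DecidableEq ι] (u : ι → ℝ) (i : ι) :
    ∃ O : Matrix ι ι ℝ, Oᵀ = O ∧ O * O = 1 ∧
      O *ᵥ u = Real.sqrt (u ⬝ᵥ u) • (Pi.single i 1 : ι → ℝ) := by
  set ρ := Real.sqrt (u ⬝ᵥ u) with hρ
  set v : ι → ℝ := u - ρ • (Pi.single i 1 : ι → ℝ) with hv
  have huu : 0 ≤ u ⬝ᵥ u := Finset.sum_nonneg fun j _ => mul_self_nonneg _
  have hρ2 : ρ * ρ = u ⬝ᵥ u := Real.mul_self_sqrt huu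
  have hvv : v ⬝ᵥ v = 2 * (v ⬝ᵥ u) := by
    simp only [hv, sub_dotProduct, dotProduct_sub, smul_dotProduct, dotProduct_smul,
      single_one_dotProduct, dotProduct_single_one, smul_eq_mul, Pi.sub_apply, Pi.smul_apply,
      Pi.single_eq_same]
    linear_combination hρ2
  by_cases hv0 : v ⬝ᵥ v = 0
  · refine ⟨1, Matrix.transpose_one, by simp, ?_⟩
    rw [dotProduct_self_eq_zero, hv, sub_eq_zero] at hv0
    rw [Matrix.one_mulVec, ← hv0]
  · refine ⟨1 - (2 / (v ⬝ᵥ v)) • Matrix.vecMulVec v v, ?_, ?_, ?_⟩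
    · rw [Matrix.transpose_sub, Matrix.transpose_one, Matrix.transpose_smul,
        Matrix.transpose_vecMulVec]
    · rw [Matrix.sub_mul, Matrix.one_mul, Matrix.mul_sub, Matrix.mul_one, Matrix.smul_mul,
        Matrix.mul_smul, Matrix.vecMulVec_mul_vecMulVec, Matrix.vecMulVec_smul, smul_smul, smul_smul]
      rw [sub_sub, add_sub_assoc', sub_eq_self, ← add_smul, ← sub_smul]
      convert zero_smul ℝ _ using 2
      field_simp
      ring
    · rw [Matrix.sub_mulVec, Matrix.one_mulVec, Matrix.smul_mulVec, Matrix.vecMulVec_mulVec]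
      have h1 : v ⬝ᵥ u ≠ 0 := fun h => hv0 (by rw [hvv, h, mul_zero])
      have h2 : 2 / (v ⬝ᵥ v) * (v ⬝ᵥ u) = 1 := by
        rw [hvv]
        field_simp
      ext j
      have h3 : u j = v j + (ρ • (Pi.single i 1 : ι → ℝ)) j := by simp [hv]
      simp only [Pi.sub_apply, Pi.smul_apply, MulOpposite.smul_eq_mul_unop, MulOpposite.unop_op,
        smul_eq_mul]
      simp only [Pi.smul_apply, smul_eq_mul] at h3
      linear_combination h3 - v j * h2

/-- A reflection turns a hyperplane that contains the subspace into a coordinate hyperplane. -/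
theorem gaussVec_submodule_eq_zero [DecidableEq ι] {U : Submodule ℝ (ι → ℝ)} (hU : U ≠ ⊤) :
    gaussVec ι U = 0 := by
  obtain ⟨f, hf, hfU⟩ := U.exists_le_ker_of_lt_top hU.lt_top
  set a : ι → ℝ := fun i => f (Pi.single i 1) with ha
  have hfa : ∀ x, f x = a ⬝ᵥ x := by
    intro x
    conv_lhs => rw [← Finset.univ_sum_single x]
    rw [map_sum, dotProduct]
    refine Finset.sum_congr rfl fun i _ => ?_
    rw [ha, show (Pi.single i (x i) : ι → ℝ) = x i • Pi.single i 1 by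
      rw [← Pi.single_smul, smul_eq_mul, mul_one], map_smul, smul_eq_mul, mul_comm]
  have ha0 : a ≠ 0 := by
    intro h
    apply hf
    ext x
    simp [hfa, h]
  obtain ⟨i, -⟩ := Function.ne_iff.1 ha0
  have haa : 0 < a ⬝ᵥ a := by
    refine lt_of_le_of_ne (Finset.sum_nonneg fun j _ => mul_self_nonneg _) fun h => ha0 ?_
    exact dotProduct_self_eq_zero.1 h.symm
  obtain ⟨O, hOt, hO, hOa⟩ := exists_reflection a i
  have hsub : (U : Set (ι → ℝ)) ⊆ {x | a ⬝ᵥ x = 0} := by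
    intro x hx
    have := hfU hx
    rw [LinearMap.mem_ker, hfa] at this
    exact this
  refine measure_mono_null hsub ?_
  have hm : Measurable (fun x : ι → ℝ => O *ᵥ x) := by
    unfold Matrix.mulVec dotProduct; fun_prop
  have hms : MeasurableSet {x : ι → ℝ | a ⬝ᵥ x = 0} := by
    refine measurableSet_eq_fun ?_ measurable_const
    unfold dotProduct; fun_prop
  rw [← gaussVec_map_mulVec O (by rw [hOt, hO]), Measure.map_apply hm hms]
  have : (fun x : ι → ℝ => O *ᵥ x) ⁻¹' {x | a ⬝ᵥ x = 0} = {x | x i = 0} := by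
    ext x
    have h1 : a ⬝ᵥ O *ᵥ x = Real.sqrt (a ⬝ᵥ a) * x i := by
      rw [Matrix.dotProduct_mulVec, ← Matrix.mulVec_transpose, hOt, hOa, smul_dotProduct,
        single_one_dotProduct, smul_eq_mul]
    simp [h1, (Real.sqrt_pos.2 haa).ne']
  rw [this]
  have := nullSingletonClass_gaussianReal (μ := 0) (v := 1) (by norm_num)
  exact Measure.pi_hyperplane _ i 0

theorem ae_gaussVec_ne_zero [DecidableEq ι] [Nonempty ι] : ∀ᵐ u ∂gaussVec ι, u ≠ 0 := by
  have h := gaussVec_submodule_eq_zero (ι := ι) (U := ⊥) bot_ne_top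
  rw [ae_iff]
  simpa using h

/-- Real Gaussian vectors are in general position for a complex matrix. By induction, a new vector
`x` has to avoid the real subspace of those `x` with `B x` in the complex span of the earlier
images; this is a proper subspace as long as the span has dimension less than `rank B`, because the
real coordinate vectors already give all the columns of `B`. -/
theorem ae_linearIndependent_mulVec [DecidableEq ι] (B : Matrix α ι ℂ) (k : ℕ) (hk : k ≤ B.rank) :
    ∀ᵐ X ∂gaussMat (Fin k) ι,
      LinearIndependent ℂ (fun l => B *ᵥ (fun i => (X l i : ℂ))) := by
  induction k with
  | zero => exact .of_forall fun X => linearIndependent_empty_type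
  | succ k ih =>
    specialize ih (by omega)
    have hmeas : ∀ k, MeasurableSet {X : Fin k → ι → ℝ |
        LinearIndependent ℂ (fun l => B *ᵥ (fun i => (X l i : ℂ)))} := by
      intro k
      refine ((isOpen_setOfPred_linearIndependent (𝕜 := ℂ) (E := α → ℂ)
        (ι := Fin k)).preimage ?_).measurableSet
      refine continuous_pi fun l => ?_
      refine Continuous.matrix_mulVec continuous_const ?_
      fun_prop
    have hmp := (measurePreserving_piFinSuccAbove (fun _ : Fin (k + 1) => gaussVec ι) 0).symm
    unfold gaussMat
    have hm2 : MeasurableSet {z : (ι → ℝ) × (Fin k → ι → ℝ) | LinearIndependent ℂ (fun l =>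
        B *ᵥ (fun i => (((MeasurableEquiv.piFinSuccAbove (fun _ : Fin (k + 1) => ι → ℝ) 0).symm z :
          Fin (k + 1) → ι → ℝ) l i : ℂ)))} := hmp.measurable (hmeas (k + 1))
    rw [← hmp.map_eq, ae_map_iff hmp.measurable.aemeasurable (hmeas (k + 1)),
      Measure.ae_prod_iff_ae_ae hm2]
    refine (Measure.ae_ae_comm (p := fun x X => LinearIndependent ℂ (fun l =>
        B *ᵥ (fun i => (((MeasurableEquiv.piFinSuccAbove (fun _ : Fin (k + 1) => ι → ℝ) 0).symm
          (x, X) : Fin (k + 1) → ι → ℝ) l i : ℂ)))) hm2).2 ?_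
    filter_upwards [ih] with X hX
    set U := Submodule.span ℂ (Set.range fun l => B *ᵥ (fun i => (X l i : ℂ))) with hUdef
    let L : (ι → ℝ) →ₗ[ℝ] (α → ℂ) :=
      { toFun := fun x => B *ᵥ (fun i => (x i : ℂ))
        map_add' := fun x y => by
          rw [← Matrix.mulVec_add]
          congr 1
          ext i
          simp
        map_smul' := fun c x => by
          ext a
          simp [Matrix.mulVec, dotProduct, Finset.mul_sum]
          exact Finset.sum_congr rfl fun i _ => by ring }
    have hne : (U.restrictScalars ℝ).comap L ≠ ⊤ := by
      intro htop
      have hall : ∀ x : ι → ℝ, B *ᵥ (fun i => (x i : ℂ)) ∈ U := fun x => by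
        have : x ∈ (U.restrictScalars ℝ).comap L := htop ▸ Submodule.mem_top
        exact this
      have hle : LinearMap.range B.mulVecLin ≤ U := by
        rw [Matrix.range_mulVecLin, Submodule.span_le]
        rintro _ ⟨i, rfl⟩
        have := hall (Pi.single i 1)
        have he : (fun j => (((Pi.single i 1 : ι → ℝ) j : ℝ) : ℂ)) = Pi.single i 1 := by
          ext j
          by_cases h : j = i
          · subst h; simp
          · simp [h]
        rw [he, Matrix.mulVec_single_one] at this
        exact this
      have h1 := Submodule.finrank_mono hle
      have h2 : Module.finrank ℂ U = k := by
        rw [hUdef, finrank_span_eq_card hX, Fintype.card_fin]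
      have h3 : B.rank = Module.finrank ℂ (LinearMap.range B.mulVecLin) := rfl
      omega
    have h0 := gaussVec_submodule_eq_zero hne
    have : ∀ᵐ x ∂gaussVec ι, x ∉ (U.restrictScalars ℝ).comap L := by
      rw [ae_iff]
      simp only [not_not]
      exact h0
    filter_upwards [this] with x hx
    have hcons : (fun l => B *ᵥ (fun i => (((MeasurableEquiv.piFinSuccAbove
        (fun _ => ι → ℝ) 0).symm (x, X) : Fin (k + 1) → ι → ℝ) l i : ℂ)))
        = Fin.cons (B *ᵥ (fun i => (x i : ℂ))) (fun l => B *ᵥ (fun i => (X l i : ℂ))) := by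
      ext l a
      refine Fin.cases ?_ (fun l => ?_) l <;>
        simp [MeasurableEquiv.piFinSuccAbove, Fin.insertNthEquiv]
    show LinearIndependent ℂ _
    rw [hcons, linearIndependent_finCons]
    exact ⟨hX, hx⟩

theorem gaussMat_map_injective {κ κ' : Type*} [Fintype κ] [Fintype κ'] {g : κ' → κ}
    (hg : Function.Injective g) :
    (gaussMat κ ι).map (fun X l => X (g l)) = gaussMat κ' ι := by
  have h := (iIndepFun_pi (μ := fun _ : κ => gaussVec ι) (X := fun _ x => x)
    fun _ => aemeasurable_id).precomp hg
  rw [iIndepFun_iff_map_fun_eq_pi_map fun l => (measurable_pi_apply (g l)).aemeasurable] at h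
  refine h.trans ?_
  unfold gaussMat
  congr 1
  funext l
  exact (measurePreserving_eval (fun _ : κ => gaussVec ι) (g l)).map_eq

theorem ae_linearIndependent_mulVec_comp [DecidableEq ι] {κ : Type*} [Fintype κ]
    (B : Matrix α ι ℂ) {k : ℕ} (hk : k ≤ B.rank) {g : Fin k → κ} (hg : Function.Injective g) :
    ∀ᵐ X ∂gaussMat κ ι, LinearIndependent ℂ (fun l => B *ᵥ (fun i => (X (g l) i : ℂ))) := by
  have h := ae_linearIndependent_mulVec B k hk
  rw [← gaussMat_map_injective hg] at h
  exact ae_of_ae_map (f := fun (X : κ → ι → ℝ) l => X (g l)) (p := fun X : Fin k → ι → ℝ =>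
    LinearIndependent ℂ (fun l => B *ᵥ (fun i => (X l i : ℂ))))
    (measurable_pi_lambda _ fun l => measurable_pi_apply (g l)).aemeasurable h

theorem rank_mul_sampleMat_of_linearIndependent {κ : Type*} [Fintype κ] {r : ℕ}
    {B : Matrix (Fin r) ι ℂ} {X : κ → ι → ℝ} {g : Fin r → κ}
    (h : LinearIndependent ℂ (fun l => B *ᵥ (fun i => (X (g l) i : ℂ)))) :
    (B * sampleMat X).rank = r := by
  refine le_antisymm ((Matrix.rank_le_card_height _).trans (by simp)) ?_
  have h1 : ((B * sampleMat X).submatrix id g)ᵀ.rank = r := by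
    have : LinearIndependent ℂ (((B * sampleMat X).submatrix id g)ᵀ).row := h
    rw [this.rank_matrix, Fintype.card_fin]
  rw [Matrix.rank_transpose] at h1
  exact h1.symm.le.trans (Matrix.rank_submatrix_le _ _ _)

open scoped ComplexOrder in
theorem isUnit_gram_det_of_rank {κ : Type*} [Fintype κ] {r : ℕ} {Z : Matrix (Fin r) κ ℂ}
    (h : Z.rank = r) : IsUnit (Z * Zᴴ).det := by
  rw [← Matrix.isUnit_iff_isUnit_det, ← Matrix.mulVec_surjective_iff_isUnit]
  have h1 : Module.finrank ℂ (LinearMap.range (Z * Zᴴ).mulVecLin) = r :=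
    (Matrix.rank_self_mul_conjTranspose Z).trans h
  have h2 : LinearMap.range (Z * Zᴴ).mulVecLin = ⊤ :=
    Submodule.eq_top_of_finrank_eq (by rw [h1]; simp)
  exact LinearMap.range_eq_top.1 h2

end

/-! ### The regularized Gram matrix of a sample -/

section
open scoped ComplexOrder

variable {κ ι μ α : Type*} [Fintype κ] [Fintype ι] [Fintype μ] [Fintype α]

theorem frobenius_norm_sq {p q : Type*} [Fintype p] [Fintype q] (C : Matrix p q ℂ) :
    ‖C‖ ^ 2 = ∑ i, ∑ j, ‖C i j‖ ^ 2 := by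
  rw [Matrix.frobenius_norm_def, ← Real.sqrt_eq_rpow, Real.sq_sqrt (by positivity)]
  simp

theorem weightedMoment_one [DecidableEq ι] : weightedMoment (fun _ : ι → ℝ => 1) = 1 := by
  ext i j
  have h := integral_gaussVec_mul_mul_exp (fun _ : ι => 0) i j
  simp only [zero_mul, neg_zero, Finset.sum_const_zero, Real.exp_zero, mul_one] at h
  simp only [weightedMoment, mul_one, h, integral_gauss_sq]
  by_cases hij : i = j
  · subst hij
    simp
  · simp [hij]

/-- The Frobenius norm is the root mean square of `|C x|` over a real Gaussian vector `x`. -/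
theorem lintegral_sum_norm_sq_mulVec (C : Matrix μ ι ℂ) :
    ∫⁻ x, ENNReal.ofReal (∑ a, ‖(C *ᵥ fun i => (x i : ℂ)) a‖ ^ 2) ∂gaussVec ι
      = ENNReal.ofReal (‖C‖ ^ 2) := by
  classical
  have h1 : ∀ a, Integrable (fun x : ι → ℝ => ‖∑ i, C a i * (x i : ℂ)‖ ^ 2) (gaussVec ι) ∧
      ∫ x : ι → ℝ, ‖∑ i, C a i * (x i : ℂ)‖ ^ 2 ∂gaussVec ι = ∑ i, ‖C a i‖ ^ 2 := by
    intro a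
    have hi := integrable_weighted_forms (w := fun _ : ι → ℝ => 1) measurable_const (by simp)
      (C a) (C a)
    have he := integral_weighted_forms (w := fun _ : ι → ℝ => 1) measurable_const (by simp)
      (C a) (C a)
    have hc : ∀ x : ι → ℝ, (∑ i, C a i * (x i : ℂ)) * star (∑ i, C a i * (x i : ℂ)) * ((1 : ℝ) : ℂ)
        = ((‖∑ i, C a i * (x i : ℂ)‖ ^ 2 : ℝ) : ℂ) := by
      intro x
      rw [RCLike.star_def, Complex.mul_conj']
      simp
    simp only [hc] at hi he
    refine ⟨hi.re.congr (.of_forall fun x => Complex.ofReal_re _), ?_⟩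
    rw [integral_complex_ofReal, weightedMoment_one] at he
    have h2 : ∑ i, ∑ j, C a i * (1 : Matrix ι ι ℂ) i j * star (C a j)
        = ((∑ i, ‖C a i‖ ^ 2 : ℝ) : ℂ) := by
      push_cast
      refine Finset.sum_congr rfl fun i _ => ?_
      rw [Finset.sum_eq_single i (fun j _ hj => by simp [Matrix.one_apply_ne' hj]) (by simp)]
      simp [Complex.mul_conj']
    rw [h2] at he
    exact_mod_cast he
  rw [← ofReal_integral_eq_lintegral_ofReal]
  · rw [frobenius_norm_sq]
    congr 1
    exact (integral_finsetSum _ fun a _ => (h1 a).1).trans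
      (Finset.sum_congr rfl fun a _ => (h1 a).2)
  · exact integrable_finsetSum _ fun a _ => (h1 a).1
  · exact .of_forall fun x => by positivity

/-- The Gram matrix of the images under `B` of a sample `X`, shifted by `ε`, which makes it positive
definite even when the images are dependent. -/
noncomputable def gramShift [DecidableEq κ] (B : Matrix μ ι ℂ) (ε : ℝ) (X : κ → ι → ℝ) :
    Matrix κ κ ℂ :=
  (B * sampleMat X)ᴴ * (B * sampleMat X) + (ε : ℂ) • 1

theorem gramShift_posDef [DecidableEq κ] (B : Matrix μ ι ℂ) {ε : ℝ} (hε : 0 < ε)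
    (X : κ → ι → ℝ) : (gramShift B ε X).PosDef := by
  have h1 : ((ε : ℂ) • (1 : Matrix κ κ ℂ)).PosDef :=
    Matrix.PosDef.one.smul (by exact_mod_cast hε)
  exact Matrix.PosDef.posSemidef_add (Matrix.posSemidef_conjTranspose_mul_self _) h1

theorem measurable_realQuad_gramShift_inv [DecidableEq κ] (B : Matrix μ ι ℂ) (ε : ℝ) :
    Measurable fun p : (κ → ι → ℝ) × (κ → ℝ) => realQuad (gramShift B ε p.1)⁻¹ p.2 := by
  have hc : Continuous fun X : κ → ι → ℝ => gramShift B ε X := by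
    have h : Continuous fun X : κ → ι → ℝ => B * sampleMat X := by
      refine continuous_const.matrix_mul ?_
      refine continuous_matrix fun i k => ?_
      unfold sampleMat
      fun_prop
    exact (h.matrix_conjTranspose.matrix_mul h).add continuous_const
  have hN : ∀ i j, Measurable fun p : (κ → ι → ℝ) × (κ → ℝ) => (gramShift B ε p.1)⁻¹ i j := by
    intro i j
    simp only [Matrix.inv_def, Ring.inverse_eq_inv', Matrix.smul_apply, smul_eq_mul]
    have h1 : Measurable fun p : (κ → ι → ℝ) × (κ → ℝ) => (gramShift B ε p.1).det :=
      (hc.matrix_det.comp continuous_fst).measurable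
    have h2 : Measurable fun p : (κ → ι → ℝ) × (κ → ℝ) => (gramShift B ε p.1).adjugate i j :=
      ((hc.matrix_adjugate.matrix_elem i j).comp continuous_fst).measurable
    exact h1.inv.mul h2
  simp only [realQuad, dotProduct, Matrix.mulVec]
  refine Complex.measurable_re.comp ?_
  refine Finset.measurable_fun_sum _ fun i _ => ?_
  refine Measurable.mul (by fun_prop) ?_
  refine Finset.measurable_fun_sum _ fun j _ => (hN i j).mul (by fun_prop)

/-- An orthogonal change of the sample acts on the argument of the quadratic form instead. For a
symmetric `O` no transposes are needed. -/
theorem gramShift_inv_orthogonal [DecidableEq κ] (B : Matrix μ ι ℂ) (ε : ℝ)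
    (O : Matrix κ κ ℝ) (hOt : Oᵀ = O) (hO : O * O = 1) (X : κ → ι → ℝ) (u : κ → ℝ) :
    realQuad (gramShift B ε (fun k i => ∑ l, O k l * X l i))⁻¹ u
      = realQuad (gramShift B ε X)⁻¹ (O *ᵥ u) := by
  set C : Matrix κ κ ℂ := O.map Complex.ofRealHom with hC
  have hCC : C * C = 1 := by
    rw [hC, ← Matrix.map_mul, hO, Matrix.map_one _ (by simp) (by simp)]
  have hCt : Cᵀ = C := by rw [hC, ← Matrix.transpose_map, hOt]
  have hCH : Cᴴ = C := by
    conv_rhs => rw [← hCt]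
    ext i j
    simp [hC, Matrix.conjTranspose_apply]
  have hs : sampleMat (fun k i => ∑ l, O k l * X l i) = sampleMat X * C := by
    conv_rhs => rw [← hCt]
    ext i k
    simp [sampleMat, Matrix.mul_apply, hC, mul_comm]
  have hg : gramShift B ε (fun k i => ∑ l, O k l * X l i) = C * gramShift B ε X * C := by
    rw [gramShift, gramShift, hs, ← Matrix.mul_assoc B, Matrix.conjTranspose_mul, hCH,
      Matrix.mul_add, Matrix.add_mul, Matrix.mul_smul, Matrix.mul_one, Matrix.smul_mul, hCC]
    simp only [Matrix.mul_assoc]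
  have hCinv : C⁻¹ = C := Matrix.inv_eq_right_inv hCC
  have hu : (fun i => (((O *ᵥ u) i : ℝ) : ℂ)) = C *ᵥ fun i => (u i : ℂ) := by
    ext i
    simp [hC, Matrix.mulVec, dotProduct]
  rw [hg, Matrix.mul_inv_rev, Matrix.mul_inv_rev, hCinv, realQuad, realQuad, hu,
    ← Matrix.mulVec_mulVec, ← Matrix.mulVec_mulVec, Matrix.dotProduct_mulVec _ C,
    ← Matrix.mulVec_transpose, hCt]

theorem realQuad_smul (N : Matrix κ κ ℂ) (c : ℝ) (u : κ → ℝ) :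
    realQuad N (c • u) = c ^ 2 * realQuad N u := by
  rw [realQuad_eq_dotProduct, realQuad_eq_dotProduct, Matrix.mulVec_smul, smul_dotProduct,
    dotProduct_smul, smul_eq_mul, smul_eq_mul]
  ring

/-- By rotation invariance, the mean of the inverse quadratic form depends on the vector only
through its length. -/
theorem lintegral_inv_realQuad_gramShift [DecidableEq κ] (B : Matrix μ ι ℂ) (ε : ℝ)
    (u : κ → ℝ) (k : κ) :
    ∫⁻ X : κ → ι → ℝ, ENNReal.ofReal (1 / realQuad (gramShift B ε X)⁻¹ u) ∂gaussMat κ ι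
      = ENNReal.ofReal (1 / (u ⬝ᵥ u)) * ∫⁻ X : κ → ι → ℝ,
        ENNReal.ofReal (1 / realQuad (gramShift B ε X)⁻¹ (Pi.single k 1)) ∂gaussMat κ ι := by
  classical
  obtain ⟨O, hOt, hO, hOu⟩ := exists_reflection u k
  have huu : 0 ≤ u ⬝ᵥ u := Finset.sum_nonneg fun j _ => mul_self_nonneg _
  have hm : ∀ u : κ → ℝ, Measurable fun X : κ → ι → ℝ =>
      ENNReal.ofReal (1 / realQuad (gramShift B ε X)⁻¹ u) := fun u =>
    (((measurable_realQuad_gramShift_inv B ε).comp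
      (by fun_prop : Measurable fun X : κ → ι → ℝ => (X, u))).const_div 1).ennreal_ofReal
  conv_lhs => rw [← gaussMat_map_orthogonal O (by rw [hOt, hO])]
  rw [lintegral_map (hm u) (by fun_prop), ← lintegral_const_mul _ (hm _)]
  refine lintegral_congr fun X => ?_
  rw [gramShift_inv_orthogonal B ε O hOt hO, hOu, realQuad_smul, Real.sq_sqrt huu,
    ← ENNReal.ofReal_mul (by positivity), one_div_mul_one_div]

/-- `E |u|⁻² = ∫₀^∞ (1 + 2 t)^{-D/2} dt = 1 / (D - 2)`. -/
theorem lintegral_gaussVec_inv_norm_sq [DecidableEq ι] [Nonempty ι] (h : 2 < Fintype.card ι) :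
    ∫⁻ u : ι → ℝ, ENNReal.ofReal (1 / (u ⬝ᵥ u)) ∂gaussVec ι
      = ENNReal.ofReal (1 / ((Fintype.card ι : ℝ) - 2)) := by
  have h1 := lintegral_gaussVec_inv_quadratic (fun _ : ι => 1) (fun _ => zero_le_one)
  have h2 := lintegral_rpow_Ioi (b := 1) (p := Fintype.card ι) one_pos (by exact_mod_cast h)
  rw [one_mul] at h2
  rw [← h2]
  have h3 : ∀ t ∈ Set.Ioi (0 : ℝ), ENNReal.ofReal ((1 + 2 * (t * 1)) ^ (-((Fintype.card ι : ℝ) / 2)))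
      = ENNReal.ofReal (∏ _i : ι, (1 + 2 * (t * 1)) ^ (-(1 / 2) : ℝ)) := by
    intro t ht
    have ht0 : (0 : ℝ) < t := ht
    rw [Finset.prod_const, Finset.card_univ, ← Real.rpow_natCast, ← Real.rpow_mul (by positivity)]
    congr 2
    ring
  rw [setLIntegral_congr_fun measurableSet_Ioi h3, h1]
  refine lintegral_congr_ae ?_
  filter_upwards [ae_gaussVec_ne_zero (ι := ι)] with u hu
  have hs : ∑ i, 1 * u i ^ 2 = u ⬝ᵥ u :=
    Finset.sum_congr rfl fun i _ => by ring
  have hpos : 0 < u ⬝ᵥ u := by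
    refine lt_of_le_of_ne (Finset.sum_nonneg fun j _ => mul_self_nonneg _) fun h => hu ?_
    exact dotProduct_self_eq_zero.1 h.symm
  rw [hs, lintegral_exp_neg_mul_Ioi hpos]

/-! ### The residual of a new sample -/

theorem sum_norm_sq_projection_le [DecidableEq μ] {P : Matrix μ μ ℂ} (hP : Pᴴ = P)
    (hPP : P * P = P) (y : μ → ℂ) : ∑ a, ‖((1 - P) *ᵥ y) a‖ ^ 2 ≤ ∑ a, ‖y a‖ ^ 2 := by
  have h1 := sum_norm_sq_mulVec (1 - P) y
  have h2 := sum_norm_sq_mulVec P y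
  have h3 := sum_norm_sq_mulVec (1 : Matrix μ μ ℂ) y
  have e : (1 - P)ᴴ * (1 - P) = 1 - P := by
    rw [Matrix.conjTranspose_sub, Matrix.conjTranspose_one, hP, Matrix.mul_sub, Matrix.sub_mul,
      Matrix.sub_mul, hPP]
    simp
  rw [e, Matrix.sub_mulVec (1 : Matrix μ μ ℂ) P, dotProduct_sub] at h1
  rw [hP, hPP] at h2
  rw [Matrix.conjTranspose_one, Matrix.one_mul] at h3
  rw [← h2, ← h3] at h1
  simp only [Matrix.one_mulVec] at h1
  have h4 : ∑ a, ‖((1 - P) *ᵥ y) a‖ ^ 2 = ∑ a, ‖y a‖ ^ 2 - ∑ a, ‖(P *ᵥ y) a‖ ^ 2 := by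
    rw [Matrix.sub_mulVec, Matrix.one_mulVec]
    exact_mod_cast h1
  have h5 : 0 ≤ ∑ a, ‖(P *ᵥ y) a‖ ^ 2 := by positivity
  linarith

/-- The squared residual of `B x` with respect to a subspace that contains the images of the other
samples is at most the reciprocal of a diagonal entry of the inverse Gram matrix. With
`y = M⁻¹ e₀`, the combination `∑ y_k B x_k` has squared length at most `y₀ = ⟨e₀, M⁻¹ e₀⟩`, and
modulo the subspace it equals `y₀ B x`. -/
theorem sum_norm_sq_residual_le [DecidableEq μ] {d : ℕ} (B : Matrix μ ι ℂ) {ε : ℝ} (hε : 0 < ε)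
    {P : Matrix μ μ ℂ} (hP : Pᴴ = P) (hPP : P * P = P) (X : Fin d → ι → ℝ)
    (hX : P * (B * sampleMat X) = B * sampleMat X) (x : ι → ℝ) :
    ∑ a, ‖(((1 - P) * B) *ᵥ fun i => (x i : ℂ)) a‖ ^ 2
      ≤ 1 / realQuad (gramShift B ε (Fin.cons x X : Fin (d + 1) → ι → ℝ))⁻¹ (Pi.single 0 1) := by
  set M := gramShift B ε (Fin.cons x X : Fin (d + 1) → ι → ℝ) with hM
  have hpd : M.PosDef := gramShift_posDef B hε _
  have hinv : (M⁻¹).PosDef := hpd.inv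
  set e : Fin (d + 1) → ℂ := Pi.single 0 1 with he
  set β := realQuad M⁻¹ (Pi.single 0 1) with hβ
  have hβpos : 0 < β := realQuad_pos hinv (by simp)
  have he' : (fun i => (((Pi.single 0 1 : Fin (d + 1) → ℝ) i : ℝ) : ℂ)) = e := by
    ext i
    refine Fin.cases ?_ (fun i => ?_) i <;> simp [he]
  set y := M⁻¹ *ᵥ e with hy
  have hstar : star e = e := by
    ext i
    refine Fin.cases ?_ (fun i => ?_) i <;> simp [he]
  have hβc : star e ⬝ᵥ y = (β : ℂ) := by
    have him := hinv.1.im_star_dotProduct_mulVec_self e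
    apply Complex.ext
    · rw [hβ, realQuad, he', Complex.ofReal_re, hstar]
    · simpa using him
  have hy0 : y 0 = β := by
    rw [← hβc, hstar, he, single_one_dotProduct]
  have hMy : M *ᵥ y = e := by
    rw [hy, Matrix.mulVec_mulVec, Matrix.mul_nonsing_inv _ (isUnit_iff_ne_zero.2 hpd.det_pos.ne'),
      Matrix.one_mulVec]
  have hq : star y ⬝ᵥ M *ᵥ y = β := by
    rw [hMy]
    have h : star y ⬝ᵥ e = star (star e ⬝ᵥ y) := by rw [Matrix.star_dotProduct]
    rw [h, hβc]
    simp
  set z := (B * sampleMat (Fin.cons x X : Fin (d + 1) → ι → ℝ)) *ᵥ y with hz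
  have hzβ : ∑ a, ‖z a‖ ^ 2 ≤ β := by
    have h1 := sum_norm_sq_mulVec (B * sampleMat (Fin.cons x X : Fin (d + 1) → ι → ℝ)) y
    have h3 := sum_norm_sq_mulVec (1 : Matrix (Fin (d + 1)) (Fin (d + 1)) ℂ) y
    rw [Matrix.conjTranspose_one, Matrix.one_mul] at h3
    rw [hM, gramShift, Matrix.add_mulVec, dotProduct_add, ← h1, Matrix.smul_mulVec,
      dotProduct_smul, ← h3, smul_eq_mul] at hq
    have h4 : ∑ a, ‖z a‖ ^ 2 + ε * ∑ a, ‖((1 : Matrix (Fin (d + 1)) (Fin (d + 1)) ℂ) *ᵥ y) a‖ ^ 2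
        = β := by exact_mod_cast hq
    have h5 : 0 ≤ ε * ∑ a, ‖((1 : Matrix (Fin (d + 1)) (Fin (d + 1)) ℂ) *ᵥ y) a‖ ^ 2 := by
      positivity
    linarith
  have hsplit : z = (β : ℂ) • (B *ᵥ fun i => (x i : ℂ)) + (B * sampleMat X) *ᵥ (Fin.tail y) := by
    rw [hz, ← Matrix.mulVec_mulVec, ← Matrix.mulVec_mulVec, ← Matrix.mulVec_smul,
      ← Matrix.mulVec_add]
    congr 1
    ext i
    rw [Matrix.mulVec, dotProduct, Fin.sum_univ_succ, hy0]
    simp [sampleMat, Matrix.mulVec, dotProduct, Fin.tail, mul_comm]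
  have hPz : (1 - P) *ᵥ z = (β : ℂ) • (((1 - P) * B) *ᵥ fun i => (x i : ℂ)) := by
    rw [hsplit, Matrix.mulVec_add, Matrix.mulVec_mulVec _ (1 - P) (B * sampleMat X), Matrix.sub_mul,
      hX, Matrix.one_mul, sub_self, Matrix.zero_mulVec, add_zero, Matrix.mulVec_smul,
      Matrix.mulVec_mulVec]
  have hfin := (sum_norm_sq_projection_le hP hPP z).trans hzβ
  rw [hPz] at hfin
  simp only [Pi.smul_apply, norm_smul, Complex.norm_real, Real.norm_eq_abs, mul_pow, sq_abs,
    ← Finset.mul_sum] at hfin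
  rw [le_div_iff₀ hβpos]
  nlinarith [hfin, hβpos]

end

/-! ### The mean residual of a Gaussian range finder -/

section
open scoped ComplexOrder

variable {κ ι μ α : Type*} [Fintype κ] [Fintype ι] [Fintype μ] [Fintype α]

/-- The indices `r, …, n - 1`. -/
def tailIdx (n r : ℕ) : Finset (Fin n) := Finset.univ.filter fun j => r ≤ (j : ℕ)

theorem mem_tailIdx {n r : ℕ} {j : Fin n} : j ∈ tailIdx n r ↔ r ≤ (j : ℕ) := by
  simp [tailIdx]

/-- The orthogonal projection onto the kernel of a matrix of full row rank. -/
noncomputable def kerProj [DecidableEq κ] [DecidableEq α] (Z : Matrix α κ ℂ) : Matrix κ κ ℂ :=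
  1 - Zᴴ * (Z * Zᴴ)⁻¹ * Z

section kerProj

variable [DecidableEq κ] [DecidableEq α] {Z : Matrix α κ ℂ}

theorem mul_kerProj (hZ : IsUnit (Z * Zᴴ).det) : Z * kerProj Z = 0 := by
  rw [kerProj, Matrix.mul_sub, Matrix.mul_one, ← Matrix.mul_assoc, ← Matrix.mul_assoc,
    Matrix.mul_nonsing_inv _ hZ, Matrix.one_mul, sub_self]

theorem kerProj_conjTranspose : (kerProj Z)ᴴ = kerProj Z := by
  have h : ((Z * Zᴴ)⁻¹)ᴴ = (Z * Zᴴ)⁻¹ := by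
    rw [Matrix.conjTranspose_nonsing_inv, Matrix.conjTranspose_mul,
      Matrix.conjTranspose_conjTranspose]
  rw [kerProj, Matrix.conjTranspose_sub, Matrix.conjTranspose_one, Matrix.conjTranspose_mul,
    Matrix.conjTranspose_mul, Matrix.conjTranspose_conjTranspose, h, Matrix.mul_assoc]

theorem kerProj_mul_self (hZ : IsUnit (Z * Zᴴ).det) : kerProj Z * kerProj Z = kerProj Z := by
  conv_lhs => enter [1]; rw [kerProj]
  rw [Matrix.sub_mul, Matrix.one_mul, Matrix.mul_assoc, mul_kerProj hZ, Matrix.mul_zero, sub_zero]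

theorem trace_kerProj (hZ : IsUnit (Z * Zᴴ).det) :
    (kerProj Z).trace = ((Fintype.card κ : ℝ) - Fintype.card α : ℝ) := by
  rw [kerProj, Matrix.trace_sub, Matrix.trace_one, Matrix.mul_assoc, Matrix.trace_mul_comm,
    Matrix.mul_assoc, Matrix.nonsing_inv_mul _ hZ, Matrix.trace_one]
  simp

/-- The Gram determinant of `Z` extended by one row `z` is the Gram determinant of `Z` times the
squared length of the projection of `z` onto the kernel of `Z`. -/
theorem gram_det_fromRows (hZ : IsUnit (Z * Zᴴ).det) (z : Matrix Unit κ ℂ) :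
    (z * kerProj Z * zᴴ) () ()
      = (Matrix.fromRows Z z * (Matrix.fromRows Z z)ᴴ).det / (Z * Zᴴ).det := by
  have : Invertible (Z * Zᴴ) := (Z * Zᴴ).invertibleOfIsUnitDet hZ
  rw [Matrix.conjTranspose_fromRows_eq_fromCols_conjTranspose, Matrix.fromRows_mul_fromCols,
    Matrix.det_fromBlocks₁₁, mul_div_cancel_left₀ _ hZ.ne_zero,
    Matrix.det_unique (z * zᴴ - z * Zᴴ * ⅟(Z * Zᴴ) * (Z * zᴴ)), Matrix.invOf_eq_nonsing_inv,
    kerProj, Matrix.mul_sub, Matrix.sub_mul, Matrix.mul_one]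
  simp only [Matrix.mul_assoc]

end kerProj

/-- The Gram determinant ratio of the projections of a sample to `v₀, …, v_{r-1}, v_j` and
to `v₀, …, v_{r-1}`. -/
noncomputable def gramRatio {n r : ℕ} [DecidableEq κ] (hr : r ≤ n)
    (V : Matrix (Fin n) (Fin n) ℂ) (j : Fin n) (X : κ → Fin n → ℝ) : ℝ :=
  let T : Matrix (Fin r ⊕ Unit) (Fin n) ℂ := Vᴴ.submatrix (Sum.elim (Fin.castLE hr) fun _ => j) id
  ((T * sampleMat X) * (T * sampleMat X)ᴴ).det.re /
    ((T.toRows₁ * sampleMat X) * (T.toRows₁ * sampleMat X)ᴴ).det.re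

theorem measurable_gramRatio {n r : ℕ} [DecidableEq κ] (hr : r ≤ n)
    (V : Matrix (Fin n) (Fin n) ℂ) (j : Fin n) :
    Measurable (gramRatio (κ := κ) hr V j) :=
  (Complex.continuous_re.comp (continuous_gram_det _)).measurable.div
    (Complex.continuous_re.comp (continuous_gram_det _)).measurable

theorem gramRatio_nonneg {n r : ℕ} [DecidableEq κ] (hr : r ≤ n)
    (V : Matrix (Fin n) (Fin n) ℂ) (j : Fin n) (X : κ → Fin n → ℝ) : 0 ≤ gramRatio hr V j X :=
  div_nonneg (gram_det_nonneg _) (gram_det_nonneg _)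

theorem lintegral_gramRatio_le {n r : ℕ} [DecidableEq κ] (hr : r ≤ n)
    {V : Matrix (Fin n) (Fin n) ℂ} (hV : Vᴴ * V = 1) (hcard : r < Fintype.card κ) {j : Fin n}
    (hj : r ≤ j) : ∫⁻ X, ENNReal.ofReal (gramRatio hr V j X) ∂gaussMat κ (Fin n)
      ≤ ENNReal.ofReal ((Fintype.card κ : ℝ) - r) := by
  have hinj : Function.Injective (Sum.elim (Fin.castLE hr) fun _ : Unit => j) := by
    rintro (a | a) (b | b) h
    · simpa using h
    · have := congrArg Fin.val h
      simp at this
      omega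
    · have := congrArg Fin.val h
      simp at this
      omega
    · rfl
  have hT : (Vᴴ.submatrix (Sum.elim (Fin.castLE hr) fun _ : Unit => j) id) *
      (Vᴴ.submatrix (Sum.elim (Fin.castLE hr) fun _ : Unit => j) id)ᴴ = 1 := by
    rw [Matrix.conjTranspose_submatrix, Matrix.conjTranspose_conjTranspose,
      ← Matrix.submatrix_mul _ _ _ _ _ Function.bijective_id, hV, Matrix.submatrix_one _ hinj]
  have h := lintegral_gram_ratio_le (κ := κ) _ hT (by simpa using hcard)
  rw [Fintype.card_fin] at h
  exact h

/-- The leading `r` singular directions drop out of the trace, since their samples are the rows of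
`Z`. Each trailing direction `j` contributes the squared length of its sample projected onto the
kernel of `Z`, which is a ratio of Gram determinants. -/
theorem trace_kerProj_mul_gramShift {n r : ℕ} [DecidableEq κ] (hr : r ≤ n)
    {V : Matrix (Fin n) (Fin n) ℂ} {B : Matrix μ (Fin n) ℂ} {s : Fin n → ℝ}
    (hB : Bᴴ * B = V * Matrix.diagonal (fun j => ((s j ^ 2 : ℝ) : ℂ)) * Vᴴ) (ε : ℝ)
    (X : κ → Fin n → ℝ) {Z : Matrix (Fin r) κ ℂ} (hZX : Z = (leading hr V)ᴴ * sampleMat X)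
    (hZ : IsUnit (Z * Zᴴ).det) :
    (kerProj Z * gramShift B ε X).trace.re = ε * ((Fintype.card κ : ℝ) - r) +
      ∑ j ∈ tailIdx n r, s j ^ 2 * gramRatio hr V j X := by
  set Y := Vᴴ * sampleMat X with hY
  have h1 : (B * sampleMat X)ᴴ * (B * sampleMat X)
      = Yᴴ * (Matrix.diagonal (fun j => ((s j ^ 2 : ℝ) : ℂ)) * Y) := by
    rw [Matrix.conjTranspose_mul, Matrix.mul_assoc, ← Matrix.mul_assoc Bᴴ, hB, hY,
      Matrix.conjTranspose_mul, Matrix.conjTranspose_conjTranspose]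
    simp only [Matrix.mul_assoc]
  have h2 : (kerProj Z * gramShift B ε X).trace
      = ∑ j, ((s j ^ 2 : ℝ) : ℂ) * (Y * kerProj Z * Yᴴ) j j
        + ((ε * ((Fintype.card κ : ℝ) - r) : ℝ) : ℂ) := by
    rw [gramShift, Matrix.mul_add, Matrix.trace_add, Matrix.mul_smul, Matrix.trace_smul,
      Matrix.mul_one, trace_kerProj hZ, h1, ← Matrix.mul_assoc, Matrix.trace_mul_comm,
      Matrix.mul_assoc, Matrix.trace]
    congr 1
    · refine Finset.sum_congr rfl fun j _ => ?_
      rw [Matrix.diag_apply, Matrix.diagonal_mul, Matrix.mul_assoc Y]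
    · simp
  rw [h2, Complex.add_re, Complex.ofReal_re, Complex.re_sum, add_comm]
  congr 1
  rw [tailIdx, Finset.sum_filter]
  refine Finset.sum_congr rfl fun j _ => ?_
  rw [Complex.re_ofReal_mul]
  split_ifs with hj
  · congr 1
    set T : Matrix (Fin r ⊕ Unit) (Fin n) ℂ :=
      Vᴴ.submatrix (Sum.elim (Fin.castLE hr) fun _ => j) id with hT
    set z : Matrix Unit κ ℂ := T.toRows₂ * sampleMat X with hz
    have hrows : T * sampleMat X = Matrix.fromRows Z z := by
      rw [hZX, hz]
      ext (a | a) k <;> rfl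
    have hTZ : T.toRows₁ * sampleMat X = Z := by
      rw [hZX]
      rfl
    have h3 : (Y * kerProj Z * Yᴴ) j j = (z * kerProj Z * zᴴ) () () := rfl
    have hreal : ((Z * Zᴴ).det.re : ℂ) = (Z * Zᴴ).det := by
      have := (Complex.le_def.1 (Matrix.posSemidef_self_mul_conjTranspose Z).det_nonneg).2
      exact Complex.ext (by simp) (by simpa using this)
    rw [h3, gram_det_fromRows hZ z, gramRatio, ← hT, hTZ, hrows, ← hreal, Complex.div_ofReal_re]
    rfl
  · have h4 : ∀ k, (Y * kerProj Z) j k = 0 := by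
      intro k
      have h5 := congrFun (congrFun (mul_kerProj hZ) ⟨j, by omega⟩) k
      rw [Matrix.zero_apply] at h5
      rw [← h5]
      subst hZX
      rfl
    rw [Matrix.mul_apply]
    simp [h4]

theorem rank_leading_conjTranspose {n r : ℕ} (hr : r ≤ n) {V : Matrix (Fin n) (Fin n) ℂ}
    (hV : Vᴴ * V = 1) : ((leading hr V)ᴴ).rank = r := by
  have h1 : (leading hr V)ᴴ * leading hr V = 1 := by
    have h2 := congrArg (fun N => N.submatrix (Fin.castLE hr) (Fin.castLE hr)) hV
    rw [Matrix.submatrix_mul _ _ _ id _ Function.bijective_id,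
      Matrix.submatrix_one _ (Fin.castLE_injective hr)] at h2
    exact h2
  refine le_antisymm ((Matrix.rank_le_card_height _).trans (by simp)) ?_
  have h2 := (Matrix.rank_mul_le (leading hr V)ᴴ (leading hr V)).trans (min_le_left _ _)
  rwa [h1, Matrix.rank_one, Fintype.card_fin] at h2

theorem ae_rank_leading_mul_sampleMat {n r D : ℕ} (hr : r ≤ n) {V : Matrix (Fin n) (Fin n) ℂ}
    (hV : Vᴴ * V = 1) (hD : r ≤ D) : ∀ᵐ X ∂gaussMat (Fin D) (Fin n),
      ((leading hr V)ᴴ * sampleMat X).rank = r := by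
  filter_upwards [ae_linearIndependent_mulVec_comp (leading hr V)ᴴ
    (rank_leading_conjTranspose hr hV).ge (Fin.castLE_injective hD)] with X hX
  exact rank_mul_sampleMat_of_linearIndependent hX

/-- The Frobenius norm is computed with one more Gaussian vector, which becomes row `0` of a sample
with `d + 1` rows. -/
theorem lintegral_residual_le_inv_realQuad {n d : ℕ} [DecidableEq μ] (B : Matrix μ (Fin n) ℂ)
    (P : (Fin d → Fin n → ℝ) → Matrix μ μ ℂ)
    (hP : ∀ᵐ X ∂gaussMat (Fin d) (Fin n), (P X)ᴴ = P X ∧ P X * P X = P X ∧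
      P X * (B * sampleMat X) = B * sampleMat X) {ε : ℝ} (hε : 0 < ε) :
    ∫⁻ X, ENNReal.ofReal (‖(1 - P X) * B‖ ^ 2) ∂gaussMat (Fin d) (Fin n)
      ≤ ∫⁻ X : Fin (d + 1) → Fin n → ℝ,
        ENNReal.ofReal (1 / realQuad (gramShift B ε X)⁻¹ (Pi.single 0 1))
          ∂gaussMat (Fin (d + 1)) (Fin n) := by
  have hmp := (measurePreserving_piFinSuccAbove
    (fun _ : Fin (d + 1) => gaussVec (Fin n)) 0).symm
  have hF1 : Measurable fun X : Fin (d + 1) → Fin n → ℝ =>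
      ENNReal.ofReal (1 / realQuad (gramShift B ε X)⁻¹ (Pi.single 0 1)) :=
    (((measurable_realQuad_gramShift_inv B ε).comp
      (by fun_prop : Measurable fun X : Fin (d + 1) → Fin n → ℝ =>
        (X, (Pi.single 0 1 : Fin (d + 1) → ℝ)))).const_div 1).ennreal_ofReal
  have hcons : ∀ z : (Fin n → ℝ) × (Fin d → Fin n → ℝ), (MeasurableEquiv.piFinSuccAbove
      (fun _ : Fin (d + 1) => Fin n → ℝ) 0).symm z = Fin.cons z.1 z.2 := by
    intro z
    ext l a
    refine Fin.cases ?_ (fun l => ?_) l <;>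
      simp [MeasurableEquiv.piFinSuccAbove, Fin.insertNthEquiv]
  unfold gaussMat at hP ⊢
  have hprod := lintegral_prod_symm' (μ := gaussVec (Fin n))
    (ν := Measure.pi fun _ : Fin d => gaussVec (Fin n)) _ (hF1.comp hmp.measurable)
  simp only [Function.comp_def, hcons] at hprod
  rw [← hmp.map_eq, lintegral_map hF1 hmp.measurable]
  simp only [hcons]
  rw [hprod]
  refine lintegral_mono_ae ?_
  filter_upwards [hP] with X hX
  rw [← lintegral_sum_norm_sq_mulVec]
  refine lintegral_mono fun x => ENNReal.ofReal_le_ofReal ?_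
  exact sum_norm_sq_residual_le B hε hX.1 hX.2.1 X hX.2.2 x

/-- The integrated form of the trace bound, with `q = D - r` and every Gram determinant ratio
replaced by its mean bound `q`. -/
theorem lintegral_trace_bound_le {n r D : ℕ} (hr : r ≤ n) (hD : r + 2 < D)
    {V : Matrix (Fin n) (Fin n) ℂ} (hV : Vᴴ * V = 1) (s : Fin n → ℝ) {ε : ℝ} (hε : 0 ≤ ε) :
    ∫⁻ X, ENNReal.ofReal ((ε * ((D : ℝ) - r) +
          ∑ j ∈ tailIdx n r, s j ^ 2 * gramRatio hr V j X) /
          (((D : ℝ) - r) * ((D : ℝ) - r - 2))) ∂gaussMat (Fin D) (Fin n)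
      ≤ ENNReal.ofReal ((ε + ∑ j ∈ tailIdx n r, s j ^ 2) / ((D : ℝ) - r - 2)) := by
  set S := ∑ j ∈ tailIdx n r, s j ^ 2 with hS
  have hS0 : 0 ≤ S := Finset.sum_nonneg fun j _ => sq_nonneg _
  have hD' : (r : ℝ) + 2 < D := by exact_mod_cast hD
  obtain ⟨q, hqdef⟩ : ∃ q : ℝ, q = (D : ℝ) - r := ⟨_, rfl⟩
  simp only [← hqdef]
  have hq : 2 < q := by linarith
  have hq0 : 0 < q * (q - 2) := by nlinarith
  have hεq : 0 ≤ ε * q := mul_nonneg hε (by linarith)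
  have hsplit : ∀ X : Fin D → Fin n → ℝ, ENNReal.ofReal ((ε * q +
        ∑ j ∈ tailIdx n r, s j ^ 2 * gramRatio hr V j X) / (q * (q - 2)))
      = (ENNReal.ofReal (ε * q) + ∑ j ∈ tailIdx n r, ENNReal.ofReal (s j ^ 2) *
        ENNReal.ofReal (gramRatio hr V j X)) * ENNReal.ofReal (1 / (q * (q - 2))) := by
    intro X
    have hnn : ∀ j ∈ tailIdx n r,
        0 ≤ s j ^ 2 * gramRatio hr V j X := fun j _ =>
      mul_nonneg (sq_nonneg _) (gramRatio_nonneg hr V j X)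
    rw [div_eq_mul_one_div, ENNReal.ofReal_mul (add_nonneg hεq (Finset.sum_nonneg hnn)),
      ENNReal.ofReal_add hεq (Finset.sum_nonneg hnn), ENNReal.ofReal_sum_of_nonneg hnn]
    simp_rw [ENNReal.ofReal_mul (sq_nonneg _)]
  have hmr : ∀ j : Fin n, Measurable fun X : Fin D → Fin n → ℝ =>
      ENNReal.ofReal (gramRatio hr V j X) := fun j => (measurable_gramRatio hr V j).ennreal_ofReal
  simp_rw [hsplit]
  rw [lintegral_mul_const _ (by fun_prop), lintegral_add_left measurable_const,
    lintegral_finsetSum _ (fun j _ => (hmr j).const_mul _)]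
  simp_rw [lintegral_const_mul _ (hmr _)]
  calc _ ≤ (ENNReal.ofReal (ε * q) + ∑ j ∈ tailIdx n r, ENNReal.ofReal (s j ^ 2) *
        ENNReal.ofReal q) * ENNReal.ofReal (1 / (q * (q - 2))) := by
        gcongr with j hj
        · simp
        · have h := lintegral_gramRatio_le (κ := Fin D) hr hV (by simp; omega)
            (mem_tailIdx.1 hj)
          rwa [Fintype.card_fin, ← hqdef] at h
    _ = ENNReal.ofReal ((ε * q + S * q) * (1 / (q * (q - 2)))) := by
        rw [← Finset.sum_mul, ← ENNReal.ofReal_sum_of_nonneg (fun j _ => sq_nonneg _),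
          ← ENNReal.ofReal_mul hS0, ← ENNReal.ofReal_add hεq (by nlinarith),
          ← ENNReal.ofReal_mul (by nlinarith)]
    _ = _ := by
        congr 1
        have h1 : q ≠ 0 := by linarith
        have h3 : q - 2 ≠ 0 := by linarith
        field_simp

/-- The mean of the reciprocal of a diagonal entry of the inverse Gram matrix. -/
theorem lintegral_inv_realQuad_gramShift_le {n r D : ℕ} (hr : r ≤ n) (hD : r + 2 < D)
    {V : Matrix (Fin n) (Fin n) ℂ} (hV : Vᴴ * V = 1) {B : Matrix μ (Fin n) ℂ} {s : Fin n → ℝ}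
    (hB : Bᴴ * B = V * Matrix.diagonal (fun j => ((s j ^ 2 : ℝ) : ℂ)) * Vᴴ) {ε : ℝ} (hε : 0 < ε)
    (k : Fin D) :
    ∫⁻ X : Fin D → Fin n → ℝ, ENNReal.ofReal (1 / realQuad (gramShift B ε X)⁻¹ (Pi.single k 1))
        ∂gaussMat (Fin D) (Fin n)
      ≤ ENNReal.ofReal (((D : ℝ) - 2) / ((D : ℝ) - r - 2) *
        (ε + ∑ j ∈ tailIdx n r, s j ^ 2)) := by
  have : Nonempty (Fin D) := ⟨k⟩
  have hD' : (r : ℝ) + 2 < D := by exact_mod_cast hD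
  have hF : Measurable fun p : (Fin D → Fin n → ℝ) × (Fin D → ℝ) =>
      ENNReal.ofReal (1 / realQuad (gramShift B ε p.1)⁻¹ p.2) :=
    ((measurable_realQuad_gramShift_inv B ε).const_div 1).ennreal_ofReal
  set Φ := ∫⁻ X : Fin D → Fin n → ℝ,
    ENNReal.ofReal (1 / realQuad (gramShift B ε X)⁻¹ (Pi.single k 1)) ∂gaussMat (Fin D) (Fin n)
    with hΦ
  -- averaging over a Gaussian vector in place of the coordinate vector
  have hM2 : ENNReal.ofReal (1 / ((D : ℝ) - 2)) * Φ
      = ∫⁻ X : Fin D → Fin n → ℝ, ∫⁻ u, ENNReal.ofReal (1 / realQuad (gramShift B ε X)⁻¹ u)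
        ∂gaussVec (Fin D) ∂gaussMat (Fin D) (Fin n) := by
    rw [lintegral_lintegral_swap hF.aemeasurable]
    have h1 : ∀ u : Fin D → ℝ, ∫⁻ X : Fin D → Fin n → ℝ, ENNReal.ofReal
        (1 / realQuad (gramShift B ε X)⁻¹ u) ∂gaussMat (Fin D) (Fin n)
        = ENNReal.ofReal (1 / (u ⬝ᵥ u)) * Φ := fun u => lintegral_inv_realQuad_gramShift B ε u k
    simp_rw [h1]
    rw [lintegral_mul_const _ (by unfold dotProduct; fun_prop),
      lintegral_gaussVec_inv_norm_sq (by simp; omega), Fintype.card_fin]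
  have hM3 : ∫⁻ X : Fin D → Fin n → ℝ, ∫⁻ u, ENNReal.ofReal (1 / realQuad (gramShift B ε X)⁻¹ u)
        ∂gaussVec (Fin D) ∂gaussMat (Fin D) (Fin n)
      ≤ ∫⁻ X, ENNReal.ofReal ((ε * ((D : ℝ) - r) +
          ∑ j ∈ tailIdx n r, s j ^ 2 * gramRatio hr V j X) /
          (((D : ℝ) - r) * ((D : ℝ) - r - 2))) ∂gaussMat (Fin D) (Fin n) := by
    refine lintegral_mono_ae ?_
    filter_upwards [ae_rank_leading_mul_sampleMat hr hV (by omega : r ≤ D)] with X hX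
    have hu := isUnit_gram_det_of_rank hX
    have h1 := lintegral_gaussVec_inv_realQuad_le (gramShift_posDef B hε X)
      (kerProj_conjTranspose (Z := (leading hr V)ᴴ * sampleMat X)) (kerProj_mul_self hu)
      (q := (D : ℝ) - r) (by linarith)
      (by rw [trace_kerProj hu, Fintype.card_fin, Fintype.card_fin])
    rw [trace_kerProj_mul_gramShift hr hB ε X rfl hu, Fintype.card_fin] at h1
    exact h1
  have hfin := hM2.trans_le (hM3.trans (lintegral_trace_bound_le hr hD hV s hε.le))
  have hd1 : (0 : ℝ) < (D : ℝ) - 2 := by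
    have : (0 : ℝ) ≤ r := r.cast_nonneg
    linarith
  calc Φ = ENNReal.ofReal ((D : ℝ) - 2) * (ENNReal.ofReal (1 / ((D : ℝ) - 2)) * Φ) := by
        rw [← mul_assoc, ← ENNReal.ofReal_mul hd1.le, mul_one_div_cancel hd1.ne', ENNReal.ofReal_one,
          one_mul]
    _ ≤ ENNReal.ofReal ((D : ℝ) - 2) * ENNReal.ofReal
        ((ε + ∑ j ∈ tailIdx n r, s j ^ 2) / ((D : ℝ) - r - 2)) := by gcongr
    _ = _ := by
        rw [← ENNReal.ofReal_mul hd1.le]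
        congr 1
        ring

/-- The mean squared residual of a Gaussian range finder: `B = U diag(s) Vᴴ` with a *complex*
unitary `V` is sampled by `d` *real* Gaussian vectors. -/
theorem lintegral_residual_le {n d r : ℕ} [DecidableEq μ] (hr : r ≤ n) (hd : r + 2 ≤ d)
    {V : Matrix (Fin n) (Fin n) ℂ} (hV : Vᴴ * V = 1) {B : Matrix μ (Fin n) ℂ} {s : Fin n → ℝ}
    (hB : Bᴴ * B = V * Matrix.diagonal (fun j => ((s j ^ 2 : ℝ) : ℂ)) * Vᴴ)
    (P : (Fin d → Fin n → ℝ) → Matrix μ μ ℂ)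
    (hP : ∀ᵐ X ∂gaussMat (Fin d) (Fin n), (P X)ᴴ = P X ∧ P X * P X = P X ∧
      P X * (B * sampleMat X) = B * sampleMat X) :
    ∫⁻ X, ENNReal.ofReal (‖(1 - P X) * B‖ ^ 2) ∂gaussMat (Fin d) (Fin n)
      ≤ ENNReal.ofReal (((d : ℝ) - 1) / ((d : ℝ) - r - 1) * ∑ j ∈ tailIdx n r, s j ^ 2) := by
  set S := ∑ j ∈ tailIdx n r, s j ^ 2 with hS
  -- it suffices to bound the regularized version for every `ε > 0`
  suffices h : ∀ ε : ℝ, 0 < ε → ∫⁻ X, ENNReal.ofReal (‖(1 - P X) * B‖ ^ 2)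
      ∂gaussMat (Fin d) (Fin n)
      ≤ ENNReal.ofReal (((d : ℝ) - 1) / ((d : ℝ) - r - 1) * (ε + S)) by
    have ht : Filter.Tendsto (fun ε : ℝ => ENNReal.ofReal (((d : ℝ) - 1) / ((d : ℝ) - r - 1) *
        (ε + S))) (nhdsWithin 0 (Set.Ioi 0))
        (nhds (ENNReal.ofReal (((d : ℝ) - 1) / ((d : ℝ) - r - 1) * S))) := by
      refine (ENNReal.tendsto_ofReal ?_).mono_left nhdsWithin_le_nhds
      have hc : Continuous fun ε : ℝ => ((d : ℝ) - 1) / ((d : ℝ) - r - 1) * (ε + S) := by fun_prop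
      simpa using hc.tendsto 0
    exact ge_of_tendsto ht (Filter.eventually_of_mem self_mem_nhdsWithin h)
  intro ε hε
  refine (lintegral_residual_le_inv_realQuad B P hP hε).trans ?_
  refine (lintegral_inv_realQuad_gramShift_le hr (by omega) hV hB hε 0).trans_eq ?_
  push_cast
  congr 2
  ring

end

/-! ### Algebra of the basis extraction -/

section

variable {m n d k s : ℕ} {A : Matrix (Fin m) (Fin n) ℂ} {hd : d = s * k}
  {W : Matrix (Fin n) (Fin d) ℝ} {ε : ℝ}

theorem colIdx_lt_iff (hd : d = s * k) (x y : Fin s × Fin k) :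
    colIdx hd x < colIdx hd y ↔ x.1 < y.1 ∨ (x.1 = y.1 ∧ x.2 < y.2) := by
  rw [Fin.lt_def, colIdx_val, colIdx_val, Fin.lt_def, Fin.lt_def, Fin.ext_iff]
  have h1 := x.2.2
  have h2 := y.2.2
  constructor
  · intro h
    rcases lt_trichotomy (x.1 : ℕ) y.1 with h3 | h3 | h3
    · exact .inl h3
    · exact .inr ⟨h3, by rw [h3] at h; omega⟩
    · have := Nat.mul_le_mul_right k (Nat.succ_le_of_lt h3)
      rw [Nat.succ_mul] at this
      omega
  · rintro (h | ⟨h, h'⟩)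
    · have := Nat.mul_le_mul_right k (Nat.succ_le_of_lt h)
      rw [Nat.succ_mul] at this
      omega
    · rw [h]
      omega

namespace BasisExt

variable (b : BasisExt A hd W ε)

/-- The column of index `x` of `[Q_0, Q_1, …]`. -/
def col (x : Fin s × Fin k) : Fin m → ℂ := fun i => b.Q x.1 i x.2

/-- The column of index `x` of `A W`. -/
noncomputable def target (_b : BasisExt A hd W ε) (x : Fin s × Fin k) : Fin m → ℂ :=
  fun i => (A * toC W) i (colIdx hd x)

/-- Column `x` of `A W`: its projection onto the earlier blocks plus the QR decomposition of the
rest. -/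
theorem target_eq (x : Fin s × Fin k) (hx : (x.1 : ℕ) * k ≤ b.size) :
    b.target x = (∑ i ∈ Finset.univ.filter (fun i => i < x.1), ∑ l,
      (star (b.col (i, l)) ⬝ᵥ b.target x) • b.col (i, l))
      + ∑ l, b.R x.1 l x.2 • b.col (x.1, l) := by
  have h := (b.qr x.1 hx).eq
  ext i
  have h1 := congrFun (congrFun h i) x.2
  have h2 : A * toC (colBlock hd W x.1) = (A * toC W).submatrix id (fun l => colIdx hd (x.1, l)) :=
    rfl
  rw [Matrix.mul_assoc, Matrix.sub_mul, Matrix.one_mul, Matrix.sub_apply, sub_eq_iff_eq_add', h2,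
    Matrix.sum_mul, Matrix.sum_apply] at h1
  have h3 : b.target x i = (A * toC W).submatrix id (fun l => colIdx hd (x.1, l)) i x.2 := rfl
  rw [h3, h1]
  simp only [Pi.add_apply, Finset.sum_apply, Pi.smul_apply, smul_eq_mul]
  congr 1
  · refine Finset.sum_congr rfl fun j _ => ?_
    rw [Matrix.mul_assoc, Matrix.mul_apply]
    refine Finset.sum_congr rfl fun l _ => ?_
    rw [mul_comm]
    rfl
  · rw [Matrix.mul_apply]
    exact Finset.sum_congr rfl fun l _ => mul_comm _ _

theorem col_inner_same (j : Fin s) (hj : (j : ℕ) * k ≤ b.size) (l l' : Fin k) :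
    star (b.col (j, l)) ⬝ᵥ b.col (j, l') = if l = l' then 1 else 0 := by
  have h := congrFun (congrFun (b.qr j hj).orthonormal l) l'
  rw [Matrix.one_apply] at h
  exact h

theorem block_le_of_lt {x : Fin s × Fin k} {N : ℕ} (hx : (colIdx hd x : ℕ) ≤ N) :
    (x.1 : ℕ) * k ≤ N := by
  rw [colIdx_val] at hx
  omega

/-- Column `x` of `A W` without its diagonal contribution `R(x) Q(x)` is a combination of the
columns of `[Q_0, Q_1, …]` before `x`. -/
theorem target_sub_diag (x : Fin s × Fin k) (hx : (x.1 : ℕ) * k ≤ b.size) :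
    b.target x - b.R x.1 x.2 x.2 • b.col x
      = (∑ i ∈ Finset.univ.filter (fun i => i < x.1), ∑ l,
      (star (b.col (i, l)) ⬝ᵥ b.target x) • b.col (i, l))
      + ∑ l ∈ Finset.univ.filter (fun l => l < x.2), b.R x.1 l x.2 • b.col (x.1, l) := by
  rw [sub_eq_iff_eq_add]
  conv_lhs => rw [b.target_eq x hx]
  rw [add_assoc]
  congr 1
  rw [← Finset.sum_filter_add_sum_filter_not Finset.univ (fun l => l < x.2)]
  congr 1
  rw [Finset.sum_eq_single_of_mem x.2 (by simp)]
  intro l hl hne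
  have hl' : x.2 < l := by
    rw [Finset.mem_filter, not_lt] at hl
    exact lt_of_le_of_ne hl.2 (Ne.symm hne)
  have h0 : b.R x.1 l x.2 = 0 := (b.qr x.1 hx).upper hl'
  rw [h0, zero_smul]

theorem diag_ne_zero (hε : 0 < ε) {x : Fin s × Fin k} (hx : (colIdx hd x : ℕ) < b.size) :
    b.R x.1 x.2 x.2 ≠ 0 := by
  intro h
  have := b.keep x hx
  rw [h, norm_zero] at this
  linarith

/-- The invariants of the Gram–Schmidt process, by induction on the position of the column. Columns
of different blocks are orthogonal because the earlier blocks have been projected out, columns of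
the same block because of the QR decomposition. -/
theorem col_mem_span_and_orthogonal (hε : 0 < ε) (x : Fin s × Fin k)
    (hx : (colIdx hd x : ℕ) < b.size) :
    b.col x ∈ Submodule.span ℂ (b.target '' {y | colIdx hd y ≤ colIdx hd x}) ∧
      ∀ y, colIdx hd y < colIdx hd x → star (b.col y) ⬝ᵥ b.col x = 0 := by
  induction hN : (colIdx hd x : ℕ) using Nat.strong_induction_on generalizing x with
  | _ N ih =>
    have hxb : (x.1 : ℕ) * k ≤ b.size := block_le_of_lt (hd := hd) hx.le
    have ih' : ∀ y, colIdx hd y < colIdx hd x →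
        b.col y ∈ Submodule.span ℂ (b.target '' {z | colIdx hd z ≤ colIdx hd y}) ∧
        ∀ z, colIdx hd z < colIdx hd y → star (b.col z) ⬝ᵥ b.col y = 0 := fun y hy =>
      ih _ (hN ▸ hy) y (lt_trans (Fin.lt_def.1 hy) hx) rfl
    have hR := b.diag_ne_zero hε hx
    have hcol : b.col x = (b.R x.1 x.2 x.2)⁻¹ • (b.target x -
        ((∑ i ∈ Finset.univ.filter (fun i => i < x.1), ∑ l,
        (star (b.col (i, l)) ⬝ᵥ b.target x) • b.col (i, l))
        + ∑ l ∈ Finset.univ.filter (fun l => l < x.2), b.R x.1 l x.2 • b.col (x.1, l))) := by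
      rw [← b.target_sub_diag x hxb, sub_sub_cancel, smul_smul, inv_mul_cancel₀ hR, one_smul]
    have hlt1 : ∀ i l, i < x.1 → colIdx hd (i, l) < colIdx hd x := fun i l hi =>
      (colIdx_lt_iff hd _ _).2 (.inl hi)
    have hlt2 : ∀ l, l < x.2 → colIdx hd (x.1, l) < colIdx hd x := fun l hl =>
      (colIdx_lt_iff hd _ _).2 (.inr ⟨rfl, hl⟩)
    -- earlier columns are orthonormal
    have hon : ∀ y z, colIdx hd y < colIdx hd x → colIdx hd z < colIdx hd x →
        star (b.col y) ⬝ᵥ b.col z = if y = z then 1 else 0 := by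
      intro y z hy hz
      rcases lt_trichotomy (colIdx hd y) (colIdx hd z) with h | h | h
      · rw [(ih' z hz).2 y h, if_neg]
        rintro rfl
        exact lt_irrefl _ h
      · have hyz := (colIdx hd).injective h
        subst hyz
        rw [if_pos rfl]
        have := b.col_inner_same y.1 (block_le_of_lt (hd := hd)
          ((Fin.lt_def.1 hy).le.trans hx.le)) y.2 y.2
        rwa [if_pos rfl] at this
      · rw [if_neg (by
          rintro rfl
          exact lt_irrefl _ h)]
        have h1 := congrArg star ((ih' y hy).2 z h)
        rw [star_zero, Matrix.star_dotProduct, star_star, dotProduct_comm] at h1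
        rw [dotProduct_comm]
        exact h1
    constructor
    · rw [hcol]
      have hmono : ∀ y, colIdx hd y < colIdx hd x →
          b.col y ∈ Submodule.span ℂ (b.target '' {z | colIdx hd z ≤ colIdx hd x}) := fun y hy =>
        Submodule.span_mono (Set.image_mono fun z (hz : _ ≤ _) => hz.trans hy.le) (ih' y hy).1
      refine Submodule.smul_mem _ _ (Submodule.sub_mem _ ?_ (Submodule.add_mem _ ?_ ?_))
      · exact Submodule.subset_span ⟨x, show colIdx hd x ≤ colIdx hd x from le_rfl, rfl⟩
      · refine Submodule.sum_mem _ fun i hi => Submodule.sum_mem _ fun l _ => ?_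
        exact Submodule.smul_mem _ _ (hmono _ (hlt1 i l (Finset.mem_filter.1 hi).2))
      · refine Submodule.sum_mem _ fun l hl => ?_
        exact Submodule.smul_mem _ _ (hmono _ (hlt2 l (Finset.mem_filter.1 hl).2))
    · intro y hy
      rcases (colIdx_lt_iff hd y x).1 hy with h | ⟨h1, h2⟩
      · rw [hcol, dotProduct_smul, dotProduct_sub, dotProduct_add, dotProduct_sum, dotProduct_sum]
        have e1 : ∑ i ∈ Finset.univ.filter (fun i => i < x.1), star (b.col y) ⬝ᵥ ∑ l,
            (star (b.col (i, l)) ⬝ᵥ b.target x) • b.col (i, l) = star (b.col y) ⬝ᵥ b.target x := by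
          rw [Finset.sum_eq_single_of_mem y.1 (by simpa using h)]
          · rw [dotProduct_sum, Finset.sum_eq_single y.2]
            · rw [dotProduct_smul, hon _ _ hy (hlt1 _ _ h), if_pos rfl, smul_eq_mul, mul_one]
            · intro l _ hl
              rw [dotProduct_smul, hon _ _ hy (hlt1 _ _ h), if_neg, smul_zero]
              exact fun hyz => hl (congrArg Prod.snd hyz).symm
            · simp
          · intro i hi hne
            rw [dotProduct_sum]
            refine Finset.sum_eq_zero fun l _ => ?_
            rw [dotProduct_smul, hon _ _ hy (hlt1 _ _ (Finset.mem_filter.1 hi).2), if_neg, smul_zero]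
            exact fun hyz => hne (congrArg Prod.fst hyz).symm
        have e2 : ∑ l ∈ Finset.univ.filter (fun l => l < x.2),
            star (b.col y) ⬝ᵥ b.R x.1 l x.2 • b.col (x.1, l) = 0 := by
          refine Finset.sum_eq_zero fun l hl => ?_
          rw [dotProduct_smul, hon _ _ hy (hlt2 l (Finset.mem_filter.1 hl).2), if_neg, smul_zero]
          exact fun hyz => h.ne (congrArg Prod.fst hyz : y.1 = (x.1, l).1)
        rw [e1, e2, add_zero, sub_self, smul_zero]
      · have := b.col_inner_same x.1 hxb y.2 x.2
        rw [if_neg h2.ne, ← h1] at this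
        rw [← this]
        have : x = (y.1, x.2) := by rw [h1]
        rw [this]

theorem basis_apply (c : Fin b.size) :
    (fun i => b.basis i c) = b.col ((colIdx hd).symm (c.castLE b.size_le)) := rfl

theorem basis_orthonormal (hε : 0 < ε) : b.basisᴴ * b.basis = 1 := by
  have hlt : ∀ c : Fin b.size,
      (colIdx hd ((colIdx hd).symm (c.castLE b.size_le)) : ℕ) < b.size := by
    intro c
    simp
  have hne : ∀ c c' : Fin b.size, c < c' →
      star (fun i => b.basis i c) ⬝ᵥ (fun i => b.basis i c') = 0 := by
    intro c c' h
    rw [basis_apply, basis_apply]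
    refine (b.col_mem_span_and_orthogonal hε _ (hlt c')).2 _ ?_
    simpa using h
  ext c c'
  show star (fun i => b.basis i c) ⬝ᵥ (fun i => b.basis i c') = _
  rcases lt_trichotomy c c' with h | h | h
  · rw [hne c c' h, Matrix.one_apply_ne h.ne]
  · subst h
    rw [Matrix.one_apply_eq, basis_apply]
    have := b.col_inner_same _ (block_le_of_lt (hd := hd) (hlt c).le)
      ((colIdx hd).symm (c.castLE b.size_le)).2 ((colIdx hd).symm (c.castLE b.size_le)).2
    rwa [if_pos rfl] at this
  · rw [Matrix.one_apply_ne h.ne']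
    have h1 := congrArg star (hne c' c h)
    rwa [star_zero, ← Matrix.star_dotProduct_star, star_star] at h1

end BasisExt

/-- A matrix whose columns are in the column span of `D` factors through `D`. -/
theorem exists_eq_mul_of_col_mem {p q l : Type*} [Fintype q] (C : Matrix p l ℂ) (D : Matrix p q ℂ)
    (h : ∀ c, (fun i => C i c) ∈ LinearMap.range D.mulVecLin) : ∃ X : Matrix q l ℂ, C = D * X := by
  choose v hv using h
  refine ⟨fun j c => v c j, ?_⟩
  ext i c
  exact (congrFun (hv c) i).symm

namespace BasisExt

variable (b : BasisExt A hd W ε)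

theorem exists_basis_eq_mul (hε : 0 < ε) :
    ∃ X : Matrix (Fin d) (Fin b.size) ℂ, b.basis = A * toC W * X := by
  refine exists_eq_mul_of_col_mem _ _ fun c => ?_
  rw [basis_apply]
  refine Submodule.span_le.2 ?_ (b.col_mem_span_and_orthogonal hε _ (by simp)).1
  rintro _ ⟨y, -, rfl⟩
  refine ⟨Pi.single (colIdx hd y) 1, ?_⟩
  rw [Matrix.mulVecLin_apply, Matrix.mulVec_single_one]
  rfl

theorem size_le_rank (hε : 0 < ε) : b.size ≤ (A * toC W).rank := by
  obtain ⟨X, hX⟩ := b.exists_basis_eq_mul hε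
  have h1 := (Matrix.rank_mul_le b.basisᴴ b.basis).trans (min_le_right _ _)
  rw [b.basis_orthonormal hε, Matrix.rank_one, Fintype.card_fin] at h1
  have h2 := (Matrix.rank_mul_le (A * toC W) X).trans (min_le_left _ _)
  rw [← hX] at h2
  exact h1.trans h2

/-- If the number of extracted columns is the rank, they span the range of `A W`. -/
theorem basis_mul_basis_conjTranspose_mul (hε : 0 < ε) (hsize : b.size = (A * toC W).rank) :
    b.basis * b.basisᴴ * (A * toC W) = A * toC W := by
  obtain ⟨X, hX⟩ := b.exists_basis_eq_mul hε
  have h0 := b.basis_orthonormal hε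
  have hle : LinearMap.range b.basis.mulVecLin ≤ LinearMap.range (A * toC W).mulVecLin := by
    rintro _ ⟨v, rfl⟩
    refine ⟨X *ᵥ v, ?_⟩
    rw [Matrix.mulVecLin_apply, Matrix.mulVecLin_apply, Matrix.mulVec_mulVec, ← hX]
  have hrk : b.size ≤ b.basis.rank := by
    have h1 := (Matrix.rank_mul_le b.basisᴴ b.basis).trans (min_le_right _ _)
    rwa [h0, Matrix.rank_one, Fintype.card_fin] at h1
  have heq : LinearMap.range b.basis.mulVecLin = LinearMap.range (A * toC W).mulVecLin := by
    refine Submodule.eq_of_le_of_finrank_le hle ?_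
    exact hsize.symm.le.trans hrk
  obtain ⟨Y, hY⟩ := exists_eq_mul_of_col_mem (A * toC W) b.basis fun c => by
    rw [heq]
    refine ⟨Pi.single c 1, ?_⟩
    rw [Matrix.mulVecLin_apply, Matrix.mulVec_single_one]
    rfl
  conv_lhs => rw [hY]
  rw [Matrix.mul_assoc, ← Matrix.mul_assoc b.basisᴴ, h0, Matrix.one_mul, ← hY]

/-- In an exact run that stops early, the next column of `A W` depends on the previous ones. -/
theorem target_mem_span_of_exact (hε : 0 < ε) (hb : b.Exact) (x : Fin s × Fin k)
    (hx : (colIdx hd x : ℕ) = b.size) :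
    b.target x ∈ Submodule.span ℂ (b.target '' {y | colIdx hd y < colIdx hd x}) := by
  have h := b.target_sub_diag x (block_le_of_lt (hd := hd) hx.le)
  rw [hb x hx, zero_smul, sub_zero] at h
  rw [h]
  have hcol : ∀ y, colIdx hd y < colIdx hd x →
      b.col y ∈ Submodule.span ℂ (b.target '' {y | colIdx hd y < colIdx hd x}) := by
    intro y hy
    refine Submodule.span_mono (Set.image_mono ?_) (b.col_mem_span_and_orthogonal hε y
      (hx ▸ Fin.lt_def.1 hy)).1
    exact fun z (hz : _ ≤ _) => hz.trans_lt hy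
  refine Submodule.add_mem _ ?_ ?_
  · refine Submodule.sum_mem _ fun i hi => Submodule.sum_mem _ fun l _ => ?_
    exact Submodule.smul_mem _ _ (hcol _ ((colIdx_lt_iff hd _ _).2
      (.inl (Finset.mem_filter.1 hi).2)))
  · refine Submodule.sum_mem _ fun l hl => ?_
    exact Submodule.smul_mem _ _ (hcol _ ((colIdx_lt_iff hd _ _).2
      (.inr ⟨rfl, (Finset.mem_filter.1 hl).2⟩)))

/-- If the columns of `A W` are in general position, an exact run extracts `rank (A W)` columns. -/
theorem size_eq_rank_of_exact (hε : 0 < ε) (hb : b.Exact)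
    (hgen : ∀ (p : ℕ) (hp : p ≤ d), p ≤ A.rank →
      LinearIndependent ℂ (fun (l : Fin p) i => (A * toC W) i (l.castLE hp))) :
    b.size = (A * toC W).rank := by
  refine le_antisymm (b.size_le_rank hε) ?_
  rcases b.size_le.eq_or_lt with h | h
  · exact (Matrix.rank_le_card_width _).trans (by simp [h])
  · refine ((Matrix.rank_mul_le A (toC W)).trans (min_le_left _ _)).trans ?_
    -- Otherwise the first `size + 1 ≤ rank A` columns of `A W` would be independent, while
    -- exactness puts the last of them in the span of the others.
    by_contra hlt
    have hli := hgen (b.size + 1) h (by omega)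
    have hmem := b.target_mem_span_of_exact hε hb ((colIdx hd).symm ⟨b.size, h⟩) (by simp)
    refine (linearIndependent_iff_notMem_span.1 hli (Fin.last _)) ?_
    have e1 : b.target ((colIdx hd).symm ⟨b.size, h⟩)
        = fun i => (A * toC W) i ((Fin.last b.size).castLE h) := by
      funext i
      simp only [target, Equiv.apply_symm_apply]
      rfl
    rw [← e1]
    refine Submodule.span_mono ?_ hmem
    rintro _ ⟨y, hy, rfl⟩
    have hy' : (colIdx hd y : ℕ) < b.size := by
      have : colIdx hd y < colIdx hd ((colIdx hd).symm ⟨b.size, h⟩) := hy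
      rw [Equiv.apply_symm_apply] at this
      exact this
    refine ⟨⟨colIdx hd y, by omega⟩, ⟨Set.mem_univ _, ?_⟩, rfl⟩
    intro he
    have := congrArg Fin.val he
    simp at this
    omega

end BasisExt

end

/-! ### Algebra of the subspace iteration -/

section
open scoped ComplexOrder

variable {m n d k s τ : ℕ} {A : Matrix (Fin m) (Fin n) ℂ} {hd : d = s * k}
  {W : Matrix (Fin n) (Fin d) ℝ} {ε : ℝ}

theorem isUnit_of_mulVec_eq_zero {p : ℕ} {R : Matrix (Fin p) (Fin p) ℂ}
    (h : ∀ v, R *ᵥ v = 0 → v = 0) : IsUnit R := by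
  rw [← Matrix.mulVec_injective_iff_isUnit]
  intro v w hvw
  rw [← sub_eq_zero]
  refine h _ ?_
  rw [Matrix.mulVec_sub, sub_eq_zero]
  exact hvw

theorem eq_zero_of_conjTranspose_mulVec_mulVec {p q : ℕ} {C : Matrix (Fin p) (Fin q) ℂ}
    {v : Fin q → ℂ} (h : Cᴴ *ᵥ (C *ᵥ v) = 0) : C *ᵥ v = 0 := by
  rw [Matrix.mulVec_mulVec] at h
  exact Matrix.conjTranspose_mul_self_mulVec_eq_zero C v |>.1 h

theorem eq_zero_of_orthonormal_mulVec {p q : ℕ} {Q : Matrix (Fin p) (Fin q) ℂ} (hQ : Qᴴ * Q = 1)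
    {v : Fin q → ℂ} (h : Q *ᵥ v = 0) : v = 0 := by
  rw [← Matrix.one_mulVec v, ← hQ, ← Matrix.mulVec_mulVec, h, Matrix.mulVec_zero]

/-- One step of the subspace iteration maps an orthonormal basis of a subspace of the range of `A`
to an orthonormal basis of its image under `A Aᴴ`. -/
theorem subspace_iteration_step {p : ℕ} {Q₀ Q₁ : Matrix (Fin m) (Fin p) ℂ}
    {Q' : Matrix (Fin n) (Fin p) ℂ} {R' R'' : Matrix (Fin p) (Fin p) ℂ}
    (hQ : Q₀ᴴ * Q₀ = 1) {Z : Matrix (Fin n) (Fin p) ℂ} (hZ : Q₀ = A * Z)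
    (h1 : IsQR (Aᴴ * Q₀) Q' R') (h2 : IsQR (A * Q') Q₁ R'') :
    (∃ Z' : Matrix (Fin n) (Fin p) ℂ, Q₁ = A * Z') ∧
      ∃ T : Matrix (Fin p) (Fin p) ℂ, IsUnit T ∧ A * Aᴴ * Q₀ = Q₁ * T := by
  -- `Aᴴ` is injective on the range of `A`, so that both triangular factors are invertible.
  have hinj : ∀ v, (Aᴴ * Q₀) *ᵥ v = 0 → v = 0 := by
    intro v hv
    rw [hZ, ← Matrix.mulVec_mulVec, ← Matrix.mulVec_mulVec] at hv
    have := eq_zero_of_conjTranspose_mulVec_mulVec hv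
    rw [Matrix.mulVec_mulVec, ← hZ] at this
    exact eq_zero_of_orthonormal_mulVec hQ this
  have hR' : IsUnit R' := by
    refine isUnit_of_mulVec_eq_zero fun v hv => hinj v ?_
    rw [h1.eq, ← Matrix.mulVec_mulVec, hv, Matrix.mulVec_zero]
  obtain ⟨S', hS'⟩ : ∃ S' : Matrix (Fin p) (Fin p) ℂ, R' * S' = 1 := hR'.exists_right_inv
  have hQ' : Q' = Aᴴ * Q₀ * S' := by
    rw [h1.eq, Matrix.mul_assoc, hS', Matrix.mul_one]
  have hR'' : IsUnit R'' := by
    refine isUnit_of_mulVec_eq_zero fun v hv => ?_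
    have h3 : (A * Q') *ᵥ v = 0 := by
      rw [h2.eq, ← Matrix.mulVec_mulVec, hv, Matrix.mulVec_zero]
    rw [hQ', ← Matrix.mulVec_mulVec, ← Matrix.mulVec_mulVec, ← Matrix.mulVec_mulVec] at h3
    have h4 := eq_zero_of_conjTranspose_mulVec_mulVec (C := Aᴴ)
      (by rwa [Matrix.conjTranspose_conjTranspose])
    rw [Matrix.mulVec_mulVec] at h4
    have h5 := hinj _ h4
    rw [← Matrix.one_mulVec v, ← hS', ← Matrix.mulVec_mulVec, h5, Matrix.mulVec_zero]
  obtain ⟨S'', hS''⟩ : ∃ S'' : Matrix (Fin p) (Fin p) ℂ, R'' * S'' = 1 := hR''.exists_right_inv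
  refine ⟨⟨Q' * S'', ?_⟩, R'' * R', hR''.mul hR', ?_⟩
  · rw [← Matrix.mul_assoc, h2.eq, Matrix.mul_assoc, hS'', Matrix.mul_one]
  · rw [Matrix.mul_assoc, h1.eq, ← Matrix.mul_assoc, h2.eq, Matrix.mul_assoc]

/-- The matrix `(A Aᴴ)^τ A` whose range the algorithm samples. -/
noncomputable def powered (A : Matrix (Fin m) (Fin n) ℂ) (τ : ℕ) : Matrix (Fin m) (Fin n) ℂ :=
  (A * Aᴴ) ^ τ * A

namespace Run

variable (ρ : Run A hd W ε τ)

theorem approx_eq : ρ.approx = ρ.Qs τ * (ρ.Qs τ)ᴴ * A := by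
  have h1 := congrArg Matrix.conjTranspose ρ.qr.eq
  rw [Matrix.conjTranspose_conjTranspose, Matrix.conjTranspose_mul, ρ.qr_hat.eq] at h1
  rw [Matrix.mul_assoc (ρ.Qs τ), h1, approx]
  simp only [Matrix.mul_assoc]

theorem exists_iterate (hε : 0 < ε) : ∀ j ≤ τ, (ρ.Qs j)ᴴ * ρ.Qs j = 1 ∧
    (∃ Z : Matrix (Fin n) (Fin ρ.ext.size) ℂ, ρ.Qs j = A * Z) ∧
    ∃ T : Matrix (Fin ρ.ext.size) (Fin ρ.ext.size) ℂ, IsUnit T ∧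
      (A * Aᴴ) ^ j * ρ.ext.basis = ρ.Qs j * T := by
  intro j
  induction j with
  | zero =>
    intro _
    rw [ρ.Qs_zero]
    obtain ⟨X, hX⟩ := ρ.ext.exists_basis_eq_mul hε
    refine ⟨ρ.ext.basis_orthonormal hε, ⟨toC W * X, ?_⟩, 1, isUnit_one, ?_⟩
    · rw [hX, Matrix.mul_assoc]
    · rw [pow_zero, Matrix.one_mul, Matrix.mul_one]
  | succ j ih =>
    intro hj
    obtain ⟨hQ, ⟨Z, hZ⟩, T, hT, hTe⟩ := ih (by omega)
    obtain ⟨Q', R', R'', h1, h2⟩ := ρ.Qs_succ j (by omega)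
    obtain ⟨hZ', T', hT', hTe'⟩ := subspace_iteration_step hQ hZ h1 h2
    refine ⟨h2.orthonormal, hZ', T' * T, hT'.mul hT, ?_⟩
    rw [pow_succ', Matrix.mul_assoc (A * Aᴴ), hTe, ← Matrix.mul_assoc, hTe', Matrix.mul_assoc]

/-- The output of a run that extracts `rank (A W)` columns is `P A`, where `P` is the orthogonal
projection onto the range of `(A Aᴴ)^τ A W`. -/
theorem exists_projection (hε : 0 < ε) (hsize : ρ.ext.size = (A * toC W).rank) :
    ∃ P : Matrix (Fin m) (Fin m) ℂ, Pᴴ = P ∧ P * P = P ∧ A - ρ.approx = (1 - P) * A ∧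
      P * (powered A τ * toC W) = powered A τ * toC W ∧
      ∃ X : Matrix (Fin d) (Fin m) ℂ, P = powered A τ * toC W * X := by
  obtain ⟨hQ, -, T, hT, hTe⟩ := ρ.exists_iterate hε τ le_rfl
  obtain ⟨S, hS⟩ : ∃ S : Matrix (Fin ρ.ext.size) (Fin ρ.ext.size) ℂ, T * S = 1 := hT.exists_right_inv
  obtain ⟨X, hX⟩ := ρ.ext.exists_basis_eq_mul hε
  have hgood := ρ.ext.basis_mul_basis_conjTranspose_mul hε hsize
  have hY : powered A τ * toC W = ρ.Qs τ * (T * ρ.ext.basisᴴ * (A * toC W)) := by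
    calc powered A τ * toC W = (A * Aᴴ) ^ τ * (ρ.ext.basis * ρ.ext.basisᴴ * (A * toC W)) := by
          rw [hgood, powered, Matrix.mul_assoc]
      _ = (A * Aᴴ) ^ τ * ρ.ext.basis * (ρ.ext.basisᴴ * (A * toC W)) := by
          simp only [Matrix.mul_assoc]
      _ = _ := by
          rw [hTe]
          simp only [Matrix.mul_assoc]
  have hQX : ρ.Qs τ = powered A τ * toC W * (X * S) := by
    calc ρ.Qs τ = ρ.Qs τ * T * S := by rw [Matrix.mul_assoc, hS, Matrix.mul_one]
      _ = _ := by
        rw [← hTe, hX, powered]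
        simp only [Matrix.mul_assoc]
  refine ⟨ρ.Qs τ * (ρ.Qs τ)ᴴ, ?_, ?_, ?_, ?_, X * S * (ρ.Qs τ)ᴴ, ?_⟩
  · rw [Matrix.conjTranspose_mul, Matrix.conjTranspose_conjTranspose]
  · rw [Matrix.mul_assoc, ← Matrix.mul_assoc _ (ρ.Qs τ), hQ, Matrix.one_mul]
  · rw [Matrix.sub_mul, Matrix.one_mul, ρ.approx_eq]
  · rw [hY, Matrix.mul_assoc, ← Matrix.mul_assoc _ (ρ.Qs τ), hQ, Matrix.one_mul]
  · rw [← Matrix.mul_assoc, ← hQX]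

end Run

/-! ### The structural bound -/

theorem trace_conjTranspose_mul_self {p q : ℕ} (C : Matrix (Fin p) (Fin q) ℂ) :
    (Cᴴ * C).trace = ((‖C‖ ^ 2 : ℝ) : ℂ) := by
  rw [frobenius_norm_sq, Matrix.trace, Finset.sum_comm]
  push_cast
  refine Finset.sum_congr rfl fun j _ => ?_
  rw [Matrix.diag_apply, Matrix.mul_apply]
  exact Finset.sum_congr rfl fun i _ => Complex.conj_mul' _

theorem norm_sq_eq_re_trace {p q : ℕ} (C : Matrix (Fin p) (Fin q) ℂ) :
    ‖C‖ ^ 2 = (Cᴴ * C).trace.re := by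
  rw [trace_conjTranspose_mul_self, Complex.ofReal_re]

theorem norm_sq_isometry_mul {p q l : ℕ} {U : Matrix (Fin p) (Fin q) ℂ} (hU : Uᴴ * U = 1)
    (C : Matrix (Fin q) (Fin l) ℂ) : ‖U * C‖ ^ 2 = ‖C‖ ^ 2 := by
  rw [norm_sq_eq_re_trace, norm_sq_eq_re_trace, Matrix.conjTranspose_mul, Matrix.mul_assoc,
    ← Matrix.mul_assoc Uᴴ, hU, Matrix.one_mul]

theorem norm_sq_mul_isometry {p q l : ℕ} {V : Matrix (Fin p) (Fin q) ℂ} (hV : Vᴴ * V = 1)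
    (C : Matrix (Fin l) (Fin q) ℂ) : ‖C * Vᴴ‖ ^ 2 = ‖C‖ ^ 2 := by
  rw [norm_sq_eq_re_trace, norm_sq_eq_re_trace, Matrix.conjTranspose_mul, Matrix.mul_assoc,
    Matrix.trace_mul_comm, Matrix.conjTranspose_conjTranspose, Matrix.mul_assoc, Matrix.mul_assoc,
    hV, Matrix.mul_one]

theorem norm_sq_projection_mul_le {p q : ℕ} {P : Matrix (Fin p) (Fin p) ℂ} (hP : Pᴴ = P)
    (hPP : P * P = P) (C : Matrix (Fin p) (Fin q) ℂ) : ‖(1 - P) * C‖ ^ 2 ≤ ‖C‖ ^ 2 := by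
  rw [frobenius_norm_sq, frobenius_norm_sq, Finset.sum_comm]
  conv_rhs => rw [Finset.sum_comm]
  refine Finset.sum_le_sum fun j _ => ?_
  exact sum_norm_sq_projection_le hP hPP fun i => C i j

/-- The projection onto a subspace that contains the range of `Y` is at least as good as any
approximation `Y X`. -/
theorem norm_sq_residual_le {p q l : ℕ} {P : Matrix (Fin p) (Fin p) ℂ} (hP : Pᴴ = P)
    (hPP : P * P = P) {Y : Matrix (Fin p) (Fin l) ℂ} (hY : P * Y = Y) (A : Matrix (Fin p) (Fin q) ℂ)
    (X : Matrix (Fin l) (Fin q) ℂ) : ‖(1 - P) * A‖ ^ 2 ≤ ‖A - Y * X‖ ^ 2 := by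
  have h : (1 - P) * A = (1 - P) * (A - Y * X) := by
    rw [Matrix.mul_sub (1 - P), ← Matrix.mul_assoc, Matrix.sub_mul 1 P Y, hY, Matrix.one_mul,
      sub_self, Matrix.zero_mul, sub_zero]
  rw [h]
  exact norm_sq_projection_mul_le hP hPP _

theorem powered_eq {U : Matrix (Fin m) (Fin n) ℂ} {σ : ℕ → ℝ} {V : Matrix (Fin n) (Fin n) ℂ}
    (hsvd : IsSVD A U σ V) (τ : ℕ) :
    powered A τ = U * Matrix.diagonal (fun j : Fin n => ((σ j ^ (2 * τ + 1) : ℝ) : ℂ)) * Vᴴ := by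
  induction τ with
  | zero =>
    rw [powered, pow_zero, Matrix.one_mul]
    simpa using hsvd.eq
  | succ τ ih =>
    have hAA : A * Aᴴ = U * Matrix.diagonal (fun j : Fin n => ((σ j ^ 2 : ℝ) : ℂ)) * Uᴴ := by
      rw [hsvd.eq]
      simp only [Matrix.conjTranspose_mul, Matrix.conjTranspose_conjTranspose,
        Matrix.diagonal_conjTranspose, Matrix.mul_assoc]
      rw [← Matrix.mul_assoc Vᴴ, hsvd.right, Matrix.one_mul, ← Matrix.mul_assoc (Matrix.diagonal _)
        (Matrix.diagonal _), Matrix.diagonal_mul_diagonal]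
      congr 3
      ext j
      simp [sq]
    have h1 : powered A (τ + 1) = A * Aᴴ * powered A τ := by
      rw [powered, powered, pow_succ', Matrix.mul_assoc]
    rw [h1, ih, hAA]
    simp only [Matrix.mul_assoc]
    rw [← Matrix.mul_assoc Uᴴ, hsvd.left, Matrix.one_mul, ← Matrix.mul_assoc (Matrix.diagonal _)
        (Matrix.diagonal _), Matrix.diagonal_mul_diagonal]
    congr 3
    ext j
    push_cast
    ring

end

theorem sum_fin_eq_leading_add_trailing {M : Type*} [AddCommMonoid M] {n r : ℕ} (hr : r ≤ n)
    (f : Fin n → M) : ∑ j, f j = ∑ a : Fin r, f (Fin.castLE hr a)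
      + ∑ b : Fin (n - r), f ⟨r + b, by omega⟩ := by
  obtain ⟨q, rfl⟩ := Nat.exists_eq_add_of_le hr
  rw [Fin.sum_univ_add]
  congr 1
  have hq : r + q - r = q := by omega
  exact (Fintype.sum_equiv (finCongr hq) _ _ fun b => rfl).symm

theorem norm_trailingSigma_mul_sq {n r l : ℕ} (σ : ℕ → ℝ)
    (C : Matrix (Fin (n - r)) (Fin l) ℂ) :
    ‖trailingSigma n r σ * C‖ ^ 2 = ∑ b : Fin (n - r), ∑ a, σ (r + b) ^ 2 * ‖C b a‖ ^ 2 := by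
  rw [frobenius_norm_sq]
  refine Finset.sum_congr rfl fun b _ => Finset.sum_congr rfl fun a _ => ?_
  rw [trailingSigma, Matrix.diagonal_mul, norm_mul, mul_pow, Complex.norm_real, Real.norm_eq_abs,
    sq_abs]

theorem norm_trailingSigma_sq (n r : ℕ) (σ : ℕ → ℝ) :
    ‖trailingSigma n r σ‖ ^ 2 = ∑ b : Fin (n - r), σ (r + b) ^ 2 := by
  have h := norm_trailingSigma_mul_sq σ (1 : Matrix (Fin (n - r)) (Fin (n - r)) ℂ)
  rw [Matrix.mul_one] at h
  rw [h]
  refine Finset.sum_congr rfl fun b _ => ?_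
  rw [Finset.sum_eq_single b]
  · simp
  · intro a _ hab
    rw [Matrix.one_apply_ne (Ne.symm hab)]
    simp
  · simp

theorem mul_pinv_eq_one {r d : ℕ} {L : Matrix (Fin r) (Fin d) ℂ} (h : L.rank = r) :
    L * pinv L = 1 := by
  have hu := isUnit_gram_det_of_rank h
  have h1 := (pinv_spec L).mul_mul_left
  have h2 : (L * pinv L) * (L * Lᴴ) = L * Lᴴ := by rw [← Matrix.mul_assoc, h1]
  calc L * pinv L = L * pinv L * (L * Lᴴ) * (L * Lᴴ)⁻¹ := by
        rw [Matrix.mul_assoc _ (L * Lᴴ), Matrix.mul_nonsing_inv _ hu, Matrix.mul_one]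
    _ = 1 := by rw [h2, Matrix.mul_nonsing_inv _ hu]

section

variable {m n d k s r τ : ℕ} {A : Matrix (Fin m) (Fin n) ℂ}

theorem IsSVD.nonneg {U : Matrix (Fin m) (Fin n) ℂ} {σ : ℕ → ℝ} {V : Matrix (Fin n) (Fin n) ℂ}
    (hsvd : IsSVD A U σ V) (j : ℕ) : 0 ≤ σ j := by
  rw [← hsvd.eq_zero (max j n) (le_max_right _ _)]
  exact hsvd.antitone (le_max_left _ _)

theorem ratio_nonneg_le_one {U : Matrix (Fin m) (Fin n) ℂ} {σ : ℕ → ℝ}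
    {V : Matrix (Fin n) (Fin n) ℂ} (hsvd : IsSVD A U σ V) (hσ : 0 < σ (r - 1)) :
    0 ≤ σ r / σ (r - 1) ∧ σ r / σ (r - 1) ≤ 1 :=
  ⟨div_nonneg (hsvd.nonneg r) hσ.le, (div_le_one hσ).2 (hsvd.antitone (Nat.sub_le r 1))⟩

/-- The approximation `A ≈ (A Aᴴ)^τ A W · Λ₁† Σ₁^{-2τ} V_rᴴ` reproduces the leading `r` singular
directions up to an error in the span of the trailing left singular vectors. -/
theorem exists_norm_sub_powered_mul_le {U : Matrix (Fin m) (Fin n) ℂ} {σ : ℕ → ℝ}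
    {V : Matrix (Fin n) (Fin n) ℂ} (hsvd : IsSVD A U σ V) (hrn : r ≤ n) (hσ : 0 < σ (r - 1))
    {W : Matrix (Fin n) (Fin d) ℝ} (hrank : ((leading hrn V)ᴴ * toC W).rank = r) :
    ∃ X : Matrix (Fin d) (Fin n) ℂ,
      ‖A - powered A τ * toC W * X‖ ^ 2 ≤ structuralBound hrn σ V τ W := by
  set F := pinv ((leading hrn V)ᴴ * toC W) with hF
  set G : Matrix (Fin n) (Fin r) ℂ := Vᴴ * toC W * F with hG
  set D : Matrix (Fin r) (Fin r) ℂ :=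
    Matrix.diagonal fun a => (((σ a ^ (2 * τ))⁻¹ : ℝ) : ℂ) with hD
  set S : Matrix (Fin n) (Fin n) ℂ :=
    Matrix.diagonal fun j : Fin n => ((σ j ^ (2 * τ + 1) : ℝ) : ℂ) with hS
  -- the error in the bases of singular vectors
  set C : Matrix (Fin n) (Fin n) ℂ :=
    Matrix.diagonal (fun j : Fin n => (σ j : ℂ)) - S * G * D * ((leading hrn V)ᴴ * V) with hC
  have hVV : V * Vᴴ = 1 := mul_eq_one_comm.1 hsvd.right
  refine ⟨F * D * (leading hrn V)ᴴ, ?_⟩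
  have hAC : A - powered A τ * toC W * (F * D * (leading hrn V)ᴴ) = U * C * Vᴴ := by
    rw [hC, Matrix.mul_sub, Matrix.sub_mul, ← hsvd.eq, powered_eq hsvd, hG, hS]
    congr 1
    simp only [Matrix.mul_assoc]
    rw [hVV, Matrix.mul_one]
  rw [hAC, norm_sq_mul_isometry hsvd.right, norm_sq_isometry_mul hsvd.left]
  have hlead : ∀ a j, ((leading hrn V)ᴴ * V) a j = if Fin.castLE hrn a = j then 1 else 0 := by
    intro a j
    have h := congrFun (congrFun hsvd.right (Fin.castLE hrn a)) j
    rw [Matrix.one_apply] at h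
    rw [← h]
    rfl
  have hG1 : ∀ a' a, G (Fin.castLE hrn a') a = if a' = a then 1 else 0 := by
    intro a' a
    have h := congrFun (congrFun (mul_pinv_eq_one hrank) a') a
    rw [Matrix.one_apply] at h
    rw [← h]
    rfl
  have hG2 : ∀ (b : Fin (n - r)) a, G ⟨r + b, by omega⟩ a
      = (((trailing r V)ᴴ * toC W) * F) b a := fun b a => rfl
  have hCl : ∀ i a, C i (Fin.castLE hrn a) = (if i = Fin.castLE hrn a then (σ i : ℂ) else 0)
      - ((σ i ^ (2 * τ + 1) : ℝ) : ℂ) * G i a * (((σ a ^ (2 * τ))⁻¹ : ℝ) : ℂ) := by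
    intro i a
    rw [hC, Matrix.sub_apply, Matrix.diagonal_apply, Matrix.mul_apply,
      Finset.sum_eq_single a]
    · rw [hlead, if_pos rfl, mul_one, hD, Matrix.mul_diagonal, hS, Matrix.diagonal_mul]
    · intro a' _ hne
      rw [hlead, if_neg fun h => hne (Fin.castLE_injective hrn h), mul_zero]
    · simp
  have hCt : ∀ i (b : Fin (n - r)), C i ⟨r + b, by omega⟩
      = if i = ⟨r + b, by omega⟩ then (σ i : ℂ) else 0 := by
    intro i b
    rw [hC, Matrix.sub_apply, Matrix.diagonal_apply, Matrix.mul_apply, Finset.sum_eq_zero, sub_zero]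
    intro a _
    rw [hlead, if_neg, mul_zero]
    intro h
    have := congrArg Fin.val h
    simp at this
    omega
  have hσa : ∀ a : Fin r, 0 < σ a := fun a =>
    hσ.trans_le (hsvd.antitone (by have := a.2; omega))
  -- The leading rows of `C` vanish; the trailing rows carry `Σ₀^{2τ+1} Λ₂ Λ₁† Σ₁^{-2τ}`.
  have hcol1 : ∀ a : Fin r, ∑ i, ‖C i (Fin.castLE hrn a)‖ ^ 2
      ≤ ∑ b : Fin (n - r), (σ r / σ (r - 1)) ^ (2 * τ) *
        (σ (r + b) ^ 2 * ‖(((trailing r V)ᴴ * toC W) * F) b a‖ ^ 2) := by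
    intro a
    rw [sum_fin_eq_leading_add_trailing hrn, Finset.sum_eq_zero, zero_add]
    · refine Finset.sum_le_sum fun b _ => ?_
      have hne : (⟨r + b, by omega⟩ : Fin n) ≠ Fin.castLE hrn a := by
        intro h
        have := congrArg Fin.val h
        simp at this
        omega
      rw [hCl, if_neg hne, zero_sub, norm_neg, norm_mul, norm_mul, Complex.norm_real,
        Complex.norm_real, hG2, Real.norm_eq_abs, Real.norm_eq_abs]
      have h0 := hsvd.nonneg (r + b)
      have h1 := hσa a
      have h2 : σ (r + b) / σ a ≤ σ r / σ (r - 1) := by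
        have h3 : σ (r + b) ≤ σ r := hsvd.antitone (Nat.le_add_right _ _)
        have h4 : σ (r - 1) ≤ σ a := hsvd.antitone (by have := a.2; omega)
        exact div_le_div₀ (hsvd.nonneg r) h3 hσ h4
      obtain ⟨h5, h6⟩ := ratio_nonneg_le_one hsvd hσ
      -- Since the ratio is at most one, the exponent `4 τ` may be lowered to `2 τ`.
      have h7 : (σ (r + b) / σ a) ^ (4 * τ) ≤ (σ r / σ (r - 1)) ^ (2 * τ) :=
        (pow_le_pow_left₀ (div_nonneg h0 h1.le) h2 _).trans
          (pow_le_pow_of_le_one h5 h6 (by omega))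
      rw [abs_of_nonneg (by positivity), abs_of_nonneg (by positivity)]
      calc (σ (r + b) ^ (2 * τ + 1) * ‖(((trailing r V)ᴴ * toC W) * F) b a‖
            * (σ a ^ (2 * τ))⁻¹) ^ 2
          = (σ (r + b) / σ a) ^ (4 * τ) *
            (σ (r + b) ^ 2 * ‖(((trailing r V)ᴴ * toC W) * F) b a‖ ^ 2) := by
            rw [div_pow, show 4 * τ = 2 * τ * 2 by ring, pow_mul _ (2 * τ) 2, pow_mul _ (2 * τ) 2]
            field_simp
            ring
        _ ≤ _ := by gcongr
    · intro a' _
      rw [hCl, hG1]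
      by_cases h : a' = a
      · subst h
        have h1 : (σ a' : ℂ) ≠ 0 := by exact_mod_cast (hσa a').ne'
        rw [if_pos rfl, if_pos rfl]
        have h2 : (σ a' : ℂ) ^ (2 * τ + 1) * ((σ a' : ℂ) ^ (2 * τ))⁻¹ = σ a' := by
          field_simp
          ring
        rw [Fin.val_castLE, mul_one]
        push_cast
        rw [h2, sub_self]
        simp
      · rw [if_neg h, if_neg fun h' => h (Fin.castLE_injective hrn h')]
        simp
  have hcol2 : ∀ b : Fin (n - r), ∑ i, ‖C i ⟨r + b, by omega⟩‖ ^ 2 = σ (r + b) ^ 2 := by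
    intro b
    rw [Finset.sum_eq_single ⟨r + b, by omega⟩]
    · rw [hCt, if_pos rfl, Complex.norm_real, Real.norm_eq_abs, sq_abs]
    · intro i _ hi
      rw [hCt, if_neg hi]
      simp
    · simp
  rw [frobenius_norm_sq, Finset.sum_comm, sum_fin_eq_leading_add_trailing hrn, structuralBound,
    Matrix.mul_assoc, norm_trailingSigma_mul_sq, norm_trailingSigma_sq, ← hF]
  simp only [hcol2]
  have key : ∑ a, ∑ i, ‖C i (Fin.castLE hrn a)‖ ^ 2 ≤ (σ r / σ (r - 1)) ^ (2 * τ) *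
      ∑ b : Fin (n - r), ∑ a, σ (r + b) ^ 2 * ‖(((trailing r V)ᴴ * toC W) * F) b a‖ ^ 2 := by
    conv_rhs => rw [Finset.sum_comm, Finset.mul_sum]
    refine Finset.sum_le_sum fun a _ => ?_
    rw [Finset.mul_sum]
    exact hcol1 a
  linarith

/-! ### From powers of `A` to `A` -/

theorem norm_sq_mul_diagonal {p : ℕ} (T : Matrix (Fin p) (Fin n) ℂ) (f : Fin n → ℝ) :
    ‖T * Matrix.diagonal fun j => (f j : ℂ)‖ ^ 2 = ∑ j, (∑ i, ‖T i j‖ ^ 2) * f j ^ 2 := by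
  rw [frobenius_norm_sq, Finset.sum_comm]
  refine Finset.sum_congr rfl fun j _ => ?_
  rw [Finset.sum_mul]
  refine Finset.sum_congr rfl fun i _ => ?_
  rw [Matrix.mul_diagonal, norm_mul, mul_pow, Complex.norm_real, Real.norm_eq_abs, sq_abs]

/-- The residual of `A` in terms of the residual of `(A Aᴴ)^τ A`: weighting by `σⱼ^{4τ}` loses
nothing on the leading singular directions, and a unit vector has residual at most one. -/
theorem norm_sq_residual_le_powered {U : Matrix (Fin m) (Fin n) ℂ} {σ : ℕ → ℝ}
    {V : Matrix (Fin n) (Fin n) ℂ} (hsvd : IsSVD A U σ V) {P : Matrix (Fin m) (Fin m) ℂ}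
    (hP : Pᴴ = P) (hPP : P * P = P) :
    σ (r - 1) ^ (4 * τ) * ‖(1 - P) * A‖ ^ 2 ≤ ‖(1 - P) * powered A τ‖ ^ 2
      + ∑ j ∈ tailIdx n r, (σ (r - 1) ^ (4 * τ) - σ j ^ (4 * τ)) * σ j ^ 2 := by
  set a : Fin n → ℝ := fun j => ∑ i, ‖((1 - P) * U : Matrix (Fin m) (Fin n) ℂ) i j‖ ^ 2 with ha
  have ha0 : ∀ j, 0 ≤ a j := fun j => by positivity
  have ha1 : ∀ j, a j ≤ 1 := by
    intro j
    refine (sum_norm_sq_projection_le hP hPP fun i => U i j).trans_eq ?_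
    have h := congrFun (congrFun hsvd.left j) j
    rw [Matrix.mul_apply, Matrix.one_apply_eq] at h
    have h2 : ((∑ i, ‖U i j‖ ^ 2 : ℝ) : ℂ) = 1 := by
      rw [← h]
      push_cast
      exact Finset.sum_congr rfl fun i _ => (Complex.conj_mul' _).symm
    exact_mod_cast h2
  have h1 : ‖(1 - P) * A‖ ^ 2 = ∑ j, a j * σ j ^ 2 := by
    conv_lhs => rw [hsvd.eq]
    rw [← Matrix.mul_assoc, norm_sq_mul_isometry hsvd.right, ← Matrix.mul_assoc]
    exact norm_sq_mul_diagonal _ fun j => σ j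
  have h2 : ‖(1 - P) * powered A τ‖ ^ 2 = ∑ j, a j * (σ j ^ (2 * τ + 1)) ^ 2 := by
    rw [powered_eq hsvd, ← Matrix.mul_assoc, norm_sq_mul_isometry hsvd.right, ← Matrix.mul_assoc]
    exact norm_sq_mul_diagonal _ fun j => σ j ^ (2 * τ + 1)
  rw [h1, h2, tailIdx, Finset.sum_filter, Finset.mul_sum, ← Finset.sum_add_distrib]
  refine Finset.sum_le_sum fun j _ => ?_
  have e : (σ j ^ (2 * τ + 1)) ^ 2 = σ j ^ (4 * τ) * σ j ^ 2 := by ring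
  rw [e]
  split_ifs with hj
  · have h3 : σ j ^ (4 * τ) ≤ σ (r - 1) ^ (4 * τ) :=
      pow_le_pow_left₀ (hsvd.nonneg _) (hsvd.antitone (by omega)) _
    have h4 : 0 ≤ (σ (r - 1) ^ (4 * τ) - σ j ^ (4 * τ)) * σ j ^ 2 :=
      mul_nonneg (sub_nonneg.2 h3) (sq_nonneg _)
    nlinarith [mul_le_mul_of_nonneg_right (ha1 j) h4]
  · have h3 : σ (r - 1) ^ (4 * τ) ≤ σ j ^ (4 * τ) :=
      pow_le_pow_left₀ (hsvd.nonneg _) (hsvd.antitone (by omega)) _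
    nlinarith [mul_le_mul_of_nonneg_right h3 (mul_nonneg (ha0 j) (sq_nonneg (σ j)))]

theorem sum_tailIdx {σ : ℕ → ℝ} : ∑ j ∈ tailIdx n r, σ j ^ 2 = ∑ j ∈ Finset.Ico r n, σ j ^ 2 := by
  have h : (tailIdx n r).map Fin.valEmbedding = Finset.Ico r n := by
    ext j
    simp only [Finset.mem_map, mem_tailIdx, Fin.valEmbedding_apply, Finset.mem_Ico]
    constructor
    · rintro ⟨i, hi, rfl⟩
      exact ⟨hi, i.2⟩
    · rintro ⟨h1, h2⟩
      exact ⟨⟨j, h2⟩, h1, rfl⟩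
  rw [← h, Finset.sum_map]
  rfl

/-- The bound on the mean squared residual of `A`, for any family of orthogonal projections whose
ranges contain the samples of `(A Aᴴ)^τ A`. -/
theorem lintegral_residual_powered_le {U : Matrix (Fin m) (Fin n) ℂ} {σ : ℕ → ℝ}
    {V : Matrix (Fin n) (Fin n) ℂ} (hsvd : IsSVD A U σ V) (hrn : r ≤ n) (hrd : r + 2 ≤ d)
    (hσ : 0 < σ (r - 1)) (P : (Fin d → Fin n → ℝ) → Matrix (Fin m) (Fin m) ℂ)
    (hP : ∀ X, (P X)ᴴ = P X ∧ P X * P X = P X ∧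
      P X * (powered A τ * sampleMat X) = powered A τ * sampleMat X) :
    ∫⁻ X, ENNReal.ofReal (‖(1 - P X) * A‖ ^ 2) ∂gaussMat (Fin d) (Fin n)
      ≤ ENNReal.ofReal ((1 + r * (σ r / σ (r - 1)) ^ (2 * τ) / ((d : ℝ) - r - 1))
        * ∑ j ∈ Finset.Ico r n, σ j ^ 2) := by
  have hd' : (r : ℝ) + 2 ≤ d := by exact_mod_cast hrd
  rw [← sum_tailIdx]
  set c := σ (r - 1) ^ (4 * τ) with hc
  have hc0 : 0 < c := by positivity
  have hB : (powered A τ)ᴴ * powered A τ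
      = V * Matrix.diagonal (fun j : Fin n => (((σ j ^ (2 * τ + 1)) ^ 2 : ℝ) : ℂ)) * Vᴴ := by
    rw [powered_eq hsvd]
    simp only [Matrix.conjTranspose_mul, Matrix.conjTranspose_conjTranspose,
      Matrix.diagonal_conjTranspose, Matrix.mul_assoc]
    rw [← Matrix.mul_assoc Uᴴ, hsvd.left, Matrix.one_mul, ← Matrix.mul_assoc (Matrix.diagonal _)
        (Matrix.diagonal _), Matrix.diagonal_mul_diagonal]
    congr 3
    ext j
    simp [sq]
  have hM := lintegral_residual_le hrn hrd hsvd.right hB P (.of_forall hP)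
  set K := ∑ j ∈ tailIdx n r, (c - σ j ^ (4 * τ)) * σ j ^ 2 with hK
  have hK0 : 0 ≤ K := by
    refine Finset.sum_nonneg fun j hj => mul_nonneg (sub_nonneg.2 ?_) (sq_nonneg _)
    have := mem_tailIdx.1 hj
    exact pow_le_pow_left₀ (hsvd.nonneg _) (hsvd.antitone (by omega)) _
  set S' := ∑ j ∈ tailIdx n r, (σ j ^ (2 * τ + 1)) ^ 2 with hS'
  set S := ∑ j ∈ tailIdx n r, σ j ^ 2 with hS
  have hS0 : 0 ≤ S := Finset.sum_nonneg fun j _ => sq_nonneg _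
  have hS'0 : 0 ≤ S' := Finset.sum_nonneg fun j _ => sq_nonneg _
  have hKS : K = c * S - S' := by
    rw [hK, hS, hS', Finset.mul_sum, ← Finset.sum_sub_distrib]
    exact Finset.sum_congr rfl fun j _ => by ring
  have hS'S : S' ≤ c * ((σ r / σ (r - 1)) ^ (2 * τ) * S) := by
    obtain ⟨h5, h6⟩ := ratio_nonneg_le_one (r := r) hsvd hσ
    rw [hS', hS, Finset.mul_sum, Finset.mul_sum]
    refine Finset.sum_le_sum fun j hj => ?_
    have h1 : σ j ^ (4 * τ) ≤ σ r ^ (4 * τ) :=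
      pow_le_pow_left₀ (hsvd.nonneg _) (hsvd.antitone (mem_tailIdx.1 hj)) _
    have h2 : σ r ^ (4 * τ) = c * (σ r / σ (r - 1)) ^ (4 * τ) := by
      rw [hc, div_pow]
      field_simp
    have h3 : (σ r / σ (r - 1)) ^ (4 * τ) ≤ (σ r / σ (r - 1)) ^ (2 * τ) :=
      pow_le_pow_of_le_one h5 h6 (by omega)
    calc (σ j ^ (2 * τ + 1)) ^ 2 = σ j ^ (4 * τ) * σ j ^ 2 := by ring
      _ ≤ c * (σ r / σ (r - 1)) ^ (2 * τ) * σ j ^ 2 := by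
        gcongr
        exact h1.trans (h2.trans_le (mul_le_mul_of_nonneg_left h3 hc0.le))
      _ = _ := by ring
  have hd1 : (0 : ℝ) < (d : ℝ) - r - 1 := by linarith
  -- With `K = c S - S'`, the bound `(1 + r / (d - r - 1)) S' + K` is `c S + r / (d - r - 1) S'`, so
  -- that only the excess over `c S` carries the factor `α^{2τ}`.
  have hkey : ENNReal.ofReal c * ∫⁻ X, ENNReal.ofReal (‖(1 - P X) * A‖ ^ 2)
      ∂gaussMat (Fin d) (Fin n) ≤ ENNReal.ofReal c * ENNReal.ofReal
        ((1 + r * (σ r / σ (r - 1)) ^ (2 * τ) / ((d : ℝ) - r - 1)) * S) := by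
    rw [← lintegral_const_mul' _ _ ENNReal.ofReal_ne_top]
    calc _ ≤ ∫⁻ X, (ENNReal.ofReal (‖(1 - P X) * powered A τ‖ ^ 2) + ENNReal.ofReal K)
          ∂gaussMat (Fin d) (Fin n) := by
          refine lintegral_mono fun X => ?_
          rw [← ENNReal.ofReal_mul hc0.le, ← ENNReal.ofReal_add (sq_nonneg _) hK0]
          exact ENNReal.ofReal_le_ofReal
            (norm_sq_residual_le_powered hsvd (hP X).1 (hP X).2.1)
      _ ≤ ENNReal.ofReal (((d : ℝ) - 1) / ((d : ℝ) - r - 1) * S') + ENNReal.ofReal K := by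
          rw [lintegral_add_right _ measurable_const]
          gcongr
          simp
      _ ≤ _ := by
          have hnn : 0 ≤ ((d : ℝ) - 1) / ((d : ℝ) - r - 1) * S' := by
            refine mul_nonneg (div_nonneg ?_ hd1.le) hS'0
            have : (0 : ℝ) ≤ r := r.cast_nonneg
            linarith
          rw [← ENNReal.ofReal_add hnn hK0, ← ENNReal.ofReal_mul hc0.le]
          refine ENNReal.ofReal_le_ofReal ?_
          rw [hKS]
          have e : ((d : ℝ) - 1) / ((d : ℝ) - r - 1) = 1 + r / ((d : ℝ) - r - 1) := by
            field_simp
            ring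
          rw [e]
          have h9 : (r : ℝ) / ((d : ℝ) - r - 1) * S'
              ≤ r / ((d : ℝ) - r - 1) * (c * ((σ r / σ (r - 1)) ^ (2 * τ) * S)) :=
            mul_le_mul_of_nonneg_left hS'S (div_nonneg r.cast_nonneg hd1.le)
          calc _ = c * S + r / ((d : ℝ) - r - 1) * S' := by ring
            _ ≤ c * S + r / ((d : ℝ) - r - 1) * (c * ((σ r / σ (r - 1)) ^ (2 * τ) * S)) := by gcongr
            _ = _ := by ring
  exact (ENNReal.mul_le_mul_iff_right (ENNReal.ofReal_pos.2 hc0).ne' ENNReal.ofReal_ne_top).1 hkey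

end

/-! ### The residual as a random variable -/

/-- The orthogonal projection onto the range of `Y`. -/
noncomputable def rangeProj {p q : ℕ} (Y : Matrix (Fin p) (Fin q) ℂ) : Matrix (Fin p) (Fin p) ℂ :=
  Y * pinv Y

theorem rangeProj_spec {p q : ℕ} (Y : Matrix (Fin p) (Fin q) ℂ) :
    (rangeProj Y)ᴴ = rangeProj Y ∧ rangeProj Y * rangeProj Y = rangeProj Y ∧
      rangeProj Y * Y = Y := by
  have h := pinv_spec Y
  refine ⟨h.herm_left, ?_, h.mul_mul_left⟩
  rw [rangeProj, ← Matrix.mul_assoc, h.mul_mul_left]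

/-- An orthogonal projection that fixes `Y` and factors through `Y` is the one onto the range of
`Y`. -/
theorem eq_rangeProj {p q : ℕ} {Y : Matrix (Fin p) (Fin q) ℂ} {P : Matrix (Fin p) (Fin p) ℂ}
    (hP : Pᴴ = P) (hY : P * Y = Y) {X : Matrix (Fin q) (Fin p) ℂ} (hX : P = Y * X) :
    P = rangeProj Y := by
  obtain ⟨h1, -, h3⟩ := rangeProj_spec Y
  have e1 : rangeProj Y * P = P := by
    conv_lhs => rw [hX, ← Matrix.mul_assoc, h3]
    exact hX.symm
  have e2 : P * rangeProj Y = rangeProj Y := by rw [rangeProj, ← Matrix.mul_assoc, hY]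
  rw [← e2, ← hP, ← h1, ← Matrix.conjTranspose_mul, e1, hP]

/-- The residual is an infimum of continuous functions of `X`, hence upper semicontinuous. -/
theorem measurable_norm_sq_residual {m n d l : ℕ} (A : Matrix (Fin m) (Fin l) ℂ)
    (B : Matrix (Fin m) (Fin n) ℂ) :
    Measurable fun X : Fin d → Fin n → ℝ => ‖(1 - rangeProj (B * sampleMat X)) * A‖ ^ 2 := by
  have hbdd : ∀ X : Fin d → Fin n → ℝ,
      BddBelow (Set.range fun Z : Matrix (Fin d) (Fin l) ℂ => ‖A - B * sampleMat X * Z‖ ^ 2) :=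
    fun X => ⟨0, by rintro _ ⟨Z, rfl⟩; exact sq_nonneg _⟩
  have h : (fun X : Fin d → Fin n → ℝ => ‖(1 - rangeProj (B * sampleMat X)) * A‖ ^ 2)
      = fun X => ⨅ Z : Matrix (Fin d) (Fin l) ℂ, ‖A - B * sampleMat X * Z‖ ^ 2 := by
    funext X
    obtain ⟨h1, h2, h3⟩ := rangeProj_spec (B * sampleMat X)
    refine le_antisymm (le_ciInf fun Z => norm_sq_residual_le h1 h2 h3 A Z) ?_
    refine (ciInf_le (hbdd X) (pinv (B * sampleMat X) * A)).trans_eq ?_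
    rw [Matrix.sub_mul, Matrix.one_mul, rangeProj, Matrix.mul_assoc _ (pinv _)]
  rw [h]
  refine (upperSemicontinuous_ciInf hbdd fun Z => Continuous.upperSemicontinuous ?_).measurable
  simp only [frobenius_norm_sq, Matrix.sub_apply, Matrix.mul_apply, sampleMat]
  fun_prop

theorem measurable_norm_residual {m n d l : ℕ} (A : Matrix (Fin m) (Fin l) ℂ)
    (B : Matrix (Fin m) (Fin n) ℂ) :
    Measurable fun X : Fin d → Fin n → ℝ => ‖(1 - rangeProj (B * sampleMat X)) * A‖ := by
  have h := (measurable_norm_sq_residual (d := d) A B).sqrt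
  simpa only [Real.sqrt_sq (norm_nonneg _)] using h

theorem norm_residual_le {p q l : ℕ} (A : Matrix (Fin p) (Fin l) ℂ) (Y : Matrix (Fin p) (Fin q) ℂ) :
    ‖(1 - rangeProj Y) * A‖ ≤ ‖A‖ := by
  obtain ⟨h1, h2, -⟩ := rangeProj_spec Y
  exact (sq_le_sq₀ (norm_nonneg _) (norm_nonneg _)).1 (norm_sq_projection_mul_le h1 h2 A)

theorem IsStdGaussian.aemeasurable_swap {Ω : Type*} [MeasurableSpace Ω] {P : Measure Ω} {n d : ℕ}
    {G : Ω → Matrix (Fin n) (Fin d) ℝ} (hG : IsStdGaussian P G) :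
    AEMeasurable (fun ω (k : Fin d) (i : Fin n) => G ω i k) P :=
  aemeasurable_pi_lambda _ fun k => aemeasurable_pi_lambda _ fun i => (hG.law i k).aemeasurable

/-- The columns of a standard Gaussian matrix are independent standard Gaussian vectors. -/
theorem IsStdGaussian.map_swap {Ω : Type*} [MeasurableSpace Ω] {P : Measure Ω}
    [IsProbabilityMeasure P] {n d : ℕ}
    {G : Ω → Matrix (Fin n) (Fin d) ℝ} (hG : IsStdGaussian P G) :
    P.map (fun ω (k : Fin d) (i : Fin n) => G ω i k) = gaussMat (Fin d) (Fin n) := by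
  have h := hG.indep.precomp (g := (Prod.swap : Fin d × Fin n → Fin n × Fin d))
    Prod.swap_injective
  have hm : ∀ x : Fin d × Fin n, AEMeasurable (fun ω => G ω x.2 x.1) P :=
    fun x => (hG.law x.2 x.1).aemeasurable
  have h2 := (iIndepFun_iff_map_fun_eq_pi_map hm).1 h
  have h3 : P.map (fun ω (x : Fin d × Fin n) => G ω x.2 x.1) = gaussVec (Fin d × Fin n) := by
    rw [h2, gaussVec]
    congr 1
    funext x
    exact (hG.law x.2 x.1).map_eq
  rw [← gaussVec_prod_map_curry, ← h3, AEMeasurable.map_map_of_aemeasurable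
    (Measurable.aemeasurable (by fun_prop)) (aemeasurable_pi_lambda _ hm)]
  rfl

section

variable {m n d k s r τ : ℕ} {A U : Matrix (Fin m) (Fin n) ℂ} {σ : ℕ → ℝ}
  {V : Matrix (Fin n) (Fin n) ℂ}

/-- Almost every sample is in general position: as many columns of `A W` are independent as the
rank of `A` permits. -/
theorem ae_linearIndependent_col (A : Matrix (Fin m) (Fin n) ℂ) (d : ℕ) :
    ∀ᵐ X ∂gaussMat (Fin d) (Fin n), ∀ (p : ℕ) (hp : p ≤ d), p ≤ A.rank →
      LinearIndependent ℂ fun (l : Fin p) i => (A * sampleMat X) i (l.castLE hp) := by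
  simp only [ae_all_iff]
  intro p hp hpA
  exact ae_linearIndependent_mulVec_comp A hpA (Fin.castLE_injective hp)

theorem Run.norm_sq_residual_le_structuralBound (hsvd : IsSVD A U σ V) (hrn : r ≤ n)
    (hσ : 0 < σ (r - 1)) {hd : d = s * k} {W : Matrix (Fin n) (Fin d) ℝ}
    (hrank : ((leading hrn V)ᴴ * toC W).rank = r) {ε : ℝ} (hε : 0 < ε) (ρ : Run A hd W ε τ)
    (hsize : ρ.ext.size = (A * toC W).rank) :
    ‖A - ρ.approx‖ ^ 2 ≤ structuralBound hrn σ V τ W := by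
  obtain ⟨P, hP, hPP, hres, hPY, -⟩ := ρ.exists_projection hε hsize
  obtain ⟨X, hX⟩ := exists_norm_sub_powered_mul_le (τ := τ) hsvd hrn hσ hrank
  rw [hres]
  exact (norm_sq_residual_le hP hPP hPY A X).trans hX

/-- The error of a run that extracts enough columns does not depend on the choices made in it. -/
theorem Run.norm_sub_approx_eq {hd : d = s * k} {W : Matrix (Fin n) (Fin d) ℝ} {ε : ℝ}
    (hε : 0 < ε) (ρ : Run A hd W ε τ) (hsize : ρ.ext.size = (A * toC W).rank) :
    ‖A - ρ.approx‖ = ‖(1 - rangeProj (powered A τ * toC W)) * A‖ := by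
  obtain ⟨P, hP, -, hres, hPY, X, hX⟩ := ρ.exists_projection hε hsize
  rw [hres, eq_rangeProj hP hPY hX]

/-- The bound on the mean residual: the second moment dominates the first. -/
theorem integral_residual_le (hsvd : IsSVD A U σ V) (hrn : r ≤ n) (hrd : r + 2 ≤ d)
    (hσ : 0 < σ (r - 1)) :
    ∫ X, ‖(1 - rangeProj (powered A τ * sampleMat X)) * A‖ ∂gaussMat (Fin d) (Fin n)
      ≤ Real.sqrt (1 + r * (σ r / σ (r - 1)) ^ (2 * τ) / ((d : ℝ) - r - 1))
        * Real.sqrt (∑ j ∈ Finset.Ico r n, σ j ^ 2) := by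
  set f : (Fin d → Fin n → ℝ) → ℝ :=
    fun X => ‖(1 - rangeProj (powered A τ * sampleMat X)) * A‖ with hf
  have hfm : Measurable f := measurable_norm_residual A (powered A τ)
  have hf0 : ∀ X, 0 ≤ f X := fun X => norm_nonneg _
  have hfA : ∀ X, f X ≤ ‖A‖ := fun X => norm_residual_le A _
  have hL := lintegral_residual_powered_le (τ := τ) hsvd hrn hrd hσ
    (fun X => rangeProj (powered A τ * sampleMat X)) fun X => rangeProj_spec _
  have hd1 : (0 : ℝ) < (d : ℝ) - r - 1 := by
    have : (r : ℝ) + 2 ≤ d := by exact_mod_cast hrd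
    linarith
  have hc0 : 0 ≤ 1 + r * (σ r / σ (r - 1)) ^ (2 * τ) / ((d : ℝ) - r - 1) := by
    have := (ratio_nonneg_le_one (r := r) hsvd hσ).1
    positivity
  have hS0 : 0 ≤ ∑ j ∈ Finset.Ico r n, σ j ^ 2 := Finset.sum_nonneg fun j _ => sq_nonneg _
  have hmem : MemLp f 2 (gaussMat (Fin d) (Fin n)) :=
    MemLp.of_bound hfm.aestronglyMeasurable ‖A‖
      (.of_forall fun X => by rw [Real.norm_of_nonneg (hf0 X)]; exact hfA X)
  have h2 : ∫ X, f X ^ 2 ∂gaussMat (Fin d) (Fin n)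
      ≤ (1 + r * (σ r / σ (r - 1)) ^ (2 * τ) / ((d : ℝ) - r - 1))
        * ∑ j ∈ Finset.Ico r n, σ j ^ 2 := by
    rw [integral_eq_lintegral_of_nonneg_ae (.of_forall fun X => sq_nonneg _)
      (hfm.pow_const 2).aestronglyMeasurable]
    exact ENNReal.toReal_le_of_le_ofReal (mul_nonneg hc0 hS0) hL
  rw [← Real.sqrt_mul hc0]
  refine Real.le_sqrt_of_sq_le (le_trans ?_ h2)
  have hvar := variance_nonneg f (gaussMat (Fin d) (Fin n))
  rw [variance_eq_sub hmem] at hvar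
  simpa using hvar

end

end EOD

theorem mainTheorem1 {m n d k s r τ : ℕ} (hmn : n ≤ m) (hk : 1 ≤ k) (hkn : k ≤ n)
    (hd : d = s * k) (hr2 : 2 ≤ r) (hrn : r ≤ n) (hrd : r + 2 ≤ d)
    (A U : Matrix (Fin m) (Fin n) ℂ) (σ : ℕ → ℝ) (V : Matrix (Fin n) (Fin n) ℂ)
    (hsvd : EOD.IsSVD A U σ V) (hσ : 0 < σ (r - 1))
    {Ω : Type*} [MeasurableSpace Ω] (P : Measure Ω) [IsProbabilityMeasure P]
    (G : Ω → Matrix (Fin n) (Fin d) ℝ) (hG : EOD.IsStdGaussian P G) :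
    -- the structural bound for a fixed test matrix
    (∀ W : Matrix (Fin n) (Fin d) ℝ, ((EOD.leading hrn V)ᴴ * EOD.toC W).rank = r →
      ∀ ε : ℝ, 0 < ε → ∀ ρ : EOD.Run A hd W ε τ, ρ.ext.size = (A * EOD.toC W).rank →
        ‖A - ρ.approx‖ ^ 2 ≤ EOD.structuralBound hrn σ V τ W) ∧
    -- the same bound, almost surely, for the standard Gaussian test matrix
    (∀ᵐ ω ∂P, ((EOD.leading hrn V)ᴴ * EOD.toC (G ω)).rank = r ∧
      ∀ ε : ℝ, 0 < ε → ∀ ρ : EOD.Run A hd (G ω) ε τ, ρ.ext.Exact →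
        ‖A - ρ.approx‖ ^ 2 ≤ EOD.structuralBound hrn σ V τ (G ω)) ∧
    -- the bound in expectation
    (∀ (ε : Ω → ℝ) (ρ : ∀ ω, EOD.Run A hd (G ω) (ε ω) τ),
      (∀ᵐ ω ∂P, 0 < ε ω ∧ (ρ ω).ext.Exact) →
        Integrable (fun ω => ‖A - (ρ ω).approx‖) P ∧
        ∫ ω, ‖A - (ρ ω).approx‖ ∂P ≤
          Real.sqrt (1 + r * (σ r / σ (r - 1)) ^ (2 * τ) / ((d : ℝ) - r - 1))
            * Real.sqrt (∑ j ∈ Finset.Ico r n, σ j ^ 2)) := by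
  have hstruct := fun (W : Matrix (Fin n) (Fin d) ℝ) hrank (ε : ℝ) (hε : 0 < ε)
    (ρ : EOD.Run A hd W ε τ) =>
      ρ.norm_sq_residual_le_structuralBound hsvd hrn hσ hrank hε
  have hlaw := hG.map_swap
  have hmeas := hG.aemeasurable_swap
  have hgen : ∀ᵐ ω ∂P, ∀ (p : ℕ) (hp : p ≤ d), p ≤ A.rank →
      LinearIndependent ℂ fun (l : Fin p) i => (A * EOD.toC (G ω)) i (l.castLE hp) := by
    have h := EOD.ae_linearIndependent_col A d
    rw [← hlaw] at h
    exact ae_of_ae_map hmeas h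
  refine ⟨hstruct, ?_, ?_⟩
  · have hrank := EOD.ae_rank_leading_mul_sampleMat hrn hsvd.right (by omega : r ≤ d)
    rw [← hlaw] at hrank
    filter_upwards [ae_of_ae_map hmeas hrank, hgen] with ω h1 h2
    refine ⟨h1, fun ε hε ρ hρ => ?_⟩
    exact hstruct _ h1 ε hε ρ (ρ.ext.size_eq_rank_of_exact hε hρ h2)
  · intro ε ρ hρ
    set f : (Fin d → Fin n → ℝ) → ℝ :=
      fun X => ‖(1 - EOD.rangeProj (EOD.powered A τ * EOD.sampleMat X)) * A‖ with hf
    have hfm : Measurable f := EOD.measurable_norm_residual A (EOD.powered A τ)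
    -- Almost surely the error does not depend on the run, which makes it measurable.
    have hae : (fun ω => ‖A - (ρ ω).approx‖) =ᵐ[P] fun ω => f fun k i => G ω i k := by
      filter_upwards [hρ, hgen] with ω h1 h2
      exact (ρ ω).norm_sub_approx_eq h1.1 ((ρ ω).ext.size_eq_rank_of_exact h1.1 h1.2 h2)
    have hint : Integrable (fun ω => f fun k i => G ω i k) P :=
      .of_bound (hfm.comp_aemeasurable hmeas).aestronglyMeasurable ‖A‖ (.of_forall fun ω => by
        rw [Real.norm_of_nonneg (norm_nonneg _)]
        exact EOD.norm_residual_le A _)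
    refine ⟨hint.congr hae.symm, ?_⟩
    rw [integral_congr_ae hae, ← integral_map hmeas hfm.aestronglyMeasurable, hlaw]
    exact EOD.integral_residual_le hsvd hrn hrd hσ
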